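/- Let $N,M\ge 1$, $\omega=e^{2\pi i/N}$, $\omega^{1/2}=e^{i\pi/N}$, $\kappa\in\mathbb C$, $K=\kappa^N$. On $(\mathbb C^N)^{\otimes M}$ with basis $|\alpha_1,\dots,\alpha_M\rangle$, $\alpha_m\in\mathbb Z_N$, let $\mathbf x_m$ multiply by $\omega^{\alpha_m}$ and let $\mathbf z_m$ raise $\alpha_m$ by $1$. For $u_m,w_m\in\mathbb C$ and $\lambda\in\mathbb C\setminus\{0\}$ put $\mathbf u_m=u_m\mathbf x_m$, $\mathbf w_m=w_m\mathbf z_m$, $$\ell_m(\lambda)=\begin{pmatrix}1+\frac{\kappa}{\lambda}\mathbf u_m\mathbf w_m & -\frac{\omega^{1/2}}{\lambda}\mathbf u_m\\ \mathbf w_m&0\end{pmatrix},\qquad \mathbf t(\lambda)=\operatorname{tr}\,\ell_1(\lambda)\ell_2(\lambda)\cdots\ell_M(\lambda).$$ Let $\phi_1,\dots,\phi_{M-1}$ be distinct elements of $\{\frac{\pi}{M},\frac{2\pi}{M},\dots,\frac{(M-1)\pi}{M}\}$ (hence an enumeration of this set). With the principal square root put $$\Delta(\phi)=e^{i\phi}\bigl(\sqrt{\cos^2\phi+K}+\cos\phi\bigr),\qquad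 \Delta^*(\phi)=e^{-i\phi}\bigl(\sqrt{\cos^2\phi+K}+\cos\phi\bigr),$$ $$d(\phi,\phi')=\frac{(\Delta(\phi)-\Delta(\phi'))(\Delta^*(\phi)-\Delta^*(\phi'))}{(\Delta(\phi)-\Delta^*(\phi'))(\Delta^*(\phi)-\Delta(\phi'))},\qquad c(\phi)=\frac{\Delta^*(\phi)}{\Delta(\phi)}\,\frac{1-\Delta(\phi)}{1-\Delta^*(\phi)},$$ and assume that $\kappa$ is such that no denominator in $c(\phi_k)$ and in $d(\phi_j,\phi_k)$, $j\ne k$, vanishes. For $f\in\mathbb C^{M-1}$ and $m\in\mathbb Z$ define $T^{(0)}_m=1$, $$T^{(n)}_m(\{f_k\}_{k=1}^{n})=T^{(n-1)}_m(\{f_k\}_{k=1}^{n-1})+f_n e^{2im\phi_n}\,T^{(n-1)}_m(\{d(\phi_k,\phi_n)f_k\}_{k=1}^{n-1}),$$ $T_m(f)=T_m^{(M-1)}(f)$ and $\Theta_m(f)=T_m(\{c(\phi_k)f_k\}_{k=1}^{M-1})$; both are $M$-periodic in $m$. A state $\mathfrak s$ consists of amplitudes $f=\{f_k\}\in\mathbb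 C^{M-1}$ with $T_m(f)\ne0$, $\Theta_m(f)\neq 0$ for all $m\in\mathbb Z_M$, together with arbitrary choices of $N$-th roots $\tau_m,\theta_m$ ($m\in\mathbb Z_M$), $\tau_m^N=T_m(f)$, $\theta_m^N=\Theta_m(f)$. It defines the chain with $$u_m=-\omega^{-1/2}\,\frac{\tau_{m-1}}{\tau_m},\qquad w_m=-\frac{\theta_m}{\theta_{m-1}},\qquad m\in\mathbb Z_M,$$ whose transfer matrix is denoted $\mathbf t(\lambda,\kappa;\mathfrak s)$. **Proposition 2.** There is a nonzero polynomial $P$ on $\mathbb C^{M-1}$ (call a state with amplitudes $f$ in general position if $P(f)\neq 0$) such that the following holds. 1. For all states $\mathfrak s,\mathfrak s'$ in general position and all $\lambda\ne0$, the matrices $\mathbf t(\lambda,\kappa;\mathfrak s)$ and $\mathbf t(\lambda,\kappa;\mathfrak s')$ have the same characteristic polynomial: their eigenvalues, with multiplicities, depend neither on the $f_k$ nor on the phases of $\tau_m,\theta_m$. 2. For any two states $\mathfrak s,\mathfrak s'$ there is a nonzero matrix $\mathfrak S$, independent of $\lambda$, with $$\mathbf t(\lambda,\kappa;\mathfrak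 s)\,\mathfrak S=\mathfrak S\,\mathbf t(\lambda,\kappa;\mathfrak s')\qquad\text{for all }\lambda\neq 0,$$ and $\mathfrak S$ can be chosen invertible if both $\mathfrak s$ and $\mathfrak s'$ are in general position. -/

import Mathlib

namespace RelToda

noncomputable section

/-! The quantum relativistic Toda chain with `M` sites at an `N`-th root of unity. -/

/-- The primitive root of unity `ω = exp (2πi / N)`. -/
def omega (N : ℕ) : ℂ := Complex.exp (2 * Real.pi * Complex.I / N)

/-- The chosen square root `ω^{1/2} = exp (πi / N)`. -/
def omegaHalf (N : ℕ) : ℂ := Complex.exp (Real.pi * Complex.I / N)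

/-- Labels `α = (α_m)_m` of the basis vectors `|α⟩` of the `M`-fold tensor power of `ℂ^N`. -/
abbrev Config (N M : ℕ) : Type := ZMod M → ZMod N

/-- Operators on the quantum space of the chain. -/
abbrev Op (N M : ℕ) : Type := Matrix (Config N M) (Config N M) ℂ

/-- The Weyl element at the site `m`: `x_m |α⟩ = ω^{α_m} |α⟩`. -/
def weylX (N M : ℕ) [NeZero N] [NeZero M] (m : ZMod M) : Op N M :=
  Matrix.diagonal fun α => omega N ^ (α m).val

/-- The Weyl element at the site `m`: `z_m |…, α_m, …⟩ = |…, α_m + 1, …⟩`. -/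
def weylZ (N M : ℕ) [NeZero N] [NeZero M] (m : ZMod M) : Op N M :=
  Matrix.of fun β α => if β = Function.update α m (α m + 1) then 1 else 0

/-- The Lax matrix at the site `m`, a `2 × 2` matrix whose entries are operators,
with `u_m x_m` and `w_m z_m` in place of the abstract Weyl pair. -/
def lax (N M : ℕ) [NeZero N] [NeZero M] (lam kap : ℂ) (u w : ZMod M → ℂ) (m : ZMod M) :
    Matrix (Fin 2) (Fin 2) (Op N M) :=
  !![1 + (kap / lam) • ((u m • weylX N M m) * (w m • weylZ N M m)),
      -((omegaHalf N / lam) • (u m • weylX N M m));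
    w m • weylZ N M m, 0]

/-- The monodromy matrix `ℓ_1 ℓ_2 ⋯ ℓ_M` (the site `M` is the class `0` in `ℤ/M`). -/
def monodromy (N M : ℕ) [NeZero N] [NeZero M] (lam kap : ℂ) (u w : ZMod M → ℂ) :
    Matrix (Fin 2) (Fin 2) (Op N M) :=
  ((List.range M).map fun i => lax N M lam kap u w ((i + 1 : ℕ) : ZMod M)).prod

/-- The transfer matrix, the trace of the monodromy matrix over the two-dimensional space. -/
def transfer (N M : ℕ) [NeZero N] [NeZero M] (lam kap : ℂ) (u w : ZMod M → ℂ) : Op N M :=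
  (monodromy N M lam kap u w).trace

/-! Solitonic tau-functions; `K` stands for `κ^N`. -/

/-- `√(cos² φ + K) + cos φ`, with the principal square root. -/
def radius (K : ℂ) (φ : ℝ) : ℂ :=
  ((Real.cos φ : ℂ) ^ 2 + K) ^ (1 / 2 : ℂ) + (Real.cos φ : ℂ)

/-- `Δ(φ) = e^{iφ} (√(cos² φ + K) + cos φ)`. -/
def Delta (K : ℂ) (φ : ℝ) : ℂ := Complex.exp (Complex.I * φ) * radius K φ

/-- `Δ*(φ) = e^{-iφ} (√(cos² φ + K) + cos φ)`. -/
def DeltaStar (K : ℂ) (φ : ℝ) : ℂ := Complex.exp (-(Complex.I * φ)) * radius K φ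

/-- The phase shift `d(φ, φ')`. -/
def phaseShift (K : ℂ) (φ φ' : ℝ) : ℂ :=
  ((Delta K φ - Delta K φ') * (DeltaStar K φ - DeltaStar K φ')) /
    ((Delta K φ - DeltaStar K φ') * (DeltaStar K φ - Delta K φ'))

/-- The function `c(φ)`. -/
def cFun (K : ℂ) (φ : ℝ) : ℂ :=
  DeltaStar K φ / Delta K φ * ((1 - Delta K φ) / (1 - DeltaStar K φ))

/-- The `n`-solitonic tau-function with amplitudes `f` and wave numbers `φ`. -/
def tau (K : ℂ) (m : ℤ) : (n : ℕ) → (Fin n → ℂ) → (Fin n → ℝ) → ℂ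
  | 0, _, _ => 1
  | n + 1, f, φ =>
      tau K m n (fun k => f k.castSucc) (fun k => φ k.castSucc) +
        f (Fin.last n) * Complex.exp (2 * Complex.I * m * φ (Fin.last n)) *
          tau K m n (fun k => phaseShift K (φ k.castSucc) (φ (Fin.last n)) * f k.castSucc)
            (fun k => φ k.castSucc)

/-- The function `Θ_m`: the tau-function with the amplitudes `c(φ_k) f_k`. -/
def theta (K : ℂ) (m : ℤ) (n : ℕ) (f : Fin n → ℂ) (φ : Fin n → ℝ) : ℂ :=
  tau K m n (fun k => cFun K (φ k) * f k) φ

/-- The denominators in `c(φ_k)` and in `d(φ_j, φ_k)`, `j ≠ k`, do not vanish. -/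
def Admissible (K : ℂ) {n : ℕ} (φ : Fin n → ℝ) : Prop :=
  (∀ k, Delta K (φ k) ≠ 0 ∧ 1 - DeltaStar K (φ k) ≠ 0) ∧
    ∀ j k, j ≠ k → Delta K (φ j) - DeltaStar K (φ k) ≠ 0

/-- A state of the chain: amplitudes `f_k`, and a choice of `N`-th roots `τ_m`, `θ_m` (`m ∈ ℤ/M`)
of the complete tau-functions, none of which vanishes. -/
structure SolitonState (N M : ℕ) (kap : ℂ) (φ : Fin (M - 1) → ℝ) where
  f : Fin (M - 1) → ℂ
  τ : ZMod M → ℂ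
  θ : ZMod M → ℂ
  τ_pow : ∀ m : ZMod M, τ m ^ N = tau (kap ^ N) (m.val : ℤ) (M - 1) f φ
  θ_pow : ∀ m : ZMod M, θ m ^ N = theta (kap ^ N) (m.val : ℤ) (M - 1) f φ
  τ_ne_zero : ∀ m, τ m ≠ 0
  θ_ne_zero : ∀ m, θ m ≠ 0

/-- `u_m = -ω^{-1/2} τ_{m-1} / τ_m`. -/
def SolitonState.u {N M : ℕ} {kap : ℂ} {φ : Fin (M - 1) → ℝ} (s : SolitonState N M kap φ)
    (m : ZMod M) : ℂ :=
  -(omegaHalf N)⁻¹ * (s.τ (m - 1) / s.τ m)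

/-- `w_m = -θ_m / θ_{m-1}`. -/
def SolitonState.w {N M : ℕ} {kap : ℂ} {φ : Fin (M - 1) → ℝ} (s : SolitonState N M kap φ)
    (m : ZMod M) : ℂ :=
  -(s.θ m / s.θ (m - 1))

/-- The transfer matrix `t(λ, κ; s)` of the inhomogeneous chain in the state `s`. -/
def SolitonState.transfer {N M : ℕ} [NeZero N] [NeZero M] {kap : ℂ} {φ : Fin (M - 1) → ℝ}
    (s : SolitonState N M kap φ) (lam : ℂ) : Op N M :=
  RelToda.transfer N M lam kap s.u s.w

end

end RelToda

/-! Two chains are similar if one invertible matrix, independent of `λ`, conjugates their transfer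
matrices. The core of the proof is that small Bäcklund transformations of the amplitudes are
similarities, and that compositions of them fill a neighbourhood of each generic amplitude vector.

Quantum side: the transfer matrix is a trace of a product of local matrices, and an intertwiner is
sought in the same form, with an `N`-dimensional auxiliary space and an explicit kernel `kern` built
from cyclic products. A local exchange relation telescopes around the chain (`local_exchange`,
`transfer_mul_intertwiner`). The cyclic products close up exactly when the `N`-th powers of the
parameters satisfy Fermat relations.

Classical side: in terms of `τ ^ N` and `θ ^ N` these relations follow from three bilinear
equations, all instances of `hirota_miwa` with parameters among `0`, `1`, `-K`, `ξ`. The curve `p q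
= p + q + K` satisfied by `p = Δ`, `q = Δ*` ties these parameters together: the shift at `0` moves
by one site, the shift at `-K` leads from `τ` to `θ`, and the shift at `1` is their composite
(`SpectralData.shift_one`). The Bäcklund transformation multiplies amplitudes by shift `ξ` over
shift `-K`. As `ξ → -K` it tends to the identity and so does the intertwiner, which is therefore
invertible nearby (`Generic.eventually_linked_bt`).

Globalisation: `n` such transformations realise all amplitude ratios close to `1`
(`eventually_exists_prod_eq`), so similarity is locally constant on generic amplitudes. These are
connected along complex lines, which gives `Generic.linked_generic`. Phases of the roots are removed
by elementary conjugations (`similar_of_pow_eq`). A state that is not generic is a limit of generic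
ones, and normalised intertwiners have a nonzero, possibly singular, limit. -/

namespace RelToda

section
open scoped Kronecker

/-! ### Traces of ordered products of local matrices -/

/-- The sites `1, 2, …, M = 0` of the chain in their order. -/
def sites (M : ℕ) : List (ZMod M) := (List.range M).map fun i => ((i + 1 : ℕ) : ZMod M)

theorem sites_nodup (M : ℕ) [NeZero M] : (sites M).Nodup := by
  refine List.Nodup.map_on ?_ List.nodup_range
  intro x hx y hy h
  rw [List.mem_range] at hx hy
  push_cast at h
  have h' : (x : ZMod M) = y := by simpa using h
  rw [ZMod.natCast_eq_natCast_iff', Nat.mod_eq_of_lt hx, Nat.mod_eq_of_lt hy] at h'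
  exact h'

theorem mem_sites (M : ℕ) [NeZero M] (m : ZMod M) : m ∈ sites M := by
  refine List.mem_map.2 ⟨(m - 1).val, List.mem_range.2 (ZMod.val_lt _), ?_⟩
  push_cast
  rw [ZMod.natCast_zmod_val]
  ring

theorem sum_prod_ofFn {S Z : Type*} [Semiring S] [Fintype Z] :
    ∀ (n : ℕ) (F : Fin n → Z → S),
      ∑ γ : Fin n → Z, (List.ofFn fun i => F i (γ i)).prod =
        (List.ofFn fun i => ∑ c, F i c).prod
  | 0, F => by simp
  | n + 1, F => by
    rw [← (Fin.consEquiv fun _ => Z).sum_comp, Fintype.sum_prod_type]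
    simp only [Fin.consEquiv_apply, List.ofFn_succ, List.prod_cons, Fin.cons_zero, Fin.cons_succ]
    rw [← sum_prod_ofFn n fun i => F i.succ, Finset.sum_mul_sum]

theorem sum_prod_list {S Z ι : Type*} [Semiring S] [Fintype Z] [Fintype ι] [DecidableEq ι]
    {l : List ι} (hl : l.Nodup) (hm : ∀ i, i ∈ l) (F : ι → Z → S) :
    ∑ γ : ι → Z, (l.map fun i => F i (γ i)).prod = (l.map fun i => ∑ c, F i c).prod := by
  have h := sum_prod_ofFn l.length fun j c => F (l.get j) c
  have key : ∀ f : ι → S, l.map f = List.ofFn fun j => f (l.get j) := by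
    intro f
    conv_lhs => rw [← List.ofFn_get l]
    rw [List.map_ofFn]; rfl
  rw [key, ← h]
  refine Fintype.sum_equiv
    ((List.Nodup.getEquivOfForallMemList l hl hm).arrowCongr (Equiv.refl Z)).symm _ _ ?_
  intro γ
  rw [key]
  rfl

/-- The matrix-product operator with the local matrices `A m a b`. -/
def mpo {R d : Type*} [CommRing R] [Fintype d] [DecidableEq d] {N M : ℕ}
    (A : ZMod M → ZMod N → ZMod N → Matrix d d R) : Matrix (Config N M) (Config N M) R :=
  Matrix.of fun α β => ((sites M).map fun m => A m (α m) (β m)).prod.trace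

section
variable {R d d' : Type*} [CommRing R] [Fintype d] [DecidableEq d] [Fintype d'] [DecidableEq d']
variable {N M : ℕ}

theorem kronecker_prod {ι : Type*} (l : List ι) (F : ι → Matrix d d R) (G : ι → Matrix d' d' R) :
    (l.map F).prod ⊗ₖ (l.map G).prod = (l.map fun i => F i ⊗ₖ G i).prod := by
  induction l with
  | nil => simp
  | cons i l ih => simp only [List.map_cons, List.prod_cons, ← ih, Matrix.mul_kronecker_mul]

/-- The sum over the intermediate configuration factorises over the sites, and a product of traces
is the trace of a Kronecker product. `mpo_mul_right` reverses the Kronecker factors, so that in both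
`t Q` and `Q t'` the two-dimensional space comes first. -/
theorem mpo_mul_left [NeZero N] [NeZero M] (A : ZMod M → ZMod N → ZMod N → Matrix d d R)
    (B : ZMod M → ZMod N → ZMod N → Matrix d' d' R) :
    mpo A * mpo B = mpo fun m a b => ∑ c, A m a c ⊗ₖ B m c b := by
  ext α β
  simp only [Matrix.mul_apply, mpo, Matrix.of_apply]
  rw [← sum_prod_list (sites_nodup M) (mem_sites M) fun m c => A m (α m) c ⊗ₖ B m c (β m),
    Matrix.trace_sum]
  refine Finset.sum_congr rfl fun γ _ => ?_
  rw [← Matrix.trace_kronecker, kronecker_prod]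

theorem mpo_mul_right [NeZero N] [NeZero M] (A : ZMod M → ZMod N → ZMod N → Matrix d d R)
    (B : ZMod M → ZMod N → ZMod N → Matrix d' d' R) :
    mpo A * mpo B = mpo fun m a b => ∑ c, B m c b ⊗ₖ A m a c := by
  ext α β
  simp only [Matrix.mul_apply, mpo, Matrix.of_apply]
  rw [← sum_prod_list (sites_nodup M) (mem_sites M) fun m c => B m c (β m) ⊗ₖ A m (α m) c,
    Matrix.trace_sum]
  refine Finset.sum_congr rfl fun γ _ => ?_
  rw [mul_comm, ← Matrix.trace_kronecker, kronecker_prod]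

theorem mpo_map {R' : Type*} [CommRing R'] (φ : R →+* R')
    (A : ZMod M → ZMod N → ZMod N → Matrix d d R) :
    (mpo A).map φ = mpo fun m a b => (A m a b).map φ := by
  ext α β
  simp only [mpo, Matrix.map_apply, Matrix.of_apply]
  rw [AddMonoidHom.map_trace φ, ← RingHom.mapMatrix_apply, map_list_prod, List.map_map]
  rfl

theorem mpo_smul [NeZero M] (c : ZMod M → ZMod N → ZMod N → R)
    (A : ZMod M → ZMod N → ZMod N → Matrix d d R) (α β : Config N M) :
    mpo (fun m a b => c m a b • A m a b) α β = (∏ m, c m (α m) (β m)) * mpo A α β := by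
  have h : ∀ l : List (ZMod M), (l.map fun m => c m (α m) (β m) • A m (α m) (β m)).prod =
      (l.map fun m => c m (α m) (β m)).prod • (l.map fun m => A m (α m) (β m)).prod := by
    intro l
    induction l with
    | nil => simp
    | cons m l ih => simp [ih, smul_smul, mul_comm]
  have h2 : (Finset.univ : Finset (ZMod M)) = (sites M).toFinset := by
    ext m; simp [mem_sites]
  simp only [mpo, Matrix.of_apply, h, Matrix.trace_smul, smul_eq_mul]
  rw [h2, List.prod_toFinset _ (sites_nodup M)]

/-- The matrices `B m` telescope, and periodicity identifies `B (M + 1)` with `B 1`. -/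
theorem range_intertwine (A A' : ZMod M → Matrix d d R) (B : ZMod M → Matrix d d R)
    (h : ∀ m, A m * B (m + 1) = B m * A' m) :
    ((sites M).map A).prod * B 1 = B 1 * ((sites M).map A').prod := by
  have key : ∀ n : ℕ, ((List.range n).map fun i => A ((i + 1 : ℕ) : ZMod M)).prod *
      B ((n + 1 : ℕ) : ZMod M) =
        B 1 * ((List.range n).map fun i => A' ((i + 1 : ℕ) : ZMod M)).prod := by
    intro n
    induction n with
    | zero => simp
    | succ n ih =>
      rw [List.range_succ, List.map_append, List.prod_append, List.map_append, List.prod_append,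
        List.map_singleton, List.map_singleton, List.prod_singleton, List.prod_singleton,
        ← mul_assoc, ← ih, mul_assoc, mul_assoc, ← h]
      push_cast
      rfl
  have h2 := key M
  simp only [Nat.cast_add, CharP.cast_eq_zero, Nat.cast_one, zero_add] at h2
  simpa [sites, List.map_map, Function.comp_def] using h2

/-- The adjugate replaces the inverse, so a nonzero determinant in a domain suffices; this is
applied over `ℂ[X]`. -/
theorem trace_eq_of_intertwine [IsDomain R] {X X' B : Matrix d d R} (h : X * B = B * X')
    (hB : B.det ≠ 0) : X.trace = X'.trace := by
  refine mul_left_cancel₀ hB ?_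
  calc B.det * X.trace = (X * (B * B.adjugate)).trace := by
        rw [Matrix.mul_adjugate, Matrix.mul_smul, Matrix.mul_one, Matrix.trace_smul, smul_eq_mul]
    _ = (X' * (B.adjugate * B)).trace := by
        rw [← mul_assoc, h, mul_assoc, Matrix.trace_mul_comm, mul_assoc]
    _ = B.det * X'.trace := by
        rw [Matrix.adjugate_mul, Matrix.mul_smul, Matrix.mul_one, Matrix.trace_smul, smul_eq_mul]

theorem mpo_eq_of_intertwine [IsDomain R] (A A' : ZMod M → ZMod N → ZMod N → Matrix d d R)
    (B : ZMod M → Matrix d d R) (h : ∀ m a b, A m a b * B (m + 1) = B m * A' m a b)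
    (hB : (B 1).det ≠ 0) : mpo A = mpo A' := by
  ext α β
  exact trace_eq_of_intertwine
    (range_intertwine (fun m => A m (α m) (β m)) (fun m => A' m (α m) (β m)) B fun m => h m _ _) hB

end

/-! ### The transfer matrix as a matrix-product operator -/

/-- The values `ω ^ a` of the character of `ℤ/N`. -/
noncomputable def chi (N : ℕ) (a : ZMod N) : ℂ := omega N ^ a.val

/-- The Lax matrix at one site, in components. -/
def localLax {R : Type*} [CommRing R] {N : ℕ} (χ : ZMod N → R) (h kap mu u w : R)
    (a b : ZMod N) : Matrix (Fin 2) (Fin 2) R :=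
  !![(if b = a then 1 else 0) + (if b = a - 1 then kap * mu * u * w * χ a else 0),
      if b = a then -(h * mu * u * χ a) else 0;
    if b = a - 1 then w else 0, 0]

theorem lax_apply {N M : ℕ} [NeZero N] [NeZero M] (lam kap : ℂ) (u w : ZMod M → ℂ)
    (m : ZMod M) (i j : Fin 2) (α γ : Config N M) :
    lax N M lam kap u w m i j α γ = if ∀ m', m' ≠ m → α m' = γ m' then
      localLax (chi N) (omegaHalf N) kap lam⁻¹ (u m) (w m) (α m) (γ m) i j else 0 := by
  have h1 : α = γ ↔ (∀ m', m' ≠ m → α m' = γ m') ∧ γ m = α m := by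
    constructor
    · rintro rfl; simp
    · rintro ⟨h, h'⟩; funext k
      by_cases hk : k = m
      · rw [hk, h']
      · exact h k hk
  have h2 : α = Function.update γ m (γ m + 1) ↔
      (∀ m', m' ≠ m → α m' = γ m') ∧ γ m = α m - 1 := by
    constructor
    · intro h; rw [h]; refine ⟨fun k hk => by simp [hk], by simp⟩
    · rintro ⟨h, h'⟩; funext k
      by_cases hk : k = m
      · subst hk; simp [h']
      · simp [hk, h k hk]
  have hX : ∀ α γ : Config N M, weylX N M m α γ = if α = γ then chi N (α m) else 0 := by
    intro α γ; simp [weylX, Matrix.diagonal_apply, chi]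
  have hZ : weylZ N M m α γ =
      if (∀ m', m' ≠ m → α m' = γ m') ∧ γ m = α m - 1 then 1 else 0 := by
    simp only [weylZ, Matrix.of_apply, h2]
  have hXZ : (weylX N M m * weylZ N M m) α γ =
      if (∀ m', m' ≠ m → α m' = γ m') ∧ γ m = α m - 1 then chi N (α m) else 0 := by
    rw [weylX, Matrix.diagonal_mul, hZ, chi]; simp
  by_cases hc : ∀ m', m' ≠ m → α m' = γ m'
  · simp only [and_iff_right hc] at h1 hZ hXZ
    rw [if_pos hc]
    fin_cases i <;> fin_cases j <;>
      simp [lax, localLax, hX, hZ, hXZ, Matrix.one_apply, h1, div_eq_mul_inv] <;>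
      split_ifs <;> ring_nf
  · have h1' : α ≠ γ := fun h => hc (h1.1 h).1
    have h2' : ¬((∀ m', m' ≠ m → α m' = γ m') ∧ γ m = α m - 1) := fun h => hc h.1
    simp only [if_neg h2'] at hZ hXZ
    rw [if_neg hc]
    fin_cases i <;> fin_cases j <;>
      simp [lax, hX, hZ, hXZ, h1']

/-- Each factor alters only its own label and the sites are distinct, so the intermediate
configuration `γ₀` is forced. -/
theorem list_prod_lax_apply {N M : ℕ} [NeZero N] [NeZero M] (lam kap : ℂ) (u w : ZMod M → ℂ)
    {l : List (ZMod M)} (hl : l.Nodup) (i j : Fin 2) (α β : Config N M) :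
    (l.map fun m => lax N M lam kap u w m).prod i j α β = if ∀ m', m' ∉ l → α m' = β m' then
      (l.map fun m => localLax (chi N) (omegaHalf N) kap lam⁻¹ (u m) (w m) (α m) (β m)).prod i j
      else 0 := by
  induction l generalizing i α with
  | nil =>
    have : (∀ m', α m' = β m') ↔ α = β := funext_iff.symm
    by_cases hij : i = j <;> simp [Matrix.one_apply, hij, this]
  | cons m l ih =>
    rw [List.nodup_cons] at hl
    simp only [List.map_cons, List.prod_cons, Matrix.mul_apply, Matrix.sum_apply]
    set γ₀ : Config N M := Function.update α m (β m) with hγ₀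
    have hγm : γ₀ m = β m := by simp [hγ₀]
    have hγo : ∀ k, k ≠ m → γ₀ k = α k := fun k hk => by simp [hγ₀, hk]
    have hsum : ∀ k : Fin 2, ∑ γ, lax N M lam kap u w m i k α γ *
        (l.map fun m => lax N M lam kap u w m).prod k j γ β =
        lax N M lam kap u w m i k α γ₀ *
          (l.map fun m => lax N M lam kap u w m).prod k j γ₀ β := by
      intro k
      refine Fintype.sum_eq_single γ₀ fun γ hγ => ?_
      rw [lax_apply, ih hl.2]
      by_cases h1 : ∀ m', m' ≠ m → α m' = γ m'
      · by_cases h2 : ∀ m', m' ∉ l → γ m' = β m'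
        · refine absurd (funext fun k => ?_) hγ
          by_cases hk : k = m
          · subst hk; rw [hγm, h2 k hl.1]
          · rw [hγo k hk, h1 k hk]
        · simp [h2]
      · simp [h1]
    simp only [hsum]
    have hiff : (∀ m', m' ∉ l → γ₀ m' = β m') ↔ ∀ m', m' ∉ m :: l → α m' = β m' := by
      constructor
      · intro h k hk
        rw [List.mem_cons, not_or] at hk
        rw [← hγo k hk.1, h k hk.2]
      · intro h k hk
        by_cases hkm : k = m
        · subst hkm; exact hγm
        · rw [hγo k hkm, h k (by simp [hkm, hk])]
    have hl' : (l.map fun m => localLax (chi N) (omegaHalf N) kap lam⁻¹ (u m) (w m) (γ₀ m) (β m)) =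
        l.map fun m => localLax (chi N) (omegaHalf N) kap lam⁻¹ (u m) (w m) (α m) (β m) := by
      refine List.map_congr_left fun k hk => ?_
      rw [hγo k (by rintro rfl; exact hl.1 hk)]
    have hc : ∀ m', m' ≠ m → α m' = γ₀ m' := fun k hk => (hγo k hk).symm
    simp only [lax_apply, ih hl.2, hl', hγm, hiff, if_pos hc]
    by_cases h : ∀ m', m' ∉ m :: l → α m' = β m'
    · simp only [if_pos h]
    · simp only [if_neg h, mul_zero, Finset.sum_const_zero]

theorem transfer_eq_mpo {N M : ℕ} [NeZero N] [NeZero M] (lam kap : ℂ) (u w : ZMod M → ℂ) :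
    transfer N M lam kap u w =
      mpo fun m a b => localLax (chi N) (omegaHalf N) kap lam⁻¹ (u m) (w m) a b := by
  ext α β
  have h : monodromy N M lam kap u w = ((sites M).map fun m => lax N M lam kap u w m).prod := by
    simp [monodromy, sites, List.map_map, Function.comp_def]
  simp only [transfer, mpo, h, Matrix.trace, Matrix.of_apply, Matrix.diag_apply, Matrix.sum_apply]
  refine Finset.sum_congr rfl fun i _ => ?_
  rw [list_prod_lax_apply lam kap u w (sites_nodup M), if_pos]
  intro m hm
  exact absurd (mem_sites M m) hm

end

section
open scoped Kronecker

/-! ### The local exchange relation -/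

/-- The Lax matrix of the auxiliary space, in components. -/
def auxLax {R : Type*} [CommRing R] {N : ℕ} (χ : ZMod N → R) (kap mu u β c d : R) :
    Matrix (Fin 2 × ZMod N) (Fin 2 × ZMod N) R :=
  Matrix.of fun i j =>
    (if j.2 = i.2 then (!![1, mu * β * χ i.2; 0, 0] : Matrix (Fin 2) (Fin 2) R) i.1 j.1 else 0) +
    (if j.2 = i.2 + 1 then (!![mu * (kap * χ 1 * u * c), mu * (kap * χ 1 * u * d) * χ i.2;
      c * χ (-i.2), d] : Matrix (Fin 2) (Fin 2) R) i.1 j.1 else 0)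

/-- The matrix in the auxiliary space with the kernel `q`. -/
def kernelMatrix {R : Type*} [CommRing R] {N : ℕ} (q : ZMod N → ZMod N → ZMod N → R)
    (a b : ZMod N) : Matrix (ZMod N) (ZMod N) R :=
  Matrix.of fun φ x => if φ = a then q a x b else 0

theorem ite_add_ite_congr {R : Type*} [AddCommMonoid R] {p p' : Prop} [Decidable p] [Decidable p']
    {x y x' y' : R} (hx : p → x = x') (hy : p' → y = y') :
    (if p then x else 0) + (if p' then y else 0) =
      (if p then x' else 0) + (if p' then y' else 0) := by
  congr 1
  · split_ifs with h
    · exact hx h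
    · rfl
  · split_ifs with h
    · exact hy h
    · rfl

/-- Both sides split into entries with `φ = a` and with `φ = a - 1`. In the first part only the top
row is nonzero and gives `E1`, `E2`. In the second the top row is `kap * mu * u * χ a` times the
bottom row, so `E6`, `E7`, `E8` suffice; `E6` and `E7` are the coefficients of two powers of `mu` in
one entry. -/
theorem local_exchange {R : Type*} [CommRing R] {N : ℕ} [NeZero N] {χ : ZMod N → R}
    (hχ0 : χ 0 = 1) (hχ : ∀ a b, χ (a + b) = χ a * χ b)
    {q : ZMod N → ZMod N → ZMod N → R} {h kap mu u w u' w' u₁ β c d β₁ c₁ d₁ : R}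
    (E1 : ∀ a x b, χ 1 * c₁ * (kap * u₁ - h * u * χ (a - x)) * q a (x - 1) b =
      w' * (kap * χ 1 * u' * χ b + β * χ a) * q a x (b + 1))
    (E2 : ∀ a x b, (β₁ * χ x + h * u' * χ b) * q a x b =
      d₁ * (h * u * χ a - kap * u₁ * χ x) * q a (x - 1) b)
    (E6 : ∀ a x b, w * q (a - 1) x b = c * χ (1 - a) * q a x b + d * w' * q a x (b + 1))
    (E7 : ∀ a x b, w * u₁ * c₁ * q (a - 1) (x - 1) b =
      c * u' * w' * χ (b + 1 - a) * q a x (b + 1))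
    (E8 : ∀ a x b, w * (β₁ * χ x * q (a - 1) x b + kap * u₁ * d₁ * χ x * q (a - 1) (x - 1) b) =
      -(h * u' * χ (b + 1 - a) * c * q a x b)) (a b : ZMod N) :
    (∑ e, localLax χ h kap mu u w a e ⊗ₖ kernelMatrix q e b) * auxLax χ kap mu u₁ β₁ c₁ d₁ =
      auxLax χ kap mu u β c d * ∑ e, localLax χ h kap mu u' w' e b ⊗ₖ kernelMatrix q a e := by
  have hinv : ∀ a, χ a * χ (-a) = 1 := fun a => by rw [← hχ, add_neg_cancel, hχ0]
  ext ⟨i, φ⟩ ⟨k, x⟩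
  have hL : ((∑ e, localLax χ h kap mu u w a e ⊗ₖ kernelMatrix q e b) *
      auxLax χ kap mu u₁ β₁ c₁ d₁) (i, φ) (k, x) = ∑ j : Fin 2, localLax χ h kap mu u w a φ i j *
      (q φ x b * (!![1, mu * β₁ * χ x; 0, 0] : Matrix (Fin 2) (Fin 2) R) j k +
       q φ (x - 1) b * (!![mu * (kap * χ 1 * u₁ * c₁), mu * (kap * χ 1 * u₁ * d₁) * χ (x - 1);
          c₁ * χ (-(x - 1)), d₁] : Matrix (Fin 2) (Fin 2) R) j k) := by
    have hx : ∀ ψ : ZMod N, x = ψ + 1 ↔ x - 1 = ψ := fun ψ => sub_eq_iff_eq_add.symm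
    simp only [Matrix.mul_apply, Fintype.sum_prod_type, Matrix.sum_apply,
      Matrix.kroneckerMap_apply, kernelMatrix, auxLax, Matrix.of_apply, mul_ite, mul_zero,
      Finset.sum_ite_eq, Finset.mem_univ, if_true, mul_add, Finset.sum_add_distrib, hx, mul_assoc]
  have hR : (auxLax χ kap mu u β c d *
      ∑ e, localLax χ h kap mu u' w' e b ⊗ₖ kernelMatrix q a e) (i, φ) (k, x) =
      ∑ j : Fin 2, auxLax χ kap mu u β c d (i, φ) (j, a) *
        ∑ e, localLax χ h kap mu u' w' e b j k * q a x e := by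
    simp only [Matrix.mul_apply, Fintype.sum_prod_type, Matrix.sum_apply,
      Matrix.kroneckerMap_apply, kernelMatrix, Matrix.of_apply, mul_ite, mul_zero,
      Finset.mul_sum]
    refine Finset.sum_congr rfl fun j _ => ?_
    rw [Finset.sum_comm]
    refine Finset.sum_congr rfl fun e _ => ?_
    rw [Finset.sum_ite_eq']
    simp
  have hb : ∀ e : ZMod N, b = e - 1 ↔ e = b + 1 := fun e => by
    rw [eq_sub_iff_add_eq, eq_comm]
  have hS : ∀ j k : Fin 2, ∑ e, localLax χ h kap mu u' w' e b j k * q a x e =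
      (!![1, -(h * mu * u' * χ b); 0, 0] : Matrix (Fin 2) (Fin 2) R) j k * q a x b +
      (!![kap * mu * u' * w' * χ (b + 1), 0; w', 0] : Matrix (Fin 2) (Fin 2) R) j k *
        q a x (b + 1) := by
    intro j k
    fin_cases j <;> fin_cases k <;>
      simp [localLax, hb, add_mul, ite_mul, Finset.sum_add_distrib]
  have hl : ∀ i j : Fin 2, localLax χ h kap mu u w a φ i j =
      (if φ = a then (!![1, -(h * mu * u * χ a); 0, 0] : Matrix (Fin 2) (Fin 2) R) i j else 0) +
      if φ = a - 1 then (!![kap * mu * u * w * χ a, 0; w, 0] : Matrix (Fin 2) (Fin 2) R) i j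
        else 0 := by
    intro i j
    fin_cases i <;> fin_cases j <;> simp [localLax]
  have hφ : a = φ + 1 ↔ φ = a - 1 := by rw [eq_sub_iff_add_eq, eq_comm]
  have hq : ∀ i j : Fin 2, auxLax χ kap mu u β c d (i, φ) (j, a) =
      (if φ = a then (!![1, mu * β * χ φ; 0, 0] : Matrix (Fin 2) (Fin 2) R) i j else 0) +
      if φ = a - 1 then (!![mu * (kap * χ 1 * u * c), mu * (kap * χ 1 * u * d) * χ φ;
        c * χ (-φ), d] : Matrix (Fin 2) (Fin 2) R) i j else 0 := by
    intro i j
    simp only [auxLax, Matrix.of_apply, hφ, @eq_comm _ a φ]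
  rw [hL, hR]
  simp only [hS, hl, hq, add_mul, ite_mul, zero_mul, Finset.sum_add_distrib]
  have hcomb : ∀ (p : Prop) [Decidable p] (f : Fin 2 → R),
      (∑ j, if p then f j else 0) = if p then ∑ j, f j else 0 := by
    intro p _ f; split_ifs <;> simp
  simp only [hcomb]
  refine ite_add_ite_congr ?_ ?_
  · rintro rfl
    have e1 := E1 φ x b
    have e2 := E2 φ x b
    have h1 : χ (φ - x) = χ φ * χ (-x) := by rw [← hχ, sub_eq_add_neg]
    have h2 : χ (-(x - 1)) = χ 1 * χ (-x) := by rw [← hχ]; ring_nf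
    have h3 : χ (b + 1) = χ b * χ 1 := hχ _ _
    have h4 : χ 1 * χ (x - 1) = χ x := by rw [← hχ]; ring_nf
    rw [h1] at e1
    fin_cases i <;> fin_cases k <;> simp only [Fin.sum_univ_two, Fin.zero_eta, Fin.mk_one,
      Fin.isValue, Matrix.of_apply, Matrix.cons_val', Matrix.cons_val_zero, Matrix.cons_val_one,
      Matrix.cons_val_fin_one]
    · rw [h2, h3]
      linear_combination mu * e1
    · linear_combination mu * e2 + mu * kap * u₁ * d₁ * q φ (x - 1) b * h4
    · ring
    · ring
  · rintro rfl
    have e6 := E6 a x b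
    have e7 := E7 a x b
    have e8 := E8 a x b
    have h1 : χ 1 * χ (a - 1) = χ a := by rw [← hχ]; ring_nf
    have h2 : χ (b + 1 - a) = χ b * χ (1 - a) := by rw [← hχ]; ring_nf
    have h3 : χ (b + 1) = χ b * χ 1 := hχ _ _
    have h4 : χ 1 * χ (x - 1) = χ x := by rw [← hχ]; ring_nf
    have h5 : χ (-(a - 1)) = χ (1 - a) := by ring_nf
    have h6 : χ a * χ (1 - a) = χ 1 := by rw [← hχ]; ring_nf
    rw [h2] at e7 e8
    fin_cases i <;> fin_cases k <;> simp only [Fin.sum_univ_two, Fin.zero_eta, Fin.mk_one,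
      Fin.isValue, Matrix.of_apply, Matrix.cons_val', Matrix.cons_val_zero, Matrix.cons_val_one,
      Matrix.cons_val_fin_one, h5]
    · rw [h3]
      linear_combination kap * mu * u * χ a * e6 + kap ^ 2 * mu ^ 2 * u * χ a * χ 1 * e7 +
        (kap * mu * u * c * q a x b + kap ^ 2 * mu ^ 2 * u * c * u' * w' * χ b * χ 1 *
        q a x (b + 1)) * h6 - kap * mu * u * d * w' * q a x (b + 1) * h1
    · linear_combination kap * mu ^ 2 * u * χ a * e8 - kap * mu ^ 2 * u * h * u' * χ b * c *
        q a x b * h6 + kap ^ 2 * mu ^ 2 * u * χ a * w * u₁ * d₁ * q (a - 1) (x - 1) b * h4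
    · rw [h3]
      linear_combination e6 + mu * kap * χ 1 * e7
    · linear_combination mu * e8 + mu * w * kap * u₁ * d₁ * q (a - 1) (x - 1) b * h4

end

section
open scoped Kronecker

/-! ### Intertwining of transfer matrices -/

/-- At `mu = 0` the matrix is block triangular, with an identity block and `d` times a cyclic shift
on the diagonal. -/
theorem auxLax_det_ne_zero {K : Type*} [Field K] {N : ℕ} [NeZero N] (χ : ZMod N → K)
    {kap u β c d : K} (hd : d ≠ 0) : (auxLax χ kap 0 u β c d).det ≠ 0 := by
  intro h
  obtain ⟨v, hv, h0⟩ := Matrix.exists_mulVec_eq_zero_iff.2 h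
  have h1 : ∀ φ, v (0, φ) = 0 := by
    intro φ
    have := congrFun h0 (0, φ)
    simpa [Matrix.mulVec, dotProduct, Fintype.sum_prod_type, auxLax, Finset.sum_add_distrib,
      add_mul] using this
  have h2 : ∀ φ, v (1, φ + 1) = 0 := by
    intro φ
    have := congrFun h0 (1, φ)
    simpa [Matrix.mulVec, dotProduct, Fintype.sum_prod_type, auxLax, Finset.sum_add_distrib,
      add_mul, h1, hd] using this
  apply hv
  ext ⟨i, φ⟩
  fin_cases i
  · exact h1 φ
  · simpa using h2 (φ - 1)

theorem localLax_map {R R' : Type*} [CommRing R] [CommRing R'] (f : R →+* R') {N : ℕ}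
    (χ : ZMod N → R) (h kap mu u w : R) (a b : ZMod N) :
    (localLax χ h kap mu u w a b).map f =
      localLax (fun a => f (χ a)) (f h) (f kap) (f mu) (f u) (f w) a b := by
  ext i j
  fin_cases i <;> fin_cases j <;> simp [localLax, apply_ite f]

theorem auxLax_map {R R' : Type*} [CommRing R] [CommRing R'] (f : R →+* R') {N : ℕ}
    (χ : ZMod N → R) (kap mu u β c d : R) :
    (auxLax χ kap mu u β c d).map f =
      auxLax (fun a => f (χ a)) (f kap) (f mu) (f u) (f β) (f c) (f d) := by
  ext ⟨i, φ⟩ ⟨j, ψ⟩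
  fin_cases i <;> fin_cases j <;> simp [auxLax, apply_ite f]

theorem kernelMatrix_map {R R' : Type*} [CommRing R] [CommRing R'] (f : R →+* R') {N : ℕ}
    (q : ZMod N → ZMod N → ZMod N → R) (a b : ZMod N) :
    (kernelMatrix q a b).map f = kernelMatrix (fun a x b => f (q a x b)) a b := by
  ext i j
  simp [kernelMatrix, apply_ite f]

theorem chi_zero (N : ℕ) : chi N 0 = 1 := by simp [chi]

theorem omega_pow (N : ℕ) [NeZero N] : omega N ^ N = 1 :=
  (Complex.isPrimitiveRoot_exp N (NeZero.ne N)).pow_eq_one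

theorem chi_add (N : ℕ) [NeZero N] (a b : ZMod N) : chi N (a + b) = chi N a * chi N b := by
  rw [chi, chi, chi, ← pow_add, ZMod.val_add, ← pow_eq_pow_mod _ (omega_pow N)]

theorem chi_pow (N : ℕ) [NeZero N] (a : ZMod N) : chi N a ^ N = 1 := by
  rw [chi, ← pow_mul, mul_comm, pow_mul, omega_pow, one_pow]

theorem chi_ne_zero (N : ℕ) [NeZero N] (a : ZMod N) : chi N a ≠ 0 := fun h => by
  have := chi_pow N a
  rw [h, zero_pow (NeZero.ne N)] at this
  exact zero_ne_one this

theorem prod_sub_chi (N : ℕ) [NeZero N] (x y : ℂ) :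
    ∏ a : ZMod N, (x - y * chi N a) = x ^ N - y ^ N := by
  have hp : IsPrimitiveRoot (omega N) N := Complex.isPrimitiveRoot_exp N (NeZero.ne N)
  rw [hp.pow_sub_pow_eq_prod_sub_mul x y (NeZero.pos N)]
  refine Finset.prod_bij (fun a _ => chi N a) ?_ ?_ ?_ ?_
  · intro a _
    rw [Polynomial.mem_nthRootsFinset (NeZero.pos N)]
    exact chi_pow N a
  · intro a _ b _ hab
    exact ZMod.val_injective N (hp.pow_inj (ZMod.val_lt a) (ZMod.val_lt b) hab)
  · intro z hz
    rw [Polynomial.mem_nthRootsFinset (NeZero.pos N)] at hz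
    obtain ⟨i, hi, rfl⟩ := hp.eq_pow_of_pow_eq_one hz
    exact ⟨(i : ZMod N), Finset.mem_univ _, by rw [chi, ZMod.val_cast_of_lt hi]⟩
  · intro a _
    rw [mul_comm]

/-- `auxLax` may be singular at special values of `1/λ`. The exchange is therefore done over `ℂ[X]`
with `X` in place of `1/λ`, where the determinant is nonzero because its value at `0` is, and is
then specialised to every `λ`. -/
theorem transfer_intertwine {N M : ℕ} [NeZero N] [NeZero M] {kap : ℂ}
    {u w u' w' β c d : ZMod M → ℂ} (q : ZMod M → ZMod N → ZMod N → ZMod N → ℂ)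
    (hd : d 1 ≠ 0)
    (E1 : ∀ m a x b, chi N 1 * c (m + 1) * (kap * u (m + 1) - omegaHalf N * u m * chi N (a - x)) *
      q m a (x - 1) b = w' m * (kap * chi N 1 * u' m * chi N b + β m * chi N a) * q m a x (b + 1))
    (E2 : ∀ m a x b, (β (m + 1) * chi N x + omegaHalf N * u' m * chi N b) * q m a x b =
      d (m + 1) * (omegaHalf N * u m * chi N a - kap * u (m + 1) * chi N x) * q m a (x - 1) b)
    (E6 : ∀ m a x b, w m * q m (a - 1) x b =
      c m * chi N (1 - a) * q m a x b + d m * w' m * q m a x (b + 1))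
    (E7 : ∀ m a x b, w m * u (m + 1) * c (m + 1) * q m (a - 1) (x - 1) b =
      c m * u' m * w' m * chi N (b + 1 - a) * q m a x (b + 1))
    (E8 : ∀ m a x b, w m * (β (m + 1) * chi N x * q m (a - 1) x b +
      kap * u (m + 1) * d (m + 1) * chi N x * q m (a - 1) (x - 1) b) =
      -(omegaHalf N * u' m * chi N (b + 1 - a) * c m * q m a x b)) (lam : ℂ) :
    transfer N M lam kap u w * mpo (fun m => kernelMatrix (q m)) =
      mpo (fun m => kernelMatrix (q m)) * transfer N M lam kap u' w' := by
  let C : ℂ →+* Polynomial ℂ := Polynomial.C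
  let ev : ℂ → Polynomial ℂ →+* ℂ := fun z => Polynomial.evalRingHom z
  have key : (mpo fun m a b => localLax (fun a => C (chi N a)) (C (omegaHalf N)) (C kap)
        Polynomial.X (C (u m)) (C (w m)) a b) *
      mpo (fun m a b => kernelMatrix (fun a x b => C (q m a x b)) a b) =
      mpo (fun m a b => kernelMatrix (fun a x b => C (q m a x b)) a b) *
      (mpo fun m a b => localLax (fun a => C (chi N a)) (C (omegaHalf N)) (C kap)
        Polynomial.X (C (u' m)) (C (w' m)) a b) := by
    rw [mpo_mul_left, mpo_mul_right]
    refine mpo_eq_of_intertwine _ _ (fun m => auxLax (fun a => C (chi N a)) (C kap) Polynomial.X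
      (C (u m)) (C (β m)) (C (c m)) (C (d m))) ?_ ?_
    · intro m a b
      refine local_exchange (by rw [chi_zero, map_one]) (fun a b => by rw [chi_add, map_mul])
        (q := fun a x b => C (q m a x b)) ?_ ?_ ?_ ?_ ?_ a b <;> intro a x b
      · have := congrArg C (E1 m a x b)
        simpa only [map_mul, map_add, map_sub, map_neg] using this
      · have := congrArg C (E2 m a x b)
        simpa only [map_mul, map_add, map_sub, map_neg] using this
      · have := congrArg C (E6 m a x b)
        simpa only [map_mul, map_add, map_sub, map_neg] using this
      · have := congrArg C (E7 m a x b)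
        simpa only [map_mul, map_add, map_sub, map_neg] using this
      · have := congrArg C (E8 m a x b)
        simpa only [map_mul, map_add, map_sub, map_neg] using this
    · intro h0
      have h1 := congrArg (ev 0) h0
      rw [RingHom.map_det, RingHom.mapMatrix_apply, auxLax_map] at h1
      simp only [ev, C, Polynomial.coe_evalRingHom, Polynomial.eval_C, Polynomial.eval_X,
        map_zero] at h1
      exact auxLax_det_ne_zero _ hd h1
  have h2 := congrArg (fun A : Matrix (Config N M) (Config N M) (Polynomial ℂ) =>
    A.map (ev lam⁻¹)) key
  simp only [Matrix.map_mul, mpo_map, localLax_map, kernelMatrix_map] at h2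
  simp only [ev, C, Polynomial.coe_evalRingHom, Polynomial.eval_C, Polynomial.eval_X] at h2
  rw [transfer_eq_mpo, transfer_eq_mpo]
  exact h2

/-! ### The kernel -/

/-- The function on `ℤ/N` with `cyc p 0 = 1` and the ratios `p`. -/
def cyc {N : ℕ} (p : ZMod N → ℂ) (n : ZMod N) : ℂ := ∏ j ∈ Finset.range n.val, p (j + 1 : ℕ)

/-- Only the wrap from `N - 1` to `0` needs the hypothesis that the product around the cycle is `1`.
-/
theorem cyc_eq {N : ℕ} [NeZero N] {p : ZMod N → ℂ} (hp : ∏ a, p a = 1) (n : ZMod N) :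
    cyc p n = p n * cyc p (n - 1) := by
  obtain ⟨m, rfl⟩ : ∃ m, n = m + 1 := ⟨n - 1, by ring⟩
  rw [add_sub_cancel_right]
  have hm : p (m + 1) * cyc p m = ∏ j ∈ Finset.range (m.val + 1), p (j + 1 : ℕ) := by
    rw [Finset.prod_range_succ, cyc, mul_comm]
    push_cast
    rw [ZMod.natCast_zmod_val]
  rw [hm]
  rcases (Nat.succ_le_of_lt (ZMod.val_lt m)).lt_or_eq with h | h
  · have : (m + 1).val = m.val + 1 := by
      have := ZMod.val_cast_of_lt h
      rw [Nat.succ_eq_add_one] at this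
      push_cast at this
      rwa [ZMod.natCast_zmod_val] at this
    rw [cyc, this]
  · have h0 : m + 1 = 0 := by
      have : ((m.val + 1 : ℕ) : ZMod N) = 0 := by
        rw [← Nat.succ_eq_add_one, h, ZMod.natCast_self]
      push_cast at this
      rwa [ZMod.natCast_zmod_val] at this
    have h1 : ∏ j ∈ Finset.range N, p ((j + 1 : ℕ) : ZMod N) = ∏ a, p a := by
      rw [← Equiv.prod_comp (Equiv.addRight (1 : ZMod N))]
      refine Finset.prod_bij (fun j _ => (j : ZMod N)) (fun _ _ => Finset.mem_univ _) ?_ ?_ ?_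
      · intro i hi j hj hij
        rw [Finset.mem_range] at hi hj
        rwa [ZMod.natCast_eq_natCast_iff', Nat.mod_eq_of_lt hi, Nat.mod_eq_of_lt hj] at hij
      · intro a _
        exact ⟨a.val, Finset.mem_range.2 (ZMod.val_lt a), ZMod.natCast_zmod_val a⟩
      · intro j _
        simp
    rw [← Nat.succ_eq_add_one, h, h1, hp, h0]
    simp [cyc]

/-- The Fermat relation is what closes the cyclic product. -/
theorem prod_div_sub_chi (N : ℕ) [NeZero N] {z x y : ℂ} (h : z ^ N = x ^ N - y ^ N)
    (hz : z ≠ 0) : ∏ a : ZMod N, z / (x - y * chi N a) = 1 := by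
  rw [Finset.prod_div_distrib, prod_sub_chi, Finset.prod_const, Finset.card_univ, ZMod.card, h,
    div_self]
  rw [← h]
  exact pow_ne_zero _ hz

theorem sub_chi_ne_zero {N : ℕ} [NeZero N] {x y : ℂ} (h : x ^ N - y ^ N ≠ 0) (a : ZMod N) :
    x - y * chi N a ≠ 0 := by
  rw [← prod_sub_chi, Finset.prod_ne_zero_iff] at h
  exact h a (Finset.mem_univ _)

/-- The local kernel of the intertwiner. -/
noncomputable def kern (N : ℕ) (kap k ρ η u u₁ u' w' d₁ : ℂ) (a x b : ZMod N) : ℂ :=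
  chi N ((a - b) * x) * (cyc (fun n => (omegaHalf N * u - kap * u₁ * chi N n) / η) (x - a) *
    cyc (fun n => η * d₁ / (omegaHalf N * u' - k * u₁ * chi N n)) (x - b)) *
    cyc (fun n => -(chi N 1 * ρ * (η * d₁) / (u₁ * w')) /
      (kap * chi N 1 * u' - k * u * chi N (1 - n))) (b - a)

section
variable {N : ℕ} [NeZero N] {kap k ρ η u u₁ w u' w' d d₁ : ℂ}

/-- The recurrence in the auxiliary variable `x`: each of the first two cyclic products contributes
one ratio, and the phase `χ((a - b) x)` supplies the factors `χ a`, `χ b`. -/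
theorem kern_aux (hη : η ^ N = (omegaHalf N * u) ^ N - (kap * u₁) ^ N) (hη0 : η ≠ 0)
    (hd₁ : d₁ ≠ 0) (hG : (η * d₁) ^ N = (omegaHalf N * u') ^ N - (k * u₁) ^ N) (a x b : ZMod N) :
    (omegaHalf N * u' * chi N b - k * u₁ * chi N x) * kern N kap k ρ η u u₁ u' w' d₁ a x b =
      d₁ * (omegaHalf N * u * chi N a - kap * u₁ * chi N x) *
        kern N kap k ρ η u u₁ u' w' d₁ a (x - 1) b := by
  have hG0 : (omegaHalf N * u') ^ N - (k * u₁) ^ N ≠ 0 := by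
    rw [← hG]; exact pow_ne_zero _ (mul_ne_zero hη0 hd₁)
  have hH : ∏ n : ZMod N, (omegaHalf N * u - kap * u₁ * chi N n) / η = 1 := by
    rw [Finset.prod_div_distrib, prod_sub_chi, Finset.prod_const, Finset.card_univ, ZMod.card, ← hη,
      div_self (pow_ne_zero _ hη0)]
  have h1 := cyc_eq hH (x - a)
  have h2 := cyc_eq (prod_div_sub_chi N hG (mul_ne_zero hη0 hd₁)) (x - b)
  have hx : chi N x = chi N b * chi N (x - b) := by rw [← chi_add]; ring_nf
  have hx' : chi N x = chi N a * chi N (x - a) := by rw [← chi_add]; ring_nf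
  have hne := sub_chi_ne_zero hG0 (x - b)
  have e1 : omegaHalf N * u' * chi N b - k * u₁ * chi N x =
      chi N b * (omegaHalf N * u' - k * u₁ * chi N (x - b)) := by rw [hx]; ring
  have e2 : omegaHalf N * u * chi N a - kap * u₁ * chi N x =
      chi N a * (omegaHalf N * u - kap * u₁ * chi N (x - a)) := by rw [hx']; ring
  have e3 : chi N ((a - b) * x) * chi N b = chi N ((a - b) * (x - 1)) * chi N a := by
    rw [← chi_add, ← chi_add]; ring_nf
  rw [e1, e2, kern, kern, h1, h2, sub_right_comm x 1 a, sub_right_comm x 1 b]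
  generalize cyc _ (x - a - 1) = A
  generalize cyc _ (x - b - 1) = B
  generalize cyc _ (b - a) = F
  field_simp
  linear_combination (omegaHalf N * u - kap * u₁ * chi N (x - a)) * A * B * F * e3

/-- Apart from its phase the kernel depends only on the differences `x - a`, `x - b`, `b - a`, which
agree at the two points. -/
theorem kern_shift (a x b : ZMod N) :
    kern N kap k ρ η u u₁ u' w' d₁ (a - 1) (x - 1) b =
      chi N (b + 1 - a) * kern N kap k ρ η u u₁ u' w' d₁ a x (b + 1) := by
  have e : chi N ((a - 1 - b) * (x - 1)) = chi N (b + 1 - a) * chi N ((a - (b + 1)) * x) := by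
    rw [← chi_add]; ring_nf
  have h1 : x - 1 - (a - 1) = x - a := by ring
  have h2 : x - 1 - b = x - (b + 1) := by ring
  have h3 : b - (a - 1) = b + 1 - a := by ring
  rw [kern, kern, h1, h2, h3, e]
  ring

/-- The recurrence in `b`: the last two cyclic products each change by one ratio, and `hF` closes
the last one. -/
theorem kern_right (hη0 : η ≠ 0) (hd₁ : d₁ ≠ 0)
    (hG : (η * d₁) ^ N = (omegaHalf N * u') ^ N - (k * u₁) ^ N)
    (hρ : ρ ≠ 0) (hu₁ : u₁ ≠ 0) (hw' : w' ≠ 0)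
    (hF : (-(chi N 1 * ρ * (η * d₁) / (u₁ * w'))) ^ N = (kap * chi N 1 * u') ^ N - (k * u) ^ N)
    (a x b : ZMod N) :
    u₁ * w' * (kap * chi N 1 * u' * chi N b - k * u * chi N a) *
        kern N kap k ρ η u u₁ u' w' d₁ a x (b + 1) =
      -(chi N 1 * ρ * (omegaHalf N * u' * chi N (b - x) - k * u₁)) *
        kern N kap k ρ η u u₁ u' w' d₁ a x b := by
  have hG0 : (omegaHalf N * u') ^ N - (k * u₁) ^ N ≠ 0 := by
    rw [← hG]; exact pow_ne_zero _ (mul_ne_zero hη0 hd₁)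
  have hz : -(chi N 1 * ρ * (η * d₁) / (u₁ * w')) ≠ 0 :=
    neg_ne_zero.2 (div_ne_zero (mul_ne_zero (mul_ne_zero (chi_ne_zero N 1) hρ)
      (mul_ne_zero hη0 hd₁)) (mul_ne_zero hu₁ hw'))
  have hF0 : (kap * chi N 1 * u') ^ N - (k * u) ^ N ≠ 0 := by
    rw [← hF]; exact pow_ne_zero _ hz
  have hP : ∏ n : ZMod N, -(chi N 1 * ρ * (η * d₁) / (u₁ * w')) /
      (kap * chi N 1 * u' - k * u * chi N (1 - n)) = 1 := by
    rw [← prod_div_sub_chi N hF hz, ← (Equiv.subLeft (1 : ZMod N)).prod_comp]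
    simp
  have h1 := cyc_eq hP (b + 1 - a)
  have h2 := cyc_eq (prod_div_sub_chi N hG (mul_ne_zero hη0 hd₁)) (x - b)
  have hne := sub_chi_ne_zero hG0 (x - b)
  have hne' := sub_chi_ne_zero hF0 (a - b)
  have i1 : (1 : ZMod N) - (b + 1 - a) = a - b := by ring
  have i2 : b + 1 - a - 1 = b - a := by ring
  have i3 : x - (b + 1) = x - b - 1 := by ring
  have e1 : kap * chi N 1 * u' * chi N b - k * u * chi N a =
      chi N b * (kap * chi N 1 * u' - k * u * chi N (a - b)) := by
    have : chi N a = chi N b * chi N (a - b) := by rw [← chi_add]; ring_nf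
    rw [this]; ring
  have e2 : omegaHalf N * u' * chi N (b - x) - k * u₁ =
      chi N (b - x) * (omegaHalf N * u' - k * u₁ * chi N (x - b)) := by
    have : chi N (b - x) * chi N (x - b) = 1 := by rw [← chi_add, ← chi_zero N]; ring_nf
    linear_combination k * u₁ * this
  have e3 : chi N ((a - (b + 1)) * x) * chi N b = chi N (b - x) * chi N ((a - b) * x) := by
    rw [← chi_add, ← chi_add]; ring_nf
  rw [e1, e2, kern, kern, h1, h2, i1, i2, i3]
  generalize cyc _ (x - a) = A
  generalize cyc _ (x - b - 1) = B
  generalize cyc _ (b - a) = F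
  generalize omegaHalf N * u' - k * u₁ * chi N (x - b) = D at *
  generalize kap * chi N 1 * u' - k * u * chi N (a - b) = D' at *
  field_simp
  linear_combination -chi N 1 * A * B * F * e3

end

end

section
open Filter Topology

/-! ### The intertwiner of two chains and its limit -/

/-- The intertwiner with the local kernels `kern`. -/
noncomputable def intertwiner (N M : ℕ) [NeZero N] [NeZero M] (kap k ρ : ℂ)
    (η u u' w' d : ZMod M → ℂ) : Op N M :=
  mpo fun m => kernelMatrix (kern N kap k ρ (η m) (u m) (u (m + 1)) (u' m) (w' m) (d (m + 1)))

/-- With `β = -k u` and `c = ρ d / u` all exchange relations follow from `kern_aux`, `kern_right`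
and `kern_shift`. The hypothesis `hd` is `E7` after `kern_shift`. -/
theorem transfer_mul_intertwiner {N M : ℕ} [NeZero N] [NeZero M] {kap k ρ : ℂ}
    {η u w u' w' d : ZMod M → ℂ} (hρ : ρ ≠ 0) (hη0 : ∀ m, η m ≠ 0) (hd0 : ∀ m, d m ≠ 0)
    (hu : ∀ m, u m ≠ 0) (hw' : ∀ m, w' m ≠ 0)
    (hη : ∀ m, η m ^ N = (omegaHalf N * u m) ^ N - (kap * u (m + 1)) ^ N)
    (hG : ∀ m, (η m * d (m + 1)) ^ N = (omegaHalf N * u' m) ^ N - (k * u (m + 1)) ^ N)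
    (hF : ∀ m, (-(chi N 1 * ρ * (η m * d (m + 1)) / (u (m + 1) * w' m))) ^ N =
      (kap * chi N 1 * u' m) ^ N - (k * u m) ^ N)
    (hd : ∀ m, d (m + 1) * (u m * w m) = d m * (u' m * w' m)) (lam : ℂ) :
    transfer N M lam kap u w * intertwiner N M kap k ρ η u u' w' d =
      intertwiner N M kap k ρ η u u' w' d * transfer N M lam kap u' w' := by
  have hadd := chi_add N
  have hinv : ∀ a : ZMod N, chi N a * chi N (-a) = 1 := fun a => by
    rw [← hadd, add_neg_cancel, chi_zero]
  have A := fun m => kern_aux (ρ := ρ) (w' := w' m) (hη m) (hη0 m) (hd0 (m + 1)) (hG m)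
  have B := fun m => kern_right (hη0 m) (hd0 (m + 1)) (hG m) hρ (hu (m + 1)) (hw' m) (hF m)
  have S := fun m => kern_shift (N := N) (kap := kap) (k := k) (ρ := ρ) (η := η m) (u := u m)
    (u₁ := u (m + 1)) (u' := u' m) (w' := w' m) (d₁ := d (m + 1))
  have D : ∀ m (x b : ZMod N), omegaHalf N * u' m * chi N b - k * u (m + 1) * chi N x ≠ 0 := by
    intro m x b
    have h1 := sub_chi_ne_zero (N := N) (x := omegaHalf N * u' m) (y := k * u (m + 1))
      (by rw [← hG]; exact pow_ne_zero _ (mul_ne_zero (hη0 m) (hd0 _))) (x - b)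
    have h2 : chi N x = chi N b * chi N (x - b) := by rw [← hadd]; ring_nf
    have h3 : omegaHalf N * u' m * chi N b - k * u (m + 1) * chi N x =
        chi N b * (omegaHalf N * u' m - k * u (m + 1) * chi N (x - b)) := by rw [h2]; ring
    rw [h3]
    exact mul_ne_zero (chi_ne_zero N b) h1
  -- By `A` and `S` the kernel at `(a - 1, x, b)` is a multiple of its value at `(a, x, b + 1)`, and
  -- by `B` so is the kernel at `(a, x, b)`. The nonzero factor `D` clears the denominator.
  have E6 : ∀ m (a x b : ZMod N),
      w m * kern N kap k ρ (η m) (u m) (u (m + 1)) (u' m) (w' m) (d (m + 1)) (a - 1) x b =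
      ρ * d m / u m * chi N (1 - a) *
        kern N kap k ρ (η m) (u m) (u (m + 1)) (u' m) (w' m) (d (m + 1)) a x b +
      d m * w' m *
        kern N kap k ρ (η m) (u m) (u (m + 1)) (u' m) (w' m) (d (m + 1)) a x (b + 1) := by
    intro m a x b
    have hA := A m (a - 1) x b
    have hB := B m a x b
    rw [S] at hA
    have c1 : chi N (b + 1 - a) = chi N b * chi N 1 * chi N (-a) := by
      rw [← hadd, ← hadd, sub_eq_add_neg]
    have c2 : chi N (a - 1) = chi N a * chi N (-1) := by rw [← hadd, sub_eq_add_neg]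
    have c3 : chi N (1 - a) = chi N 1 * chi N (-a) := by rw [← hadd, sub_eq_add_neg]
    have c4 : chi N (b - x) = chi N b * chi N (-x) := by rw [← hadd, sub_eq_add_neg]
    rw [c1, c2] at hA
    rw [c4] at hB
    rw [c3]
    have i1 := hinv 1
    have ia := hinv a
    have ix := hinv x
    have hdm := hd m
    have hum := hu m
    refine mul_left_cancel₀ (mul_ne_zero (D m x b) hum) ?_
    field_simp
    generalize kern N kap k ρ (η m) (u m) (u (m + 1)) (u' m) (w' m) (d (m + 1)) (a - 1) x b = P
      at *
    generalize kern N kap k ρ (η m) (u m) (u (m + 1)) (u' m) (w' m) (d (m + 1)) a x b = Q₀ at *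
    generalize kern N kap k ρ (η m) (u m) (u (m + 1)) (u' m) (w' m) (d (m + 1)) a x (b + 1) = Q₁
      at *
    generalize chi N a = ca at *
    generalize chi N (-a) = ja at *
    generalize chi N b = cb at *
    generalize chi N x = cx at *
    generalize chi N (-x) = jx at *
    generalize chi N 1 = o at *
    generalize chi N (-1) = jo at *
    generalize omegaHalf N = h at *
    linear_combination (u m * w m) * hA +
      (h * u m * (ca * jo) - kap * u (m + 1) * cx) * (cb * o * ja) * Q₁ * hdm
      - d m * ja * cx * hB +
      d m * u' m * w' m * h * u m * cb * Q₁ * (ca * ja * i1 + ia)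
      + d m * ja * o * ρ * h * u' m * cb * Q₀ * ix -
      d m * cx * u (m + 1) * w' m * k * u m * Q₁ * ia
  refine transfer_intertwine (β := fun m => -(k * u m)) (c := fun m => ρ * d m / u m) (d := d)
    (fun m => kern N kap k ρ (η m) (u m) (u (m + 1)) (u' m) (w' m) (d (m + 1))) (hd0 1)
    ?_ ?_ E6 ?_ ?_ lam <;> intro m a x b
  · have hA := A m a x b
    have hB := B m a x b
    have c4 : chi N (b - x) = chi N b * chi N (-x) := by rw [← hadd, sub_eq_add_neg]
    have c5 : chi N (a - x) = chi N a * chi N (-x) := by rw [← hadd, sub_eq_add_neg]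
    rw [c4] at hB
    simp only [c5]
    have ix := hinv x
    have hum := hu (m + 1)
    refine mul_left_cancel₀ (mul_ne_zero hum (chi_ne_zero N x)) ?_
    field_simp
    linear_combination (chi N 1 * ρ) * hA - chi N x * hB - (chi N 1 * ρ * omegaHalf N) *
      (d (m + 1) * u m * chi N a *
        kern N kap k ρ (η m) (u m) (u (m + 1)) (u' m) (w' m) (d (m + 1)) a (x - 1) b -
        u' m * chi N b *
        kern N kap k ρ (η m) (u m) (u (m + 1)) (u' m) (w' m) (d (m + 1)) a x b) * ix
  · linear_combination A m a x b
  · have hdm := hd m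
    have hum := hu m
    have hum1 := hu (m + 1)
    simp only [S]
    field_simp
    linear_combination chi N (b + 1 - a) *
      kern N kap k ρ (η m) (u m) (u (m + 1)) (u' m) (w' m) (d (m + 1)) a x (b + 1) * hdm
  · have hA := A m (a - 1) x b
    have h6 := E6 m a x b
    rw [S] at hA
    have c1 : chi N (b + 1 - a) = chi N b * chi N (1 - a) := by rw [← hadd]; ring_nf
    have c2 : chi N (a - 1) * chi N (1 - a) = 1 := by rw [← hadd, ← chi_zero N]; ring_nf
    simp only [S]
    rw [c1] at hA ⊢
    linear_combination (w m) * hA - omegaHalf N * u' m * chi N b * h6 +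
      omegaHalf N * chi N b *
      kern N kap k ρ (η m) (u m) (u (m + 1)) (u' m) (w' m) (d (m + 1)) a x (b + 1) *
      (hd m + d (m + 1) * u m * w m * c2)

/-- For equal labels the local matrix has a single nonzero row, consisting of ones. Products of such
matrices keep this form and have trace `1`. -/
theorem mpo_kernelMatrix_delta (N M : ℕ) [NeZero N] [NeZero M] :
    mpo (fun (_ : ZMod M) => kernelMatrix (fun a _ b : ZMod N => if a = b then (1 : ℂ) else 0)) =
      1 := by
  have hP : ∀ (α : Config N M) (l : List (ZMod M)), l ≠ [] → ∃ m, (l.map fun m => kernelMatrix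
      (fun a _ b : ZMod N => if a = b then (1 : ℂ) else 0) (α m) (α m)).prod =
      Matrix.of fun φ _ => if φ = α m then 1 else 0 := by
    intro α l hl
    induction l with
    | nil => exact absurd rfl hl
    | cons m l ih =>
      refine ⟨m, ?_⟩
      rw [List.map_cons, List.prod_cons]
      rcases eq_or_ne l [] with rfl | h
      · ext φ x
        simp [kernelMatrix]
      · obtain ⟨m', hm'⟩ := ih h
        rw [hm']
        ext φ x
        simp [kernelMatrix, Matrix.mul_apply]
  ext α β
  rw [mpo, Matrix.of_apply]
  by_cases h : α = β
  · subst h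
    obtain ⟨m, hm⟩ := hP α (sites M) (List.ne_nil_of_mem (mem_sites M 0))
    rw [hm]
    simp [Matrix.trace]
  · obtain ⟨m, hm⟩ := Function.ne_iff.1 h
    rw [Matrix.one_apply_ne h, List.prod_eq_zero, Matrix.trace_zero]
    refine List.mem_map.2 ⟨m, mem_sites M m, ?_⟩
    ext φ x
    simp [kernelMatrix, hm]

theorem tendsto_mpo {N M : ℕ} {Y d : Type*} [Fintype d] [DecidableEq d] {l : Filter Y}
    {A : Y → ZMod M → ZMod N → ZMod N → Matrix d d ℂ} {A₀ : ZMod M → ZMod N → ZMod N → Matrix d d ℂ}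
    (h : ∀ m a b i j, Tendsto (fun y => A y m a b i j) l (𝓝 (A₀ m a b i j))) :
    Tendsto (fun y => mpo (A y)) l (𝓝 (mpo A₀)) := by
  refine tendsto_pi_nhds.2 fun α => tendsto_pi_nhds.2 fun β => ?_
  have h1 : Tendsto (fun y => ((sites M).map fun m => A y m (α m) (β m)).prod) l
      (𝓝 ((sites M).map fun m => A₀ m (α m) (β m)).prod) :=
    tendsto_list_prod _ fun m _ => tendsto_pi_nhds.2 fun i => tendsto_pi_nhds.2 fun j => h _ _ _ i j
  exact ((continuous_id.matrix_trace).tendsto _).comp h1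

theorem tendsto_cyc {N : ℕ} {Y : Type*} {l : Filter Y} {p : Y → ZMod N → ℂ}
    {p₀ : ZMod N → ℂ} (n : ZMod N)
    (h : ∀ j < n.val, Tendsto (fun y => p y (j + 1 : ℕ)) l (𝓝 (p₀ (j + 1 : ℕ)))) :
    Tendsto (fun y => cyc (p y) n) l (𝓝 (cyc p₀ n)) :=
  tendsto_finsetProd _ fun j hj => h j (Finset.mem_range.1 hj)

theorem chi_eq_one_iff {N : ℕ} [NeZero N] {a : ZMod N} : chi N a = 1 ↔ a = 0 := by
  refine ⟨fun h => ?_, fun h => by rw [h, chi_zero]⟩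
  have hp : IsPrimitiveRoot (omega N) N := Complex.isPrimitiveRoot_exp N (NeZero.ne N)
  rw [chi, hp.pow_eq_one_iff_dvd] at h
  exact (ZMod.val_eq_zero a).1 (Nat.eq_zero_of_dvd_of_lt h (ZMod.val_lt a))

/-- In the limit the two products in `x` are mutually inverse when `a = b`, while `ρ → 0` kills the
third product unless it is empty, that is unless `a = b`. -/
theorem tendsto_kern {N : ℕ} [NeZero N] {Y : Type*} {l : Filter Y} {kap : ℂ} (hkap : kap ≠ 0)
    {k ρ η u u₁ u' w' d₁ : Y → ℂ} {η₀ v v₁ w₀ : ℂ} (hη₀ : η₀ ≠ 0)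
    (hη : η₀ ^ N = (omegaHalf N * v) ^ N - (kap * v₁) ^ N) (hv : v ≠ 0) (hv₁ : v₁ ≠ 0)
    (hw₀ : w₀ ≠ 0) (tk : Tendsto k l (𝓝 kap)) (tρ : Tendsto ρ l (𝓝 0))
    (tη : Tendsto η l (𝓝 η₀)) (tu : Tendsto u l (𝓝 v)) (tu₁ : Tendsto u₁ l (𝓝 v₁))
    (tu' : Tendsto u' l (𝓝 v)) (tw' : Tendsto w' l (𝓝 w₀)) (td₁ : Tendsto d₁ l (𝓝 1))
    (a x b : ZMod N) :
    Tendsto (fun y => kern N kap (k y) (ρ y) (η y) (u y) (u₁ y) (u' y) (w' y) (d₁ y) a x b) l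
      (𝓝 (if a = b then 1 else 0)) := by
  have hne : ∀ n : ZMod N, omegaHalf N * v - kap * v₁ * chi N n ≠ 0 :=
    sub_chi_ne_zero (by rw [← hη]; exact pow_ne_zero _ hη₀)
  have t1 : ∀ n : ZMod N, Tendsto
      (fun y => cyc (fun n => (omegaHalf N * u y - kap * u₁ y * chi N n) / η y) n) l
      (𝓝 (cyc (fun n => (omegaHalf N * v - kap * v₁ * chi N n) / η₀) n)) := fun n =>
    tendsto_cyc n fun j _ => ((tu.const_mul _).sub ((tu₁.const_mul _).mul_const _)).div tη hη₀
  have t2 : ∀ n : ZMod N, Tendsto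
      (fun y => cyc (fun n => η y * d₁ y / (omegaHalf N * u' y - k y * u₁ y * chi N n)) n) l
      (𝓝 (cyc (fun n => η₀ * 1 / (omegaHalf N * v - kap * v₁ * chi N n)) n)) := fun n =>
    tendsto_cyc n fun j _ => (tη.mul td₁).div
      ((tu'.const_mul _).sub ((tk.mul tu₁).mul_const _)) (hne _)
  have t3 : ∀ n : ZMod N, Tendsto (fun y => cyc (fun n => -(chi N 1 * ρ y * (η y * d₁ y) /
      (u₁ y * w' y)) / (kap * chi N 1 * u' y - k y * u y * chi N (1 - n))) n) l
      (𝓝 (cyc (fun n => -(chi N 1 * 0 * (η₀ * 1) / (v₁ * w₀)) /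
        (kap * chi N 1 * v - kap * v * chi N (1 - n))) n)) := by
    refine fun n => tendsto_cyc n fun j hj => ((((tρ.const_mul _).mul (tη.mul td₁)).div
      (tu₁.mul tw') (mul_ne_zero hv₁ hw₀)).neg).div
      ((tu'.const_mul _).sub ((tk.mul tu).mul_const _)) ?_
    -- The limiting denominator vanishes only at argument `0`, which the arguments `1, …, n.val`
    -- with `n.val < N` never reach.
    intro h0
    have h1 : chi N 1 * (1 - chi N (-((j + 1 : ℕ) : ZMod N))) = 0 := by
      rw [sub_eq_add_neg (1 : ZMod N), chi_add] at h0
      refine mul_left_cancel₀ (mul_ne_zero hkap hv) ?_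
      linear_combination h0
    have h2 := (mul_eq_zero.1 h1).resolve_left (chi_ne_zero N 1)
    have h3 := chi_eq_one_iff.1 (sub_eq_zero.1 h2).symm
    rw [neg_eq_zero, ZMod.natCast_eq_zero_iff] at h3
    have := Nat.le_of_dvd (Nat.succ_pos j) h3
    have := ZMod.val_lt n
    omega
  have t := ((((t1 (x - a)).mul (t2 (x - b))).const_mul (chi N ((a - b) * x)))).mul (t3 (b - a))
  refine (congrArg (Tendsto _ l ∘ 𝓝) ?_).mp t
  by_cases hab : a = b
  · subst hab
    rw [if_pos rfl, sub_self, zero_mul, chi_zero, one_mul]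
    simp only [cyc, ZMod.val_zero, Finset.range_zero, Finset.prod_empty, mul_one]
    rw [← Finset.prod_mul_distrib]
    refine Finset.prod_eq_one fun j _ => ?_
    have := hne ((j + 1 : ℕ) : ZMod N)
    field_simp
  · rw [if_neg hab]
    refine mul_eq_zero_of_right _ (Finset.prod_eq_zero (i := 0) ?_ (by simp))
    rw [Finset.mem_range, Nat.pos_iff_ne_zero, Ne, ZMod.val_eq_zero, sub_eq_zero]
    exact fun h => hab h.symm

/-- The kernels tend to `δ_{ab}`, so the intertwiner tends to the identity, and a nonzero
determinant is an open condition. -/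
theorem eventually_isUnit_intertwiner {N M : ℕ} [NeZero N] [NeZero M] {Y : Type*} {l : Filter Y}
    {kap : ℂ} (hkap : kap ≠ 0) {k ρ : Y → ℂ} {η u u' w' d : Y → ZMod M → ℂ} {η₀ v w₀ : ZMod M → ℂ}
    (hη₀ : ∀ m, η₀ m ≠ 0)
    (hη : ∀ m, η₀ m ^ N = (omegaHalf N * v m) ^ N - (kap * v (m + 1)) ^ N) (hv : ∀ m, v m ≠ 0)
    (hw₀ : ∀ m, w₀ m ≠ 0) (tk : Tendsto k l (𝓝 kap)) (tρ : Tendsto ρ l (𝓝 0))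
    (tη : ∀ m, Tendsto (fun y => η y m) l (𝓝 (η₀ m)))
    (tu : ∀ m, Tendsto (fun y => u y m) l (𝓝 (v m)))
    (tu' : ∀ m, Tendsto (fun y => u' y m) l (𝓝 (v m)))
    (tw' : ∀ m, Tendsto (fun y => w' y m) l (𝓝 (w₀ m)))
    (td : ∀ m, Tendsto (fun y => d y m) l (𝓝 1)) :
    ∀ᶠ y in l, IsUnit (intertwiner N M kap (k y) (ρ y) (η y) (u y) (u' y) (w' y) (d y)) := by
  have h1 : Tendsto (fun y => intertwiner N M kap (k y) (ρ y) (η y) (u y) (u' y) (w' y) (d y)) l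
      (𝓝 1) := by
    rw [← mpo_kernelMatrix_delta N M]
    refine tendsto_mpo fun m a b φ x => ?_
    simp only [kernelMatrix, Matrix.of_apply]
    split_ifs with h h'
    · simpa [h'] using tendsto_kern hkap (hη₀ m) (hη m) (hv m) (hv (m + 1)) (hw₀ m) tk tρ (tη m)
        (tu m) (tu (m + 1)) (tu' m) (tw' m) (td (m + 1)) a x b
    · simpa [h'] using tendsto_kern hkap (hη₀ m) (hη m) (hv m) (hv (m + 1)) (hw₀ m) tk tρ (tη m)
        (tu m) (tu (m + 1)) (tu' m) (tw' m) (td (m + 1)) a x b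
    · exact tendsto_const_nhds
  have h2 := ((continuous_id.matrix_det).tendsto (1 : Op N M)).comp h1
  have h3 := h2.eventually (isOpen_ne (x := (0 : ℂ)) |>.mem_nhds (by simp))
  filter_upwards [h3] with y hy
  rw [Matrix.isUnit_iff_isUnit_det, isUnit_iff_ne_zero]
  exact hy

end

section
open Matrix

/-! ### Solitonic tau-functions as determinants -/

/-- The `n`-solitonic tau-function with spectral parameters `p`, `q` and amplitudes `f`. -/
noncomputable def sol : (n : ℕ) → (Fin n → ℂ) → (Fin n → ℂ) → (Fin n → ℂ) → ℂ
  | 0, _, _, _ => 1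
  | n + 1, p, q, f =>
    sol n (fun k => p k.castSucc) (fun k => q k.castSucc) (fun k => f k.castSucc) +
      f (Fin.last n) * sol n (fun k => p k.castSucc) (fun k => q k.castSucc) fun k =>
        ((p k.castSucc - p (Fin.last n)) * (q k.castSucc - q (Fin.last n))) /
          ((p k.castSucc - q (Fin.last n)) * (q k.castSucc - p (Fin.last n))) * f k.castSucc

/-- The Cauchy-like matrix of the tau-function. -/
noncomputable def cauchy {n : ℕ} (p q f : Fin n → ℂ) : Matrix (Fin n) (Fin n) ℂ :=
  of fun j k => f j * (p j - q j) / (p j - q k)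

/-- Linearity in the last row, which is `(0, 1) + c (r, 1)`, followed by two Schur complements. -/
theorem det_fromBlocks_smul_row {n : ℕ} (S : Matrix (Fin n) (Fin n) ℂ) (B : Matrix (Fin n) (Fin 1) ℂ)
    (r : Matrix (Fin 1) (Fin n) ℂ) (c : ℂ) :
    (fromBlocks S B (c • r) (1 + c • 1)).det = S.det + c * (S - B * r).det := by
  let X : Matrix (Fin n ⊕ Fin 1) (Fin n ⊕ Fin 1) ℂ := fromBlocks S B 0 0
  have hX : ∀ (r' : Matrix (Fin 1) (Fin n) ℂ) (x : Matrix (Fin 1) (Fin 1) ℂ),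
      fromBlocks S B r' x = X.updateRow (Sum.inr 0) (Sum.elim (r' 0) (x 0)) := by
    intro r' x
    ext i j
    rcases i with i | i
    · rw [updateRow_ne (by simp)]
      rcases j with j | j <;> simp [X]
    · rw [Fin.fin_one_eq_zero i, updateRow_self]
      rcases j with j | j <;> simp
  have hsum : Sum.elim ((c • r) 0) ((1 + c • (1 : Matrix (Fin 1) (Fin 1) ℂ)) 0) =
      Sum.elim ((0 : Matrix (Fin 1) (Fin n) ℂ) 0) ((1 : Matrix (Fin 1) (Fin 1) ℂ) 0) +
        c • Sum.elim (r 0) ((1 : Matrix (Fin 1) (Fin 1) ℂ) 0) := by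
    ext j
    rcases j with j | j <;> simp
  rw [hX, hsum, det_updateRow_add, det_updateRow_smul, ← hX, ← hX, det_fromBlocks_one₂₂,
    det_fromBlocks_one₂₂, Matrix.mul_zero, sub_zero]

/-- Linearity in the last amplitude reproduces the two terms of the recursion. In the second, the
Schur complement of a Cauchy-like matrix is again Cauchy-like; its amplitudes acquire the phase
shifts once the diagonal factor `s` is moved to the other side by Sylvester's identity. -/
theorem sol_eq_det : ∀ (n : ℕ) (p q f : Fin n → ℂ), (∀ j k, p j ≠ q k) →
    sol n p q f = (1 + cauchy p q f).det
  | 0, p, q, f, _ => by simp [sol]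
  | n + 1, p, q, f, hpq => by
    have hpq' : ∀ j k, p j - q k ≠ 0 := fun j k => sub_ne_zero.2 (hpq j k)
    rw [sol, sol_eq_det n _ _ _ fun j k => hpq _ _, sol_eq_det n _ _ _ fun j k => hpq _ _]
    let r : Matrix (Fin 1) (Fin n) ℂ := of fun _ k =>
      (p (Fin.last n) - q (Fin.last n)) / (p (Fin.last n) - q k.castSucc)
    let B : Matrix (Fin n) (Fin 1) ℂ := of fun j _ =>
      f j.castSucc * (p j.castSucc - q j.castSucc) / (p j.castSucc - q (Fin.last n))
    have e1 : (1 + cauchy p q f).det = (fromBlocks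
        (1 + cauchy (fun k => p k.castSucc) (fun k => q k.castSucc) fun k => f k.castSucc) B
        (f (Fin.last n) • r) (1 + f (Fin.last n) • 1)).det := by
      rw [← det_submatrix_equiv_self (finSumFinEquiv (m := n) (n := 1))]
      congr 1
      have h1 : ∀ j : Fin n, Fin.castAdd 1 j = j.castSucc := fun _ => rfl
      have h2 : ∀ j : Fin 1, Fin.natAdd n j = Fin.last n := fun j => by
        rw [Fin.fin_one_eq_zero j]; rfl
      ext i j
      rcases i with i | i <;> rcases j with j | j
      · simp [h1, cauchy, Matrix.one_apply]
      · simp [h1, h2, cauchy, B]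
      · have := hpq' (Fin.last n) j.castSucc
        simp [h1, h2, cauchy, r, (Fin.castSucc_ne_last j).symm]
        ring
      · have := hpq' (Fin.last n) (Fin.last n)
        rw [Fin.fin_one_eq_zero i, Fin.fin_one_eq_zero j]
        simp [h2, cauchy, this]
    rw [e1, det_fromBlocks_smul_row]
    congr 2
    let s : Fin n → ℂ := fun j =>
      (q j.castSucc - q (Fin.last n)) / (q j.castSucc - p (Fin.last n))
    let G : Matrix (Fin n) (Fin n) ℂ := of fun j k =>
      f j.castSucc * (p j.castSucc - q j.castSucc) * (p j.castSucc - p (Fin.last n)) /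
        ((p j.castSucc - q (Fin.last n)) * (p j.castSucc - q k.castSucc))
    have h1 : cauchy (fun k => p k.castSucc) (fun k => q k.castSucc) (fun k =>
        ((p k.castSucc - p (Fin.last n)) * (q k.castSucc - q (Fin.last n))) /
          ((p k.castSucc - q (Fin.last n)) * (q k.castSucc - p (Fin.last n))) * f k.castSucc) =
        diagonal s * G := by
      ext j k
      rw [diagonal_mul]
      have a1 := hpq' j.castSucc (Fin.last n)
      have a2 := hpq' j.castSucc k.castSucc
      have a3 : q j.castSucc - p (Fin.last n) ≠ 0 := sub_ne_zero.2 (hpq _ _).symm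
      simp only [cauchy, G, s, of_apply]
      field_simp
    have h2 : 1 + cauchy (fun k => p k.castSucc) (fun k => q k.castSucc) (fun k => f k.castSucc) -
        B * r = 1 + G * diagonal s := by
      ext j k
      rw [Matrix.sub_apply, Matrix.add_apply, Matrix.add_apply, mul_diagonal, mul_apply, Fin.sum_univ_one]
      have a1 := hpq' j.castSucc (Fin.last n)
      have a2 := hpq' j.castSucc k.castSucc
      have a3 : q k.castSucc - p (Fin.last n) ≠ 0 := sub_ne_zero.2 (hpq _ _).symm
      have a4 := hpq' (Fin.last n) k.castSucc
      simp only [cauchy, G, s, of_apply, B, r]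
      rw [add_sub_assoc]
      congr 1
      field_simp
      ring
    rw [h1, h2, det_one_add_mul_comm]

/-! ### The Hirota–Miwa equation -/

section
variable {n : ℕ} {p q : Fin n → ℂ} (f : Fin n → ℂ)

/-- The multiplier of the amplitudes under the elementary shift with parameter `a`. -/
noncomputable def shift (p q : Fin n → ℂ) (a : ℂ) (k : Fin n) : ℂ := (p k - a) / (q k - a)

/-- Once `1 / (q - a)` is moved from rows to columns, `(p - a) / ((p - q)(q - a)) = 1 / (p - q) + 1
/ (q - a)` exhibits the shift as a rank-one perturbation. -/
theorem sol_shift (hpq : ∀ j k, p j ≠ q k) (h0 : sol n p q f ≠ 0) {a : ℂ} (ha : ∀ k, q k ≠ a) :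
    sol n p q (fun k => f k * shift p q a k) = sol n p q f *
      (1 + (fun k => (q k - a)⁻¹) ⬝ᵥ
        ((1 + cauchy p q f)⁻¹ *ᵥ fun k => f k * (p k - q k))) := by
  have hpq' : ∀ j k, p j - q k ≠ 0 := fun j k => sub_ne_zero.2 (hpq j k)
  rw [sol_eq_det n p q _ hpq] at h0 ⊢
  rw [sol_eq_det n p q _ hpq]
  let v : Fin n → ℂ := fun k => (q k - a)⁻¹
  let G : Matrix (Fin n) (Fin n) ℂ := of fun j k => f j * (p j - q j) * (p j - a) / (p j - q k)
  have h1 : cauchy p q (fun k => f k * shift p q a k) = diagonal v * G := by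
    ext j k
    rw [diagonal_mul]
    simp only [cauchy, G, v, of_apply, shift]
    ring
  have h2 : 1 + G * diagonal v = (1 + cauchy p q f) +
      (of fun j (_ : Fin 1) => f j * (p j - q j)) * (of fun (_ : Fin 1) k => v k) := by
    ext j k
    rw [Matrix.add_apply, Matrix.add_apply, Matrix.add_apply, mul_diagonal, mul_apply, Fin.sum_univ_one, add_assoc]
    congr 1
    have a1 := hpq' j k
    have a2 : q k - a ≠ 0 := sub_ne_zero.2 (ha k)
    simp only [cauchy, G, v, of_apply]
    field_simp
    ring
  rw [h1, det_one_add_mul_comm, h2, det_add_mul _ _ (isUnit_iff_ne_zero.2 h0), det_fin_one,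
    Matrix.add_apply, one_apply_eq]
  congr 2
  rw [Matrix.mul_assoc, mul_apply]
  rfl

/-- With two shifts, partial fractions give a rank-two perturbation. Multiplied by `a - b`, its `2 ×
2` determinant becomes antisymmetric in `a` and `b`. -/
theorem sol_shift_shift (hpq : ∀ j k, p j ≠ q k) (h0 : sol n p q f ≠ 0) {a b : ℂ}
    (ha : ∀ k, q k ≠ a) (hb : ∀ k, q k ≠ b) (hab : a ≠ b) :
    (a - b) * sol n p q (fun k => f k * shift p q a k * shift p q b k) = sol n p q f *
      ((1 + (fun k => (q k - b)⁻¹) ⬝ᵥ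
          ((1 + cauchy p q f)⁻¹ *ᵥ fun k => f k * (p k - q k))) *
        (a + (fun k => (q k - a)⁻¹) ⬝ᵥ
          ((1 + cauchy p q f)⁻¹ *ᵥ fun k => f k * (p k - q k) * p k)) -
      (1 + (fun k => (q k - a)⁻¹) ⬝ᵥ
          ((1 + cauchy p q f)⁻¹ *ᵥ fun k => f k * (p k - q k))) *
        (b + (fun k => (q k - b)⁻¹) ⬝ᵥ
          ((1 + cauchy p q f)⁻¹ *ᵥ fun k => f k * (p k - q k) * p k))) := by
  have hpq' : ∀ j k, p j - q k ≠ 0 := fun j k => sub_ne_zero.2 (hpq j k)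
  have hab' : a - b ≠ 0 := sub_ne_zero.2 hab
  rw [sol_eq_det n p q _ hpq] at h0 ⊢
  rw [sol_eq_det n p q _ hpq]
  let va : Fin n → ℂ := fun k => (q k - a)⁻¹
  let vb : Fin n → ℂ := fun k => (q k - b)⁻¹
  let G : Matrix (Fin n) (Fin n) ℂ := of fun j k =>
    f j * (p j - q j) * ((p j - a) * (p j - b)) / (p j - q k)
  let U : Matrix (Fin n) (Fin 2) ℂ :=
    (of ![fun j => f j * (p j - q j) * p j, fun j => f j * (p j - q j)])ᵀ
  let V : Matrix (Fin 2) (Fin n) ℂ :=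
    of ![(a - b)⁻¹ • (va - vb), (a - b)⁻¹ • (a • vb - b • va)]
  have h1 : cauchy p q (fun k => f k * shift p q a k * shift p q b k) =
      diagonal (fun k => va k * vb k) * G := by
    ext j k
    rw [diagonal_mul]
    simp only [cauchy, G, va, vb, of_apply, shift]
    ring
  have h2 : 1 + G * diagonal (fun k => va k * vb k) = (1 + cauchy p q f) + U * V := by
    ext j k
    rw [Matrix.add_apply, Matrix.add_apply, Matrix.add_apply, mul_diagonal, mul_apply, Fin.sum_univ_two, add_assoc]
    congr 1
    have a1 := hpq' j k
    have a2 : q k - a ≠ 0 := sub_ne_zero.2 (ha k)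
    have a3 : q k - b ≠ 0 := sub_ne_zero.2 (hb k)
    simp only [cauchy, G, va, vb, U, V, of_apply, transpose_apply, cons_val_zero, cons_val_one,
      Pi.smul_apply, Pi.sub_apply, smul_eq_mul]
    field_simp
    ring
  rw [h1, det_one_add_mul_comm, h2, det_add_mul _ _ (isUnit_iff_ne_zero.2 h0), det_fin_two]
  have hent : ∀ i j : Fin 2, (V * (1 + cauchy p q f)⁻¹ * U) i j =
      V i ⬝ᵥ ((1 + cauchy p q f)⁻¹ *ᵥ Uᵀ j) := by
    intro i j
    rw [Matrix.mul_assoc, mul_apply]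
    rfl
  have u0 : Uᵀ 0 = fun j => f j * (p j - q j) * p j := rfl
  have u1 : Uᵀ 1 = fun j => f j * (p j - q j) := rfl
  have v0 : V 0 = (a - b)⁻¹ • (va - vb) := rfl
  have v1 : V 1 = (a - b)⁻¹ • (a • vb - b • va) := rfl
  simp only [Matrix.add_apply, hent, u0, u1, v0, v1, smul_dotProduct, sub_dotProduct, smul_eq_mul,
    one_apply_eq, one_apply_ne (zero_ne_one : (0 : Fin 2) ≠ 1),
    one_apply_ne (one_ne_zero : (1 : Fin 2) ≠ 0)]
  change _ = (1 + cauchy p q f).det * ((1 + vb ⬝ᵥ _) * (a + va ⬝ᵥ _) -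
    (1 + va ⬝ᵥ _) * (b + vb ⬝ᵥ _))
  generalize va ⬝ᵥ ((1 + cauchy p q f)⁻¹ *ᵥ fun k => f k * (p k - q k)) = A0
  generalize vb ⬝ᵥ ((1 + cauchy p q f)⁻¹ *ᵥ fun k => f k * (p k - q k)) = B0
  generalize va ⬝ᵥ ((1 + cauchy p q f)⁻¹ *ᵥ fun k => f k * (p k - q k) * p k) = A1
  generalize vb ⬝ᵥ ((1 + cauchy p q f)⁻¹ *ᵥ fun k => f k * (p k - q k) * p k) = B1
  field_simp
  ring

/-- The Hirota–Miwa equation. -/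
theorem hirota_miwa (hpq : ∀ j k, p j ≠ q k) (h0 : sol n p q f ≠ 0) {a b c : ℂ}
    (ha : ∀ k, q k ≠ a) (hb : ∀ k, q k ≠ b) (hc : ∀ k, q k ≠ c) :
    (a - b) * sol n p q (fun k => f k * shift p q a k * shift p q b k) *
        sol n p q (fun k => f k * shift p q c k) +
      (b - c) * sol n p q (fun k => f k * shift p q b k * shift p q c k) *
        sol n p q (fun k => f k * shift p q a k) +
      (c - a) * sol n p q (fun k => f k * shift p q c k * shift p q a k) *
        sol n p q (fun k => f k * shift p q b k) = 0 := by
  -- Each parameter carries a vector in `ℂ²`: up to the factor `sol n p q f`, one shift gives its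
  -- first coordinate and two shifts a `2 × 2` determinant. The claim is then a three-term Plücker
  -- relation.
  have key : ∀ x y : ℂ, (∀ k, q k ≠ x) → (∀ k, q k ≠ y) →
      (x - y) * sol n p q (fun k => f k * shift p q x k * shift p q y k) = sol n p q f *
      ((1 + (fun k => (q k - y)⁻¹) ⬝ᵥ
          ((1 + cauchy p q f)⁻¹ *ᵥ fun k => f k * (p k - q k))) *
        (x + (fun k => (q k - x)⁻¹) ⬝ᵥ
          ((1 + cauchy p q f)⁻¹ *ᵥ fun k => f k * (p k - q k) * p k)) -
      (1 + (fun k => (q k - x)⁻¹) ⬝ᵥ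
          ((1 + cauchy p q f)⁻¹ *ᵥ fun k => f k * (p k - q k))) *
        (y + (fun k => (q k - y)⁻¹) ⬝ᵥ
          ((1 + cauchy p q f)⁻¹ *ᵥ fun k => f k * (p k - q k) * p k))) := by
    intro x y hx hy
    rcases eq_or_ne x y with rfl | hxy
    · ring
    · exact sol_shift_shift f hpq h0 hx hy hxy
  rw [key a b ha hb, key b c hb hc, key c a hc ha, sol_shift f hpq h0 ha, sol_shift f hpq h0 hb,
    sol_shift f hpq h0 hc]
  ring

end

end

section
open Matrix

/-! ### Similarity of chains -/

/-- The parameters `u_m` determined by the roots `τ_m`. -/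
noncomputable def uOf (N : ℕ) {M : ℕ} (τ : ZMod M → ℂ) (m : ZMod M) : ℂ :=
  -(omegaHalf N)⁻¹ * (τ (m - 1) / τ m)

/-- The parameters `w_m` determined by the roots `θ_m`. -/
noncomputable def wOf {M : ℕ} (θ : ZMod M → ℂ) (m : ZMod M) : ℂ := -(θ m / θ (m - 1))

theorem omegaHalf_pow (N : ℕ) [NeZero N] : omegaHalf N ^ N = -1 := by
  rw [omegaHalf, ← Complex.exp_nat_mul, mul_div_cancel₀ _ (Nat.cast_ne_zero.2 (NeZero.ne N)),
    Complex.exp_pi_mul_I]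

theorem omegaHalf_ne_zero (N : ℕ) : omegaHalf N ≠ 0 := Complex.exp_ne_zero _

theorem uOf_ne_zero {N M : ℕ} {τ : ZMod M → ℂ} (h : ∀ m, τ m ≠ 0) (m : ZMod M) : uOf N τ m ≠ 0 :=
  mul_ne_zero (neg_ne_zero.2 (inv_ne_zero (omegaHalf_ne_zero N))) (div_ne_zero (h _) (h _))

theorem wOf_ne_zero {M : ℕ} {θ : ZMod M → ℂ} (h : ∀ m, θ m ≠ 0) (m : ZMod M) : wOf θ m ≠ 0 :=
  neg_ne_zero.2 (div_ne_zero (h _) (h _))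

theorem uOf_pow {N M : ℕ} [NeZero N] (τ : ZMod M → ℂ) (m : ZMod M) :
    uOf N τ m ^ N = -((-1) ^ N * (τ (m - 1) ^ N / τ m ^ N)) := by
  rw [uOf, mul_pow, neg_pow, inv_pow, omegaHalf_pow, div_pow, inv_neg, inv_one]
  ring

theorem wOf_pow {M : ℕ} (N : ℕ) (θ : ZMod M → ℂ) (m : ZMod M) :
    wOf θ m ^ N = (-1) ^ N * (θ m ^ N / θ (m - 1) ^ N) := by
  rw [wOf, neg_pow, div_pow]

/-- The transfer matrices of two chains are conjugate, uniformly in the spectral parameter. -/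
def Similar (N M : ℕ) [NeZero N] [NeZero M] (kap : ℂ) (u w u' w' : ZMod M → ℂ) : Prop :=
  ∃ S : Op N M, IsUnit S ∧
    ∀ lam : ℂ, transfer N M lam kap u w * S = S * transfer N M lam kap u' w'

section
variable {N M : ℕ} [NeZero N] [NeZero M] {kap : ℂ} {u w u' w' u'' w'' : ZMod M → ℂ}

theorem Similar.symm (h : Similar N M kap u w u' w') : Similar N M kap u' w' u w := by
  obtain ⟨S, ⟨S, rfl⟩, hS⟩ := h
  refine ⟨(S⁻¹ : (Op N M)ˣ), Units.isUnit _, fun lam => ?_⟩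
  rw [Units.eq_inv_mul_iff_mul_eq, ← mul_assoc, ← hS, mul_assoc, Units.mul_inv, mul_one]

theorem Similar.trans (h : Similar N M kap u w u' w') (h' : Similar N M kap u' w' u'' w'') :
    Similar N M kap u w u'' w'' := by
  obtain ⟨S, hS, h1⟩ := h
  obtain ⟨S', hS', h2⟩ := h'
  exact ⟨S * S', hS.mul hS', fun lam => by rw [← mul_assoc, h1, mul_assoc, h2, mul_assoc]⟩

/-- In the local matrices `w` occurs exactly where the label drops by `1`, so conjugation by a
diagonal character rescales it and nothing else. -/
theorem similar_mul_chi_right (b : ZMod M → ZMod N) :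
    Similar N M kap u w u fun m => w m * chi N (b m) := by
  let D : Config N M → ℂ := fun α => ∏ m, chi N (-(b m) * α m)
  have hD : ∀ α, D α ≠ 0 := fun α => Finset.prod_ne_zero_iff.2 fun m _ => chi_ne_zero N _
  refine ⟨diagonal D, ?_, fun lam => ?_⟩
  · rw [isUnit_iff_isUnit_det, det_diagonal, isUnit_iff_ne_zero]
    exact Finset.prod_ne_zero_iff.2 fun α _ => hD α
  · rw [transfer_eq_mpo, transfer_eq_mpo]
    have h : (mpo fun m a c => localLax (chi N) (omegaHalf N) kap lam⁻¹ (u m)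
        (w m * chi N (b m)) a c) = mpo fun m a c => chi N (-(b m) * (c - a)) •
          localLax (chi N) (omegaHalf N) kap lam⁻¹ (u m) (w m) a c := by
      congr 1
      funext m a c
      have hc : ∀ z : ℂ, (if c = a - 1 then z * chi N (b m) else 0) =
          chi N (-(b m) * (c - a)) * if c = a - 1 then z else 0 := by
        intro z
        split_ifs with hca
        · rw [hca]; ring_nf
        · ring
      have hc' : ∀ z : ℂ, (if c = a then z else 0) =
          chi N (-(b m) * (c - a)) * if c = a then z else 0 := by
        intro z
        split_ifs with hca
        · rw [hca, sub_self, mul_zero, chi_zero, one_mul]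
        · ring
      ext i j
      have hw := hc (w m)
      have huw := hc (kap * lam⁻¹ * u m * w m * chi N a)
      have h1 := hc' 1
      have hu := hc' (-(omegaHalf N * lam⁻¹ * u m * chi N a))
      fin_cases i <;> fin_cases j <;> simp only [localLax, Fin.zero_eta, Fin.mk_one, Fin.isValue,
        of_apply, cons_val', cons_val_zero, cons_val_one, cons_val_fin_one, Matrix.smul_apply, smul_eq_mul,
        mul_zero]
      · rw [mul_add, ← h1, ← huw]
        ring_nf
      · exact hu
      · exact hw
    ext α β
    rw [mul_diagonal, diagonal_mul, h, mpo_smul]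
    have hprod : D α * ∏ m, chi N (-(b m) * (β m - α m)) = D β := by
      rw [← Finset.prod_mul_distrib]
      refine Finset.prod_congr rfl fun m _ => ?_
      rw [← chi_add]
      ring_nf
    rw [← mul_assoc, hprod, mul_comm]

/-- Translation of the labels rescales each `x_m` by a root of unity and commutes with every `z_m`.
-/
theorem similar_mul_chi_left (c : ZMod M → ZMod N) :
    Similar N M kap u w (fun m => u m * chi N (c m)) w := by
  let P : Config N M → Op N M := fun c => of fun α β => if β = α - c then 1 else 0
  have hPl : ∀ (c : Config N M) (A : Op N M) α β, (P c * A) α β = A (α - c) β := by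
    intro c A α β
    simp [P, mul_apply]
  have hP : ∀ c c', P c * P c' = P (c + c') := by
    intro c c'
    ext α β
    rw [hPl]
    simp [P, sub_sub]
  have hP0 : P 0 = 1 := by
    ext α β
    simp [P, Matrix.one_apply, eq_comm]
  refine ⟨P c, ?_, fun lam => ?_⟩
  · rw [isUnit_iff_isUnit_det]
    refine isUnit_det_of_right_inverse (B := P (-c)) ?_
    rw [hP, add_neg_cancel, hP0]
  · rw [transfer_eq_mpo, transfer_eq_mpo]
    ext α β
    have h1 : ∀ A : Op N M, (A * P c) α β = A α (β + c) := by
      intro A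
      have : ∀ γ, β = γ - c ↔ γ = β + c := fun γ => by rw [eq_sub_iff_add_eq, eq_comm]
      simp [P, mul_apply, this]
    rw [h1, hPl, mpo, mpo, of_apply, of_apply]
    congr 3
    funext m
    have hχ : chi N (α m) = chi N (c m) * chi N (α m - c m) := by rw [← chi_add]; ring_nf
    have e1 : β m + c m = α m ↔ β m = α m - c m := eq_sub_iff_add_eq.symm
    have e2 : β m + c m = α m - 1 ↔ β m = α m - c m - 1 := by
      rw [← eq_sub_iff_add_eq, sub_right_comm]
    ext i j
    fin_cases i <;> fin_cases j <;> simp [localLax, e1, e2, hχ, mul_assoc, mul_left_comm]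

theorem exists_chi_of_pow_eq {x y : ℂ} (hx : x ≠ 0) (h : x ^ N = y ^ N) :
    ∃ a : ZMod N, y = x * chi N a := by
  have hp : IsPrimitiveRoot (omega N) N := Complex.isPrimitiveRoot_exp N (NeZero.ne N)
  have h1 : (y / x) ^ N = 1 := by rw [div_pow, ← h, div_self (pow_ne_zero _ hx)]
  obtain ⟨i, hi, h2⟩ := hp.eq_pow_of_pow_eq_one h1
  refine ⟨(i : ZMod N), ?_⟩
  rw [chi, ZMod.val_cast_of_lt hi, h2]
  field_simp

theorem similar_of_pow_eq (hu : ∀ m, u m ≠ 0) (hw : ∀ m, w m ≠ 0) (h : ∀ m, u m ^ N = u' m ^ N)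
    (h' : ∀ m, w m ^ N = w' m ^ N) : Similar N M kap u w u' w' := by
  choose c hc using fun m => exists_chi_of_pow_eq (hu m) (h m)
  choose b hb using fun m => exists_chi_of_pow_eq (hw m) (h' m)
  rw [funext hc, funext hb]
  exact (similar_mul_chi_left c).trans (similar_mul_chi_right b)

/-! ### The Bäcklund transformation -/

/-- The given `d` solves `hd`, because `u' w' / (u w)` is a ratio of consecutive values of `τ θ' /
(τ' θ)`. `I0` with `I1`, and `I1` with `I2`, share the factor `Θ m`; cancelling it yields the Fermat
relations `hG` and `hF`, with constants absorbed by `δ` and `ρ`. -/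
theorem transfer_backlund {τ θ τ' θ' Θ η : ZMod M → ℂ} {ξ k δ ρ : ℂ}
    (hτ : ∀ m, τ m ≠ 0) (hθ : ∀ m, θ m ≠ 0) (hτ' : ∀ m, τ' m ≠ 0) (hθ' : ∀ m, θ' m ≠ 0)
    (hη0 : ∀ m, η m ≠ 0) (hξ1 : 1 - ξ ≠ 0) (hξK : kap ^ N + ξ ≠ 0) (hK : 1 + kap ^ N ≠ 0)
    (hk : k ^ N = -ξ) (hδ : δ ^ N = (1 - ξ) / (1 + kap ^ N))
    (hρ : (-ρ) ^ N = (kap ^ N + ξ) / (1 - ξ))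
    (hη : ∀ m, η m ^ N = (omegaHalf N * uOf N τ m) ^ N - (kap * uOf N τ (m + 1)) ^ N)
    (I0 : ∀ m, τ (m - 1) ^ N * τ (m + 1) ^ N + kap ^ N * (τ m ^ N * τ m ^ N) =
      (1 + kap ^ N) * (θ m ^ N * Θ m))
    (I1 : ∀ m, τ' (m - 1) ^ N * τ (m + 1) ^ N - ξ * (τ m ^ N * τ' m ^ N) =
      (1 - ξ) * (θ' m ^ N * Θ m))
    (I2 : ∀ m, kap ^ N * (τ' (m - 1) ^ N * τ m ^ N) + ξ * (τ (m - 1) ^ N * τ' m ^ N) =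
      (kap ^ N + ξ) * (θ' (m - 1) ^ N * Θ m)) (lam : ℂ) :
    transfer N M lam kap (uOf N τ) (wOf θ) * intertwiner N M kap k ρ η (uOf N τ) (uOf N τ')
        (wOf θ') (fun m => δ * (τ (m - 1) * θ' (m - 1) / (τ' (m - 1) * θ (m - 1)))) =
      intertwiner N M kap k ρ η (uOf N τ) (uOf N τ')
        (wOf θ') (fun m => δ * (τ (m - 1) * θ' (m - 1) / (τ' (m - 1) * θ (m - 1)))) *
        transfer N M lam kap (uOf N τ') (wOf θ') := by
  have hN := NeZero.ne N
  have pτ := fun m => pow_ne_zero N (hτ m)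
  have pθ := fun m => pow_ne_zero N (hθ m)
  have pτ' := fun m => pow_ne_zero N (hτ' m)
  have pθ' := fun m => pow_ne_zero N (hθ' m)
  have hs : ((-1 : ℂ) ^ N) * (-1) ^ N = 1 := by rw [← mul_pow]; simp
  have hs0 : ((-1 : ℂ) ^ N) ≠ 0 := pow_ne_zero _ (by simp)
  have hδ0 : δ ≠ 0 := by
    rintro rfl
    rw [zero_pow hN] at hδ
    exact div_ne_zero hξ1 hK hδ.symm
  have hρ0 : ρ ≠ 0 := by
    rintro rfl
    rw [neg_zero, zero_pow hN] at hρ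
    exact div_ne_zero hξK hξ1 hρ.symm
  have hB : ∀ m, τ' (m - 1) ^ N / τ' m ^ N - ξ * (τ m ^ N / τ (m + 1) ^ N) =
      (1 - ξ) * (θ' m ^ N * Θ m) / (τ' m ^ N * τ (m + 1) ^ N) := by
    intro m
    have a2 := pτ (m + 1)
    have a3 := pτ' m
    field_simp
    linear_combination I1 m
  have hG : ∀ m, (η m * (δ * (τ (m + 1 - 1) * θ' (m + 1 - 1) /
      (τ' (m + 1 - 1) * θ (m + 1 - 1))))) ^ N =
      (omegaHalf N * uOf N τ' m) ^ N - (k * uOf N τ (m + 1)) ^ N := by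
    intro m
    have i0 := I0 m
    have a1 := pτ m
    have a2 := pτ (m + 1)
    have a3 := pτ' m
    have a4 := pθ m
    rw [mul_pow, hη, mul_pow (omegaHalf N), mul_pow kap, mul_pow δ, div_pow, mul_pow (τ _),
      mul_pow (τ' _), mul_pow (omegaHalf N), mul_pow k, hδ, hk, omegaHalf_pow, uOf_pow, uOf_pow,
      uOf_pow, add_sub_cancel_right]
    have e0 : τ (m - 1) ^ N / τ m ^ N + kap ^ N * (τ m ^ N / τ (m + 1) ^ N) =
        (1 + kap ^ N) * (θ m ^ N * Θ m) / (τ m ^ N * τ (m + 1) ^ N) := by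
      field_simp
      linear_combination i0
    have e1 := hB m
    trans (-1) ^ N * (τ (m - 1) ^ N / τ m ^ N + kap ^ N * (τ m ^ N / τ (m + 1) ^ N)) *
      ((1 - ξ) / (1 + kap ^ N) * (τ m ^ N * θ' m ^ N / (τ' m ^ N * θ m ^ N)))
    · ring
    trans (-1) ^ N * (τ' (m - 1) ^ N / τ' m ^ N - ξ * (τ m ^ N / τ (m + 1) ^ N))
    · rw [e0, e1]
      field_simp
    · ring
  refine transfer_mul_intertwiner hρ0 hη0 ?_ (uOf_ne_zero hτ) (wOf_ne_zero hθ') hη hG ?_ ?_ lam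
  · intro m
    exact mul_ne_zero hδ0 (div_ne_zero (mul_ne_zero (hτ _) (hθ' _)) (mul_ne_zero (hτ' _) (hθ _)))
  · intro m
    have i2 := I2 m
    have e1 : (-(chi N 1 * ρ * (η m * (δ * (τ (m + 1 - 1) * θ' (m + 1 - 1) /
        (τ' (m + 1 - 1) * θ (m + 1 - 1))))) / (uOf N τ (m + 1) * wOf θ' m))) ^ N =
        (-ρ) ^ N * (η m * (δ * (τ (m + 1 - 1) * θ' (m + 1 - 1) /
        (τ' (m + 1 - 1) * θ (m + 1 - 1))))) ^ N / (uOf N τ (m + 1) ^ N * wOf θ' m ^ N) := by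
      have := chi_pow N 1
      rw [← mul_pow, ← mul_pow, ← div_pow, neg_mul, neg_div, mul_assoc, mul_div_assoc, neg_mul_eq_mul_neg,
        mul_pow, this, one_mul]
    have a1 := pτ m
    have a2 := pτ (m + 1)
    have a3 := pτ' m
    have a4 := pθ' m
    have a5 := pθ' (m - 1)
    rw [e1, hG, hρ, mul_pow, mul_pow, mul_pow, mul_pow, mul_pow, hk, omegaHalf_pow, chi_pow, uOf_pow,
      uOf_pow, uOf_pow, wOf_pow, add_sub_cancel_right]
    have e2 : kap ^ N * (τ' (m - 1) ^ N / τ' m ^ N) + ξ * (τ (m - 1) ^ N / τ m ^ N) =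
        (kap ^ N + ξ) * (θ' (m - 1) ^ N * Θ m) / (τ' m ^ N * τ m ^ N) := by
      field_simp
      linear_combination i2
    trans -((-1) ^ N * (-1) ^ N * (-1) ^ N * ((kap ^ N + ξ) / (1 - ξ) *
      (τ' (m - 1) ^ N / τ' m ^ N - ξ * (τ m ^ N / τ (m + 1) ^ N)) /
      (τ m ^ N / τ (m + 1) ^ N * (θ' m ^ N / θ' (m - 1) ^ N))))
    · rw [hs]
      generalize ((-1 : ℂ) ^ N) = s at *
      field_simp
      linear_combination (τ' (m - 1) ^ N * τ (m + 1) ^ N - ξ * τ m ^ N * τ' m ^ N) * hs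
    trans -((-1) ^ N * (kap ^ N * (τ' (m - 1) ^ N / τ' m ^ N) + ξ * (τ (m - 1) ^ N / τ m ^ N)))
    · rw [e2, hB m, hs]
      field_simp
    · ring
  · intro m
    have a1 := hτ m
    have a2 := hτ' m
    have a3 := hθ m
    have a4 := hθ' m
    have a5 := hτ (m - 1)
    have a6 := hτ' (m - 1)
    have a7 := hθ (m - 1)
    have a8 := hθ' (m - 1)
    have a9 := omegaHalf_ne_zero N
    simp only [uOf, wOf, add_sub_cancel_right]
    field_simp

end

end

section

/-! ### The spectral parameters -/

/-- The properties of the spectral parameters `p_k = Δ(φ_k)` and `q_k = Δ*(φ_k)`. -/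
structure SpectralData (M : ℕ) (K : ℂ) {n : ℕ} (p q : Fin n → ℂ) : Prop where
  K_ne : K ≠ 0
  one_add_K_ne : 1 + K ≠ 0
  rel : ∀ k, p k * q k = p k + q k + K
  p_ne : ∀ k, p k ≠ 0
  q_ne : ∀ k, q k ≠ 0
  q_ne_one : ∀ k, q k ≠ 1
  p_ne_q : ∀ j k, p j ≠ q k
  p_inj : Function.Injective p
  per : ∀ k, (p k / q k) ^ M = 1

theorem radius_sq (K : ℂ) (φ : ℝ) :
    radius K φ ^ 2 = 2 * radius K φ * (Real.cos φ : ℂ) + K := by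
  have h : (((Real.cos φ : ℂ) ^ 2 + K) ^ (1 / 2 : ℂ)) ^ 2 = (Real.cos φ : ℂ) ^ 2 + K := by
    have := Complex.cpow_nat_inv_pow ((Real.cos φ : ℂ) ^ 2 + K) (n := 2) two_ne_zero
    rw [one_div]
    exact_mod_cast this
  rw [radius]
  linear_combination h

theorem exp_mul_exp_neg (z : ℂ) : Complex.exp z * Complex.exp (-z) = 1 := by
  rw [← Complex.exp_add, add_neg_cancel, Complex.exp_zero]

theorem Delta_mul_DeltaStar (K : ℂ) (φ : ℝ) :
    Delta K φ * DeltaStar K φ = Delta K φ + DeltaStar K φ + K := by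
  have h := radius_sq K φ
  have h2 : Complex.exp (Complex.I * φ) + Complex.exp (-(Complex.I * φ)) = 2 * (Real.cos φ : ℂ) := by
    rw [Complex.ofReal_cos, Complex.cos, mul_comm Complex.I]
    ring_nf
  have h3 := exp_mul_exp_neg (Complex.I * φ)
  rw [Delta, DeltaStar]
  linear_combination radius K φ ^ 2 * h3 + h - radius K φ * h2

theorem DeltaStar_ne_zero {K : ℂ} {φ : ℝ} (h : Delta K φ ≠ 0) : DeltaStar K φ ≠ 0 :=
  mul_ne_zero (Complex.exp_ne_zero _) (right_ne_zero_of_mul h)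

theorem Delta_div_DeltaStar {K : ℂ} {φ : ℝ} (h : Delta K φ ≠ 0) :
    Delta K φ / DeltaStar K φ = Complex.exp (2 * Complex.I * φ) := by
  rw [div_eq_iff (DeltaStar_ne_zero h), Delta, DeltaStar, ← mul_assoc, ← Complex.exp_add]
  ring_nf

/-- For `K = -1` the principal root is `i sin φ`, so the radius is `e^{iφ}` and `Δ = e^{2iφ}`. -/
theorem Delta_ne_one_of_sin_pos {φ : ℝ} (h : 0 < Real.sin φ) : Delta (-1) φ ≠ 1 := by
  have h1 : radius (-1) φ = Complex.exp (Complex.I * φ) := by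
    have e1 : ((Real.cos φ : ℂ) ^ 2 + -1) = ((-(Real.sin φ) ^ 2 : ℝ) : ℂ) := by
      rw [← Complex.ofReal_pow, Real.cos_sq']
      push_cast
      ring
    have e2 : (((-(-(Real.sin φ) ^ 2) : ℝ) : ℂ)) ^ (1 / 2 : ℂ) = (Real.sin φ : ℂ) := by
      rw [neg_neg, one_div]
      have := Complex.ofReal_cpow (sq_nonneg (Real.sin φ)) (2⁻¹ : ℝ)
      push_cast at this
      push_cast
      rw [← this, ← one_div, ← Real.sqrt_eq_rpow, Real.sqrt_sq h.le]
      push_cast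
      rfl
    rw [radius, e1, Complex.ofReal_cpow_of_nonpos (by nlinarith [sq_nonneg (Real.sin φ)]),
      ← Complex.ofReal_neg, e2, mul_one_div, mul_comm Complex.I, Complex.exp_mul_I,
      show (Real.pi : ℂ) * Complex.I / 2 = Real.pi / 2 * Complex.I by ring,
      Complex.exp_pi_div_two_mul_I]
    push_cast
    ring
  intro h2
  rw [Delta, h1, ← Complex.exp_add, Complex.exp_eq_one_iff] at h2
  obtain ⟨n, hn⟩ := h2
  have h3 : (φ : ℂ) = n * Real.pi := by
    have : (2 * Complex.I) * φ = (2 * Complex.I) * (n * Real.pi) := by linear_combination hn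
    exact mul_left_cancel₀ (by simp) this
  have h4 : φ = n * Real.pi := by exact_mod_cast h3
  rw [h4, Real.sin_int_mul_pi] at h
  exact lt_irrefl _ h

theorem spectralData {M n : ℕ} (hn : 0 < n) (hM : n + 1 = M) {K : ℂ} {φ : Fin n → ℝ}
    (hφ_inj : Function.Injective φ)
    (hφ_mem : ∀ k, ∃ j : ℕ, 1 ≤ j ∧ j ≤ n ∧ φ k = j * Real.pi / M)
    (hadm : Admissible K φ) :
    SpectralData M K (fun k => Delta K (φ k)) fun k => DeltaStar K (φ k) := by
  have hM0 : (0 : ℝ) < M := by rw [← hM]; positivity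
  have hpos : ∀ k, 0 < φ k := by
    intro k
    obtain ⟨j, h1, h2, h3⟩ := hφ_mem k
    rw [h3]
    have : (1 : ℝ) ≤ j := by exact_mod_cast h1
    positivity
  have hlt : ∀ k, φ k < Real.pi := by
    intro k
    obtain ⟨j, h1, h2, h3⟩ := hφ_mem k
    rw [h3, div_lt_iff₀ hM0, mul_comm]
    have : (j : ℝ) < M := by exact_mod_cast (by omega : j < M)
    exact mul_lt_mul_of_pos_left this Real.pi_pos
  have hp : ∀ k, Delta K (φ k) ≠ 0 := fun k => (hadm.1 k).1
  have hq : ∀ k, DeltaStar K (φ k) ≠ 0 := fun k => DeltaStar_ne_zero (hp k)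
  have hq1 : ∀ k, DeltaStar K (φ k) ≠ 1 := fun k h => (hadm.1 k).2 (by rw [h, sub_self])
  have hratio : ∀ j k, Delta K (φ j) / DeltaStar K (φ j) = Delta K (φ k) / DeltaStar K (φ k) →
      j = k := by
    intro j k h
    rw [Delta_div_DeltaStar (hp j), Delta_div_DeltaStar (hp k), Complex.exp_eq_exp_iff_exists_int] at h
    obtain ⟨m, hm⟩ := h
    have h3 : (φ j : ℂ) = φ k + m * Real.pi := by
      have : (2 * Complex.I) * φ j = (2 * Complex.I) * (φ k + m * Real.pi) := by
        linear_combination hm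
      exact mul_left_cancel₀ (by simp) this
    have h4 : φ j = φ k + m * Real.pi := by exact_mod_cast h3
    have b1 := hpos j
    have b2 := hpos k
    have b3 := hlt j
    have b4 := hlt k
    have hm1 : (m : ℝ) < 1 := by
      by_contra! hc
      nlinarith [Real.pi_pos]
    have hm2 : (-1 : ℝ) < m := by
      by_contra! hc
      nlinarith [Real.pi_pos]
    have hm0 : m = 0 := by
      have h5 : m < 1 := by exact_mod_cast hm1
      have h6 : -1 < m := by exact_mod_cast hm2
      omega
    rw [hm0] at h4
    exact hφ_inj (by simpa using h4)
  refine ⟨?_, ?_, fun k => Delta_mul_DeltaStar K (φ k), hp, hq, hq1, ?_, ?_, ?_⟩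
  -- `K = 0` is excluded: the `φ k` exhaust the list, so one equals `nπ/M`. There `cos φ ≤ 0`, the
  -- principal root is `-cos φ` and `Δ` vanishes.
  · rintro rfl
    choose g hg1 hg2 hg3 using hφ_mem
    have hginj : Function.Injective fun k => (⟨g k - 1, by have := hg1 k; have := hg2 k; omega⟩ : Fin n) := by
      intro j k hjk
      have h1 : g j - 1 = g k - 1 := congrArg Fin.val hjk
      have h2 : g j = g k := by have := hg1 j; have := hg1 k; omega
      exact hφ_inj (by rw [hg3, hg3, h2])
    obtain ⟨k, hk⟩ := (Finite.injective_iff_surjective.1 hginj) ⟨n - 1, by omega⟩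
    have hgk : g k = n := by
      have h1 : g k - 1 = n - 1 := congrArg Fin.val hk
      have := hg1 k
      omega
    have hcos : Real.cos (φ k) ≤ 0 := by
      refine Real.cos_nonpos_of_pi_div_two_le_of_le ?_ (by linarith [hlt k, Real.pi_pos])
      rw [hg3, hgk, le_div_iff₀ hM0]
      have h1 : (M : ℝ) ≤ 2 * n := by exact_mod_cast (by omega : M ≤ 2 * n)
      nlinarith [Real.pi_pos]
    have hr : radius 0 (φ k) = 0 := by
      have e1 : ((Real.cos (φ k) : ℂ) ^ 2 + 0) ^ (1 / 2 : ℂ) = -(Real.cos (φ k) : ℂ) := by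
        have := Complex.ofReal_cpow (sq_nonneg (Real.cos (φ k))) (2⁻¹ : ℝ)
        push_cast at this
        rw [add_zero, one_div]
        push_cast
        rw [← this, ← one_div, ← Real.sqrt_eq_rpow, Real.sqrt_sq_eq_abs, abs_of_nonpos hcos]
        push_cast
        rfl
      rw [radius, e1, neg_add_cancel]
    exact hp k (by rw [Delta, hr, mul_zero])
  -- For `K = -1` the relation reads `(Δ - 1)(Δ* - 1) = 0`, and both factors are nonzero.
  · intro h
    have hK : K = -1 := by linear_combination h
    subst hK
    let k : Fin n := ⟨0, hn⟩
    have h1 := Delta_mul_DeltaStar (-1) (φ k)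
    have h2 : (Delta (-1) (φ k) - 1) * (DeltaStar (-1) (φ k) - 1) = 0 := by linear_combination h1
    rcases mul_eq_zero.1 h2 with h3 | h3
    · exact Delta_ne_one_of_sin_pos (Real.sin_pos_of_pos_of_lt_pi (hpos k) (hlt k))
        (sub_eq_zero.1 h3)
    · exact hq1 k (sub_eq_zero.1 h3)
  · intro j k
    rcases eq_or_ne j k with rfl | hjk
    · intro h
      have h1 := Delta_div_DeltaStar (hp j)
      rw [h, div_self (hq j), eq_comm, Complex.exp_eq_one_iff] at h1
      obtain ⟨m, hm⟩ := h1
      have h3 : (φ j : ℂ) = m * Real.pi := by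
        have : (2 * Complex.I) * φ j = (2 * Complex.I) * (m * Real.pi) := by
          linear_combination hm
        exact mul_left_cancel₀ (by simp) this
      have h4 : φ j = m * Real.pi := by exact_mod_cast h3
      have h5 := Real.sin_pos_of_pos_of_lt_pi (hpos j) (hlt j)
      rw [h4, Real.sin_int_mul_pi] at h5
      exact lt_irrefl _ h5
    · exact sub_ne_zero.1 (hadm.2 j k hjk)
  -- Since `p ≠ 1`, equal `p` force equal `q` and hence equal phases `e^{2iφ}`, which determine `φ`
  -- in `(0, π)`.
  · intro j k h
    simp only at h
    refine hratio j k ?_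
    have h1 := Delta_mul_DeltaStar K (φ j)
    have h2 := Delta_mul_DeltaStar K (φ k)
    rw [h] at h1 ⊢
    have h3 : Delta K (φ k) - 1 ≠ 0 := by
      intro h4
      have h5 := Delta_mul_DeltaStar K (φ k)
      have h6 : Delta K (φ k) = 1 := by linear_combination h4
      have h7 : 1 + K = 0 := by rw [h6] at h5; linear_combination -h5
      have hK : K = -1 := by linear_combination h7
      subst hK
      exact Delta_ne_one_of_sin_pos (Real.sin_pos_of_pos_of_lt_pi (hpos k) (hlt k)) h6
    congr 1
    exact mul_left_cancel₀ h3 (by linear_combination h1 - h2)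
  · intro k
    obtain ⟨j, h1, h2, h3⟩ := hφ_mem k
    have hM1 : (M : ℂ) ≠ 0 := by exact_mod_cast hM0.ne'
    rw [Delta_div_DeltaStar (hp k), ← Complex.exp_nat_mul, Complex.exp_eq_one_iff]
    refine ⟨j, ?_⟩
    rw [h3]
    push_cast
    field_simp

/-! ### The tau-functions of the chain -/

theorem tau_eq_sol (K : ℂ) (m : ℤ) : ∀ (n : ℕ) (f : Fin n → ℂ) (φ : Fin n → ℝ),
    tau K m n f φ = sol n (fun k => Delta K (φ k)) (fun k => DeltaStar K (φ k))
      fun k => f k * Complex.exp (2 * Complex.I * m * φ k)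
  | 0, _, _ => rfl
  | n + 1, f, φ => by
    rw [tau, sol, tau_eq_sol K m n, tau_eq_sol K m n]
    simp only [phaseShift, mul_assoc]

/-- The tau-function at a site of the periodic chain. -/
noncomputable def tauAt {M n : ℕ} (p q : Fin n → ℂ) (m : ZMod M) (f : Fin n → ℂ) : ℂ :=
  sol n p q fun k => f k * (p k / q k) ^ m.val

theorem tau_eq_tauAt {M n : ℕ} {K : ℂ} {φ : Fin n → ℝ}
    (h : SpectralData M K (fun k => Delta K (φ k)) fun k => DeltaStar K (φ k)) (m : ZMod M)
    (f : Fin n → ℂ) : tau K (m.val : ℤ) n f φ =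
      tauAt (fun k => Delta K (φ k)) (fun k => DeltaStar K (φ k)) m f := by
  rw [tau_eq_sol, tauAt]
  congr 1
  funext k
  rw [Delta_div_DeltaStar (h.p_ne k), ← Complex.exp_nat_mul]
  push_cast
  ring_nf

section
variable {M n : ℕ} {K : ℂ} {p q : Fin n → ℂ} (h : SpectralData M K p q)
include h

theorem SpectralData.p_ne_one (k : Fin n) : p k ≠ 1 := fun h1 => h.one_add_K_ne (by
  have := h.rel k
  rw [h1] at this
  linear_combination -this)

theorem SpectralData.p_add (k : Fin n) : p k + K = q k * (p k - 1) := by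
  linear_combination -h.rel k

theorem SpectralData.q_add (k : Fin n) : q k + K = p k * (q k - 1) := by
  linear_combination -h.rel k

theorem SpectralData.p_add_ne (k : Fin n) : p k + K ≠ 0 := by
  rw [h.p_add]
  exact mul_ne_zero (h.q_ne k) (sub_ne_zero.2 (h.p_ne_one k))

theorem SpectralData.q_add_ne (k : Fin n) : q k + K ≠ 0 := by
  rw [h.q_add]
  exact mul_ne_zero (h.p_ne k) (sub_ne_zero.2 (h.q_ne_one k))

theorem SpectralData.shift_neg_ne (k : Fin n) : shift p q (-K) k ≠ 0 := by
  rw [shift, sub_neg_eq_add, sub_neg_eq_add]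
  exact div_ne_zero (h.p_add_ne k) (h.q_add_ne k)

/-- On the spectral curve `p + K = q (p - 1)` and `q + K = p (q - 1)`. This dependence brings all
three bilinear equations under Hirota–Miwa. -/
theorem SpectralData.shift_one (k : Fin n) :
    shift p q 1 k = shift p q 0 k * shift p q (-K) k := by
  have h1 := h.p_ne k
  have h2 := h.q_ne k
  have h3 := sub_ne_zero.2 (h.q_ne_one k)
  rw [shift, shift, shift, sub_neg_eq_add, sub_neg_eq_add, h.p_add, h.q_add]
  field_simp
  ring

/-- The shift at `0` is translation by one site; `per` absorbs the reduction of `val` modulo `M`. -/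
theorem SpectralData.phase_succ [NeZero M] (m : ZMod M) (k : Fin n) :
    (p k / q k) ^ (m + 1).val = (p k / q k) ^ m.val * shift p q 0 k := by
  rw [shift, sub_zero, sub_zero, ZMod.val_add, ← pow_eq_pow_mod _ (h.per k), pow_add,
    ZMod.val_one_eq_one_mod, ← pow_eq_pow_mod _ (h.per k), pow_one]

end

/-- The amplitudes after a Bäcklund transformation. -/
noncomputable def bt {n : ℕ} (K : ℂ) (p q : Fin n → ℂ) (ξ : ℂ) (f : Fin n → ℂ) (k : Fin n) : ℂ :=
  f k * (shift p q ξ k / shift p q (-K) k)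

theorem SpectralData.bt_self {M n : ℕ} {K : ℂ} {p q : Fin n → ℂ} (h : SpectralData M K p q)
    (f : Fin n → ℂ) : bt K p q (-K) f = f := by
  funext k
  rw [bt, div_self (h.shift_neg_ne k), mul_one]

section
variable {M n : ℕ} [NeZero M] {K : ℂ} {p q : Fin n → ℂ} (h : SpectralData M K p q)
include h

/-- Hirota–Miwa with parameters `0`, `1`, `ξ`, based at the amplitudes `f / shift p q (-K)` at site
`m - 1`; `h0` is the nonvanishing it needs there. -/
theorem SpectralData.bilinear_one {f : Fin n → ℂ} {ξ : ℂ} (hξ : ∀ k, q k ≠ ξ) (m : ZMod M)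
    (h0 : tauAt p q (m - 1) (fun k => f k / shift p q (-K) k) ≠ 0) :
    tauAt p q (m - 1) (bt K p q ξ f) * tauAt p q (m + 1) f -
        ξ * (tauAt p q m f * tauAt p q m (bt K p q ξ f)) =
      (1 - ξ) * (tauAt p q m (fun k => shift p q (-K) k * bt K p q ξ f k) *
        tauAt p q m fun k => f k / shift p q (-K) k) := by
  obtain ⟨l, rfl⟩ : ∃ l, m = l + 1 := ⟨m - 1, by ring⟩
  rw [add_sub_cancel_right] at h0 ⊢
  have key := hirota_miwa (fun k => f k / shift p q (-K) k * (p k / q k) ^ l.val) h.p_ne_q h0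
    (a := 0) (b := 1) (c := ξ) h.q_ne h.q_ne_one hξ
  have hc := h.shift_neg_ne
  simp only [tauAt, bt, h.phase_succ, h.shift_one] at key ⊢
  have e1 : (fun k => f k / shift p q (-K) k * (p k / q k) ^ l.val * shift p q 0 k *
      (shift p q 0 k * shift p q (-K) k)) =
      fun k => f k * ((p k / q k) ^ l.val * shift p q 0 k * shift p q 0 k) := by
    funext k; have := hc k; field_simp
  have e2 : (fun k => f k / shift p q (-K) k * (p k / q k) ^ l.val * shift p q ξ k) =
      fun k => f k * (shift p q ξ k / shift p q (-K) k) * (p k / q k) ^ l.val := by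
    funext k; have := hc k; field_simp
  have e3 : (fun k => f k / shift p q (-K) k * (p k / q k) ^ l.val *
      (shift p q 0 k * shift p q (-K) k) * shift p q ξ k) =
      fun k => shift p q (-K) k * (f k * (shift p q ξ k / shift p q (-K) k)) *
        ((p k / q k) ^ l.val * shift p q 0 k) := by
    funext k; have := hc k; field_simp
  have e4 : (fun k => f k / shift p q (-K) k * (p k / q k) ^ l.val * shift p q 0 k) =
      fun k => f k / shift p q (-K) k * ((p k / q k) ^ l.val * shift p q 0 k) := by
    funext k; ring
  have e5 : (fun k => f k / shift p q (-K) k * (p k / q k) ^ l.val * shift p q ξ k *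
      shift p q 0 k) = fun k => f k * (shift p q ξ k / shift p q (-K) k) *
        ((p k / q k) ^ l.val * shift p q 0 k) := by
    funext k; have := hc k; field_simp
  have e6 : (fun k => f k / shift p q (-K) k * (p k / q k) ^ l.val *
      (shift p q 0 k * shift p q (-K) k)) =
      fun k => f k * ((p k / q k) ^ l.val * shift p q 0 k) := by
    funext k; have := hc k; field_simp
  rw [e1, e2, e3, e4, e5, e6] at key
  linear_combination -key

/-- Hirota–Miwa with parameters `ξ`, `0`, `-K` and the same base point. -/
theorem SpectralData.bilinear_two {f : Fin n → ℂ} {ξ : ℂ} (hξ : ∀ k, q k ≠ ξ) (m : ZMod M)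
    (h0 : tauAt p q (m - 1) (fun k => f k / shift p q (-K) k) ≠ 0) :
    K * (tauAt p q (m - 1) (bt K p q ξ f) * tauAt p q m f) +
        ξ * (tauAt p q (m - 1) f * tauAt p q m (bt K p q ξ f)) =
      (K + ξ) * (tauAt p q (m - 1) (fun k => shift p q (-K) k * bt K p q ξ f k) *
        tauAt p q m fun k => f k / shift p q (-K) k) := by
  obtain ⟨l, rfl⟩ : ∃ l, m = l + 1 := ⟨m - 1, by ring⟩
  rw [add_sub_cancel_right] at h0 ⊢
  have key := hirota_miwa (fun k => f k / shift p q (-K) k * (p k / q k) ^ l.val) h.p_ne_q h0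
    (a := ξ) (b := 0) (c := -K) hξ h.q_ne
    (fun k hk => h.q_add_ne k (by rw [hk, neg_add_cancel]))
  have hc := h.shift_neg_ne
  simp only [tauAt, bt, h.phase_succ] at key ⊢
  have e1 : (fun k => f k / shift p q (-K) k * (p k / q k) ^ l.val * shift p q ξ k *
      shift p q 0 k) = fun k => f k * (shift p q ξ k / shift p q (-K) k) *
        ((p k / q k) ^ l.val * shift p q 0 k) := by
    funext k; have := hc k; field_simp
  have e2 : (fun k => f k / shift p q (-K) k * (p k / q k) ^ l.val * shift p q (-K) k) =
      fun k => f k * (p k / q k) ^ l.val := by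
    funext k; have := hc k; field_simp
  have e3 : (fun k => f k / shift p q (-K) k * (p k / q k) ^ l.val * shift p q 0 k *
      shift p q (-K) k) = fun k => f k * ((p k / q k) ^ l.val * shift p q 0 k) := by
    funext k; have := hc k; field_simp
  have e4 : (fun k => f k / shift p q (-K) k * (p k / q k) ^ l.val * shift p q ξ k) =
      fun k => f k * (shift p q ξ k / shift p q (-K) k) * (p k / q k) ^ l.val := by
    funext k; have := hc k; field_simp
  have e5 : (fun k => f k / shift p q (-K) k * (p k / q k) ^ l.val * shift p q (-K) k *
      shift p q ξ k) = fun k => shift p q (-K) k * (f k * (shift p q ξ k / shift p q (-K) k)) *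
        (p k / q k) ^ l.val := by
    funext k; have := hc k; field_simp
  have e6 : (fun k => f k / shift p q (-K) k * (p k / q k) ^ l.val * shift p q 0 k) =
      fun k => f k / shift p q (-K) k * ((p k / q k) ^ l.val * shift p q 0 k) := by
    funext k; ring
  rw [e1, e2, e3, e4, e5, e6] at key
  linear_combination key

theorem SpectralData.bilinear_zero {f : Fin n → ℂ} (m : ZMod M)
    (h0 : tauAt p q (m - 1) (fun k => f k / shift p q (-K) k) ≠ 0) :
    tauAt p q (m - 1) f * tauAt p q (m + 1) f + K * (tauAt p q m f * tauAt p q m f) =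
      (1 + K) * (tauAt p q m (fun k => shift p q (-K) k * f k) *
        tauAt p q m fun k => f k / shift p q (-K) k) := by
  have := h.bilinear_one (ξ := -K) (fun k hk => h.q_add_ne k (by rw [hk, neg_add_cancel])) m h0
  rw [h.bt_self] at this
  linear_combination this

end

theorem cFun_eq_shift {M n : ℕ} {K : ℂ} {φ : Fin n → ℝ}
    (h : SpectralData M K (fun k => Delta K (φ k)) fun k => DeltaStar K (φ k)) (k : Fin n) :
    cFun K (φ k) = shift (fun k => Delta K (φ k)) (fun k => DeltaStar K (φ k)) (-K) k := by
  have h1 := h.p_ne k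
  have h2 : 1 - DeltaStar K (φ k) ≠ 0 := sub_ne_zero.2 (h.q_ne_one k).symm
  have h3 : DeltaStar K (φ k) - 1 ≠ 0 := sub_ne_zero.2 (h.q_ne_one k)
  have h4 := h.p_add k
  have h5 := h.q_add k
  rw [shift, sub_neg_eq_add, sub_neg_eq_add, h4, h5, cFun, div_mul_div_comm,
    div_eq_div_iff (mul_ne_zero h1 h2) (mul_ne_zero h1 h3)]
  ring

end

section
open Filter Topology

/-! ### Continuous branches of roots -/

/-- Only the limit matters, not continuity elsewhere: for `a = 0` any root works, otherwise the
principal power of `g / a ^ N` near `1`. -/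
theorem exists_tendsto_root {Y : Type*} {l : Filter Y} {N : ℕ} [NeZero N] {g : Y → ℂ} {a : ℂ}
    (hg : Tendsto g l (𝓝 (a ^ N))) : ∃ r : Y → ℂ, (∀ y, r y ^ N = g y) ∧ Tendsto r l (𝓝 a) := by
  have hN := NeZero.ne N
  rcases eq_or_ne a 0 with rfl | ha
  · choose r hr using fun y => IsAlgClosed.exists_pow_nat_eq (g y) (Nat.pos_of_ne_zero hN)
    refine ⟨r, hr, ?_⟩
    rw [zero_pow hN] at hg
    rw [tendsto_zero_iff_norm_tendsto_zero] at hg ⊢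
    have h1 : (fun y => ‖r y‖) = fun y => ‖g y‖ ^ ((N : ℝ)⁻¹) := by
      funext y
      rw [← hr, norm_pow, Real.pow_rpow_inv_natCast (norm_nonneg _) hN]
    have hN' : (0 : ℝ) < (N : ℝ)⁻¹ := inv_pos.2 (Nat.cast_pos.2 (Nat.pos_of_ne_zero hN))
    rw [h1]
    simpa [Real.zero_rpow hN'.ne'] using hg.rpow_const (Or.inr hN'.le)
  · have ha' := pow_ne_zero N ha
    refine ⟨fun y => a * (g y / a ^ N) ^ ((N : ℂ)⁻¹), fun y => ?_, ?_⟩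
    · rw [mul_pow, Complex.cpow_nat_inv_pow _ hN, mul_div_cancel₀ _ ha']
    · have h1 : Tendsto (fun y => g y / a ^ N) l (𝓝 1) := by
        simpa [div_self ha'] using hg.div_const (a ^ N)
      have h2 := (continuousAt_cpow_const (b := (N : ℂ)⁻¹) Complex.one_mem_slitPlane).tendsto.comp h1
      simpa using h2.const_mul a

/-! ### Tau-functions as polynomials in the amplitudes -/

theorem sol_zero : ∀ (n : ℕ) (p q : Fin n → ℂ), sol n p q 0 = 1
  | 0, _, _ => rfl
  | n + 1, p, q => by
    rw [sol, Pi.zero_apply, zero_mul, add_zero]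
    exact sol_zero n _ _

theorem exists_eval_eq_sol : ∀ (n : ℕ) (p q : Fin n → ℂ),
    ∃ P : MvPolynomial (Fin n) ℂ, ∀ f, MvPolynomial.eval f P = sol n p q f
  | 0, _, _ => ⟨1, fun f => by simp [sol]⟩
  | n + 1, p, q => by
    obtain ⟨P, hP⟩ := exists_eval_eq_sol n (fun k => p k.castSucc) (fun k => q k.castSucc)
    refine ⟨MvPolynomial.rename Fin.castSucc P + MvPolynomial.X (Fin.last n) *
      MvPolynomial.bind₁ (fun k => MvPolynomial.C
        (((p k.castSucc - p (Fin.last n)) * (q k.castSucc - q (Fin.last n))) /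
          ((p k.castSucc - q (Fin.last n)) * (q k.castSucc - p (Fin.last n)))) *
        MvPolynomial.X k.castSucc) P, fun f => ?_⟩
    rw [sol, map_add, map_mul, MvPolynomial.eval_X, MvPolynomial.eval_rename, ← hP, ← hP]
    congr 2
    simp only [MvPolynomial.eval, MvPolynomial.eval₂Hom_bind₁]
    simp

section
variable {M n : ℕ} {p q : Fin n → ℂ}

theorem exists_eval_eq_tauAt (p q c : Fin n → ℂ) (m : ZMod M) :
    ∃ P : MvPolynomial (Fin n) ℂ, P ≠ 0 ∧
      ∀ f, MvPolynomial.eval f P = tauAt p q m fun k => c k * f k := by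
  obtain ⟨P, hP⟩ := exists_eval_eq_sol n p q
  have key : ∀ f, MvPolynomial.eval f (MvPolynomial.bind₁ (fun k => MvPolynomial.C
      (c k * (p k / q k) ^ m.val) * MvPolynomial.X k) P) = tauAt p q m fun k => c k * f k := by
    intro f
    rw [tauAt, ← hP]
    simp only [MvPolynomial.eval, MvPolynomial.eval₂Hom_bind₁]
    congr 2
    funext k
    simp
    ring
  -- The polynomial is nonzero because it takes the value `1` at zero amplitudes.
  refine ⟨_, fun h0 => ?_, key⟩
  have h1 := key 0
  rw [h0, map_zero, tauAt] at h1
  simp only [Pi.zero_apply, mul_zero, zero_mul] at h1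
  exact zero_ne_one (h1.trans (sol_zero n p q))

theorem continuous_tauAt (c : Fin n → ℂ) (m : ZMod M) :
    Continuous fun f : Fin n → ℂ => tauAt p q m fun k => c k * f k := by
  obtain ⟨P, -, hP⟩ := exists_eval_eq_tauAt p q c m
  simpa only [hP] using MvPolynomial.continuous_eval P

end

/-- The amplitudes in general position. -/
structure Generic (M : ℕ) (K : ℂ) {n : ℕ} (p q f : Fin n → ℂ) : Prop where
  amp_ne : ∀ k, f k ≠ 0
  tau_ne : ∀ m : ZMod M, tauAt p q m f ≠ 0
  theta_ne : ∀ m : ZMod M, tauAt p q m (fun k => shift p q (-K) k * f k) ≠ 0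
  dual_ne : ∀ m : ZMod M, tauAt p q m (fun k => f k / shift p q (-K) k) ≠ 0

section
variable {M n : ℕ} [NeZero M] {K : ℂ} {p q : Fin n → ℂ}

theorem exists_generic_iff (M : ℕ) [NeZero M] (K : ℂ) (p q : Fin n → ℂ) :
    ∃ P : MvPolynomial (Fin n) ℂ, P ≠ 0 ∧
      ∀ f, MvPolynomial.eval f P ≠ 0 ↔ Generic M K p q f := by
  choose A hA0 hA using exists_eval_eq_tauAt (M := M) p q 1
  choose B hB0 hB using exists_eval_eq_tauAt (M := M) p q (shift p q (-K))
  choose C hC0 hC using exists_eval_eq_tauAt (M := M) p q (fun k => (shift p q (-K) k)⁻¹)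
  refine ⟨(∏ k, MvPolynomial.X k) * ∏ m, A m * B m * C m, ?_, fun f => ?_⟩
  · refine mul_ne_zero (Finset.prod_ne_zero_iff.2 fun k _ => MvPolynomial.X_ne_zero k)
      (Finset.prod_ne_zero_iff.2 fun m _ => mul_ne_zero (mul_ne_zero (hA0 m) (hB0 m)) (hC0 m))
  · simp only [map_mul, map_prod, MvPolynomial.eval_X, hA, hB, hC, mul_ne_zero_iff,
      Finset.prod_ne_zero_iff, Finset.mem_univ, true_implies, Pi.one_apply, one_mul,
      inv_mul_eq_div]
    exact ⟨fun h => ⟨h.1, fun m => (h.2 m).1.1, fun m => (h.2 m).1.2, fun m => (h.2 m).2⟩,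
      fun h => ⟨h.1, fun m => ⟨⟨h.2 m, h.3 m⟩, h.4 m⟩⟩⟩

theorem isOpen_generic : IsOpen {f | Generic M K p q f} := by
  obtain ⟨P, -, hP⟩ := exists_generic_iff M K p q
  simp only [← hP]
  exact isOpen_ne_fun (MvPolynomial.continuous_eval P) continuous_const

end

/-! ### Linked amplitudes -/

/-- `τ` and `θ` are `N`-th roots of the tau-functions with the amplitudes `f`. -/
structure IsRoots (N : ℕ) {M : ℕ} (K : ℂ) {n : ℕ} (p q f : Fin n → ℂ) (τ θ : ZMod M → ℂ) :
    Prop where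
  tau_pow : ∀ m, τ m ^ N = tauAt p q m f
  theta_pow : ∀ m, θ m ^ N = tauAt p q m fun k => shift p q (-K) k * f k

/-- All chains with the amplitudes `f` and `f'` are similar. -/
def Linked (N M : ℕ) [NeZero N] [NeZero M] (kap : ℂ) {n : ℕ} (p q f f' : Fin n → ℂ) : Prop :=
  ∀ τ θ τ' θ' : ZMod M → ℂ, IsRoots N (kap ^ N) p q f τ θ → IsRoots N (kap ^ N) p q f' τ' θ' →
    Similar N M kap (uOf N τ) (wOf θ) (uOf N τ') (wOf θ')

section
variable {N M n : ℕ} [NeZero N] [NeZero M] {kap K : ℂ} {p q f f' f'' : Fin n → ℂ}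

theorem exists_isRoots (N M : ℕ) [NeZero N] (K : ℂ) (p q f : Fin n → ℂ) :
    ∃ τ θ : ZMod M → ℂ, IsRoots N K p q f τ θ := by
  have hN := Nat.pos_of_ne_zero (NeZero.ne N)
  choose τ hτ using fun m : ZMod M => IsAlgClosed.exists_pow_nat_eq (tauAt p q m f) hN
  choose θ hθ using fun m : ZMod M =>
    IsAlgClosed.exists_pow_nat_eq (tauAt p q m fun k => shift p q (-K) k * f k) hN
  exact ⟨τ, θ, hτ, hθ⟩

theorem ne_zero_of_pow_eq {x y : ℂ} (h : x ^ N = y) (hy : y ≠ 0) : x ≠ 0 := by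
  rintro rfl
  exact hy (by rw [← h, zero_pow (NeZero.ne N)])

theorem Linked.symm (h : Linked N M kap p q f f') : Linked N M kap p q f' f :=
  fun τ θ τ' θ' h1 h2 => (h τ' θ' τ θ h2 h1).symm

theorem Linked.trans (h : Linked N M kap p q f f') (h' : Linked N M kap p q f' f'') :
    Linked N M kap p q f f'' := by
  intro τ θ τ'' θ'' h1 h2
  obtain ⟨τ', θ', h3⟩ := exists_isRoots N M (kap ^ N) p q f'
  exact (h τ θ τ' θ' h1 h3).trans (h' τ' θ' τ'' θ'' h3 h2)

theorem Generic.linked (hf : Generic M (kap ^ N) p q f) : Linked N M kap p q f f := by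
  intro τ θ τ' θ' h1 h2
  have e1 : ∀ m, τ m ≠ 0 := fun m => ne_zero_of_pow_eq (h1.tau_pow m) (hf.tau_ne m)
  have e2 : ∀ m, θ m ≠ 0 := fun m => ne_zero_of_pow_eq (h1.theta_pow m) (hf.theta_ne m)
  refine similar_of_pow_eq (uOf_ne_zero e1) (wOf_ne_zero e2) (fun m => ?_) fun m => ?_
  · simp only [uOf_pow, h1.tau_pow, h2.tau_pow]
  · simp only [wOf_pow, h1.theta_pow, h2.theta_pow]

theorem Generic.linked_of_similar (hf : Generic M (kap ^ N) p q f)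
    (hf' : Generic M (kap ^ N) p q f') {τ θ τ' θ' : ZMod M → ℂ}
    (h : IsRoots N (kap ^ N) p q f τ θ) (h' : IsRoots N (kap ^ N) p q f' τ' θ')
    (hs : Similar N M kap (uOf N τ) (wOf θ) (uOf N τ') (wOf θ')) : Linked N M kap p q f f' :=
  fun σ ϑ σ' ϑ' h1 h1' => ((hf.linked σ ϑ τ θ h1 h).trans hs).trans (hf'.linked τ' θ' σ' ϑ' h' h1')

end

end

/-! ### Bäcklund transformations near the identity -/

section
open Filter Topology

theorem tendsto_uOf {N M : ℕ} {Y : Type*} {l : Filter Y} {τ : Y → ZMod M → ℂ} {τ₀ : ZMod M → ℂ}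
    (h0 : ∀ m, τ₀ m ≠ 0) (h : ∀ m, Tendsto (fun y => τ y m) l (𝓝 (τ₀ m))) (m : ZMod M) :
    Tendsto (fun y => uOf N (τ y) m) l (𝓝 (uOf N τ₀ m)) :=
  ((h _).div (h m) (h0 m)).const_mul _

theorem tendsto_wOf {M : ℕ} {Y : Type*} {l : Filter Y} {θ : Y → ZMod M → ℂ} {θ₀ : ZMod M → ℂ}
    (h0 : ∀ m, θ₀ m ≠ 0) (h : ∀ m, Tendsto (fun y => θ y m) l (𝓝 (θ₀ m))) (m : ZMod M) :
    Tendsto (fun y => wOf (θ y) m) l (𝓝 (wOf θ₀ m)) :=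
  ((h m).div (h _) (h0 _)).neg

/-- Roots of the tau-functions can be continued along with the amplitudes. -/
theorem exists_tendsto_isRoots {N M n : ℕ} [NeZero N] {K : ℂ} {p q f : Fin n → ℂ} {Y : Type*}
    {l : Filter Y} {g : Y → Fin n → ℂ} {τ θ : ZMod M → ℂ}
    (h : IsRoots N K p q f τ θ) (hg : Tendsto g l (𝓝 f)) :
    ∃ τ' θ' : Y → ZMod M → ℂ, (∀ y, IsRoots N K p q (g y) (τ' y) (θ' y)) ∧
      (∀ m, Tendsto (fun y => τ' y m) l (𝓝 (τ m))) ∧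
      ∀ m, Tendsto (fun y => θ' y m) l (𝓝 (θ m)) := by
  have h1 : ∀ m, Tendsto (fun y => tauAt p q m (g y)) l (𝓝 (τ m ^ N)) := fun m => by
    have := ((continuous_tauAt (p := p) (q := q) 1 m).tendsto f).comp hg
    simpa [h.tau_pow, Function.comp_def] using this
  have h2 : ∀ m, Tendsto (fun y => tauAt p q m fun k => shift p q (-K) k * g y k) l
      (𝓝 (θ m ^ N)) := fun m => by
    rw [h.theta_pow]
    exact ((continuous_tauAt (p := p) (q := q) (shift p q (-K)) m).tendsto f).comp hg
  choose t ht ht' using fun m => exists_tendsto_root (h1 m)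
  choose s hs hs' using fun m => exists_tendsto_root (h2 m)
  exact ⟨fun y m => t m y, fun y m => s m y,
    fun y => ⟨fun m => ht m y, fun m => hs m y⟩, ht', hs'⟩

theorem SpectralData.tendsto_bt {M n : ℕ} {K : ℂ} {p q : Fin n → ℂ} (h : SpectralData M K p q)
    (f₀ : Fin n → ℂ) :
    Tendsto (fun y : (Fin n → ℂ) × ℂ => bt K p q (-K + y.2) y.1) (𝓝 (f₀, 0)) (𝓝 f₀) := by
  have key : ContinuousAt (fun y : (Fin n → ℂ) × ℂ => bt K p q (-K + y.2) y.1) (f₀, 0) := by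
    refine continuousAt_pi.2 fun k => ?_
    simp only [bt, shift]
    have h1 : q k - (-K + ((f₀, 0) : (Fin n → ℂ) × ℂ).2) ≠ 0 := by
      simpa using h.q_add_ne k
    have h2 : (p k - -K) / (q k - -K) ≠ 0 := h.shift_neg_ne k
    fun_prop (disch := assumption)
  have e : bt K p q (-K + ((f₀, 0) : (Fin n → ℂ) × ℂ).2) ((f₀, 0) : (Fin n → ℂ) × ℂ).1 = f₀ := by
    simpa using h.bt_self f₀
  simpa only [e] using key.tendsto

section
variable {N M n : ℕ} [NeZero N] [NeZero M] {kap : ℂ} {p q f : Fin n → ℂ}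

/-- By `bilinear_zero` this is, up to nonzero factors, `1 + K` times a `Θ`-value times a dual
tau-function, whence `dual_ne` in the definition of `Generic`. -/
theorem Generic.eta_pow_ne_zero (h : SpectralData M (kap ^ N) p q) (hf : Generic M (kap ^ N) p q f)
    {τ θ : ZMod M → ℂ} (hr : IsRoots N (kap ^ N) p q f τ θ) (m : ZMod M) :
    (omegaHalf N * uOf N τ m) ^ N - (kap * uOf N τ (m + 1)) ^ N ≠ 0 := by
  have hb := h.bilinear_zero m (hf.dual_ne (m - 1))
  have h1 := hf.tau_ne m
  have h2 := hf.tau_ne (m + 1)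
  have h3 : (1 + kap ^ N) * (tauAt p q m (fun k => shift p q (-kap ^ N) k * f k) *
      tauAt p q m fun k => f k / shift p q (-kap ^ N) k) ≠ 0 :=
    mul_ne_zero h.one_add_K_ne (mul_ne_zero (hf.theta_ne m) (hf.dual_ne m))
  rw [← hb] at h3
  have hs : ((-1 : ℂ) ^ N) ≠ 0 := pow_ne_zero _ (by norm_num)
  rw [mul_pow, mul_pow, omegaHalf_pow, uOf_pow, uOf_pow, add_sub_cancel_right, hr.tau_pow,
    hr.tau_pow, hr.tau_pow]
  have e : -1 * -((-1) ^ N * (tauAt p q (m - 1) f / tauAt p q m f)) -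
      kap ^ N * -((-1) ^ N * (tauAt p q m f / tauAt p q (m + 1) f)) =
      (-1) ^ N * ((tauAt p q (m - 1) f * tauAt p q (m + 1) f +
        kap ^ N * (tauAt p q m f * tauAt p q m f)) / (tauAt p q m f * tauAt p q (m + 1) f)) := by
    field_simp
    ring
  rw [e]
  exact mul_ne_zero hs (div_ne_zero h3 (mul_ne_zero h1 h2))

/-- A Bäcklund transformation close to the identity is a similarity of the chains. -/
theorem Generic.eventually_linked_bt (h : SpectralData M (kap ^ N) p q) {f₀ : Fin n → ℂ}
    (hf : Generic M (kap ^ N) p q f₀) : ∀ᶠ y : (Fin n → ℂ) × ℂ in 𝓝 (f₀, 0),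
      Linked N M kap p q y.1 (bt (kap ^ N) p q (-kap ^ N + y.2) y.1) := by
  have hkap : kap ≠ 0 := fun h0 => h.K_ne (by rw [h0, zero_pow (NeZero.ne N)])
  obtain ⟨τ₀, θ₀, hr₀⟩ := exists_isRoots N M (kap ^ N) p q f₀
  have hτ₀ : ∀ m, τ₀ m ≠ 0 := fun m => ne_zero_of_pow_eq (hr₀.tau_pow m) (hf.tau_ne m)
  have hθ₀ : ∀ m, θ₀ m ≠ 0 := fun m => ne_zero_of_pow_eq (hr₀.theta_pow m) (hf.theta_ne m)
  have t1 : Tendsto (fun y : (Fin n → ℂ) × ℂ => y.1) (𝓝 (f₀, 0)) (𝓝 f₀) :=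
    continuous_fst.tendsto (f₀, (0 : ℂ))
  have t2 : Tendsto (fun y : (Fin n → ℂ) × ℂ => y.2) (𝓝 (f₀, 0)) (𝓝 0) :=
    continuous_snd.tendsto (f₀, (0 : ℂ))
  have t3 := h.tendsto_bt f₀
  obtain ⟨τ, θ, hr, tτ, tθ⟩ := exists_tendsto_isRoots hr₀ t1
  obtain ⟨τ', θ', hr', tτ', tθ'⟩ := exists_tendsto_isRoots hr₀ t3
  -- With `ξ = -K + y.2` the parameters `k`, `δ`, `ρ` tend to `κ`, `1`, `0`, for which the limiting
  -- intertwiner is the identity.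
  obtain ⟨k, hk, tk⟩ := exists_tendsto_root (N := N) (a := kap)
    (g := fun y : (Fin n → ℂ) × ℂ => -(-kap ^ N + y.2)) (l := 𝓝 (f₀, 0)) (by
      simpa using (t2.const_add (-kap ^ N)).neg)
  obtain ⟨δ, hδ, tδ⟩ := exists_tendsto_root (N := N) (a := 1)
    (g := fun y : (Fin n → ℂ) × ℂ => (1 - (-kap ^ N + y.2)) / (1 + kap ^ N)) (l := 𝓝 (f₀, 0)) (by
      have := ((t2.const_add (-kap ^ N)).const_sub 1).div_const (1 + kap ^ N)
      simpa [div_self h.one_add_K_ne] using this)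
  have h1ξ : Tendsto (fun y : (Fin n → ℂ) × ℂ => 1 - (-kap ^ N + y.2)) (𝓝 (f₀, 0))
      (𝓝 (1 + kap ^ N)) := by
    simpa using (t2.const_add (-kap ^ N)).const_sub 1
  obtain ⟨ρ, hρ, tρ⟩ := exists_tendsto_root (N := N) (a := 0)
    (g := fun y : (Fin n → ℂ) × ℂ => (kap ^ N + (-kap ^ N + y.2)) / (1 - (-kap ^ N + y.2)))
    (l := 𝓝 (f₀, 0)) (by
      have := ((t2.const_add (-kap ^ N)).const_add (kap ^ N)).div h1ξ h.one_add_K_ne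
      simpa [zero_pow (NeZero.ne N), Pi.div_def] using this)
  have tu : ∀ m, Tendsto (fun y => uOf N (τ y) m) (𝓝 (f₀, 0)) (𝓝 (uOf N τ₀ m)) :=
    tendsto_uOf hτ₀ tτ
  choose η₀ hη₀ using fun m => IsAlgClosed.exists_pow_nat_eq
    ((omegaHalf N * uOf N τ₀ m) ^ N - (kap * uOf N τ₀ (m + 1)) ^ N)
    (Nat.pos_of_ne_zero (NeZero.ne N))
  have hη₀' : ∀ m, η₀ m ≠ 0 := fun m => ne_zero_of_pow_eq (hη₀ m) (hf.eta_pow_ne_zero h hr₀ m)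
  choose η hη tη using fun m => exists_tendsto_root (N := N) (a := η₀ m)
    (g := fun y => (omegaHalf N * uOf N (τ y) m) ^ N - (kap * uOf N (τ y) (m + 1)) ^ N)
    (l := 𝓝 (f₀, 0)) (by
      rw [hη₀]
      exact (((tu m).const_mul _).pow N).sub (((tu (m + 1)).const_mul _).pow N))
  have td : ∀ m, Tendsto (fun y => δ y * (τ y (m - 1) * θ' y (m - 1) /
      (τ' y (m - 1) * θ y (m - 1)))) (𝓝 (f₀, 0)) (𝓝 1) := by
    intro m
    have h0 := mul_ne_zero (hτ₀ (m - 1)) (hθ₀ (m - 1))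
    have := tδ.mul (((tτ (m - 1)).mul (tθ' (m - 1))).div ((tτ' (m - 1)).mul (tθ (m - 1))) h0)
    simpa [div_self h0] using this
  have hunit := eventually_isUnit_intertwiner hkap hη₀' hη₀ (uOf_ne_zero hτ₀) (wOf_ne_zero hθ₀)
    tk (by simpa using tρ.neg) (η := fun y m => η m y) tη tu (tendsto_uOf hτ₀ tτ')
    (tendsto_wOf hθ₀ tθ') td
  have hgen : ∀ᶠ y : (Fin n → ℂ) × ℂ in 𝓝 (f₀, 0), Generic M (kap ^ N) p q y.1 :=
    t1.eventually (isOpen_generic.mem_nhds hf)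
  have hgen' := t3.eventually (isOpen_generic.mem_nhds hf)
  have hξq : ∀ᶠ y : (Fin n → ℂ) × ℂ in 𝓝 (f₀, 0), ∀ j, q j ≠ -kap ^ N + y.2 := by
    refine eventually_all.2 fun j => ?_
    filter_upwards [t2.eventually (isOpen_ne.mem_nhds (h.q_add_ne j).symm)] with y hy hq
    exact hy (by rw [hq]; ring)
  filter_upwards [hunit, hgen, hgen', hξq, h1ξ.eventually (isOpen_ne.mem_nhds h.one_add_K_ne)]
    with y y1 y2 y3 y4 y5
  -- At `ξ = -K` itself `ρ = 0` and `transfer_backlund` does not apply, but the transformation is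
  -- trivial.
  rcases eq_or_ne y.2 0 with hy | hy
  · rw [hy, add_zero, h.bt_self]
    exact y2.linked
  · refine y2.linked_of_similar y3 (hr y) (hr' y) ⟨_, y1, fun lam => ?_⟩
    refine transfer_backlund (ξ := -kap ^ N + y.2)
      (Θ := fun m => tauAt p q m fun k => y.1 k / shift p q (-kap ^ N) k)
      (fun m => ne_zero_of_pow_eq ((hr y).tau_pow m) (y2.tau_ne m))
      (fun m => ne_zero_of_pow_eq ((hr y).theta_pow m) (y2.theta_ne m))
      (fun m => ne_zero_of_pow_eq ((hr' y).tau_pow m) (y3.tau_ne m))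
      (fun m => ne_zero_of_pow_eq ((hr' y).theta_pow m) (y3.theta_ne m))
      (fun m => ne_zero_of_pow_eq (hη m y) (y2.eta_pow_ne_zero h (hr y) m)) y5 (by simpa using hy)
      h.one_add_K_ne (hk y) (hδ y) (by rw [neg_neg, hρ]) (fun m => hη m y) (fun m => ?_)
      (fun m => ?_) (fun m => ?_) lam
    · simp only [(hr y).tau_pow, (hr y).theta_pow]
      exact h.bilinear_zero m (y2.dual_ne _)
    · simp only [(hr y).tau_pow, (hr' y).tau_pow, (hr' y).theta_pow]
      exact h.bilinear_one y4 m (y2.dual_ne _)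
    · simp only [(hr y).tau_pow, (hr' y).tau_pow, (hr' y).theta_pow]
      exact h.bilinear_two y4 m (y2.dual_ne _)

end

end

section
open Filter Topology

/-! ### Factorising small rational functions -/

/-- If `‖z‖ ≥ ε`, each of the `n` lower terms is smaller than `‖z‖ ^ n / n`, so together they cannot
cancel `z ^ n`. -/
theorem norm_lt_of_small_coeff {n : ℕ} {e : Fin n → ℂ} {ε : ℝ} (hε : 0 < ε)
    (he : ∀ i, ‖e i‖ < ε ^ ((i : ℕ) + 1) / n) {z : ℂ}
    (hz : z ^ n + ∑ i : Fin n, e i * z ^ (n - 1 - i) = 0) (hn : 0 < n) : ‖z‖ < ε := by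
  by_contra! hc
  have hn' : (0 : ℝ) < n := Nat.cast_pos.2 hn
  have h1 : z ^ n = -∑ i : Fin n, e i * z ^ (n - 1 - i) := by linear_combination hz
  have hne : (Finset.univ : Finset (Fin n)).Nonempty := ⟨⟨0, hn⟩, Finset.mem_univ _⟩
  have hz0 : 0 < ‖z‖ := hε.trans_le hc
  have h2 : ‖z‖ ^ n < ∑ _i : Fin n, ‖z‖ ^ n / n := by
    conv_lhs => rw [← norm_pow, h1, norm_neg]
    refine (norm_sum_le _ _).trans_lt (Finset.sum_lt_sum_of_nonempty hne fun i _ => ?_)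
    have h3 : ε ^ ((i : ℕ) + 1) ≤ ‖z‖ ^ ((i : ℕ) + 1) := pow_le_pow_left₀ hε.le hc _
    have h4 : ‖z‖ ^ n = ‖z‖ ^ ((i : ℕ) + 1) * ‖z‖ ^ (n - 1 - i) := by
      rw [← pow_add]
      congr 1
      omega
    rw [norm_mul, norm_pow, h4, mul_div_right_comm]
    refine mul_lt_mul_of_pos_right ((he i).trans_le ?_) (pow_pos hz0 _)
    gcongr
  rw [Finset.sum_const, Finset.card_univ, Fintype.card_fin, nsmul_eq_mul,
    mul_div_cancel₀ _ hn'.ne'] at h2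
  exact lt_irrefl _ h2

/-- A polynomial `1 + e₁ x + … + eₙ xⁿ` is a product of factors `1 - ζ x`. -/
theorem exists_factorization {n : ℕ} (hn : 0 < n) (e : Fin n → ℂ) {ε : ℝ} (hε : 0 < ε)
    (he : ∀ i, ‖e i‖ < ε ^ ((i : ℕ) + 1) / n) : ∃ ζ : Fin n → ℂ, (∀ j, ‖ζ j‖ < ε) ∧
      ∀ x : ℂ, ∏ j, (1 - ζ j * x) = 1 + ∑ i : Fin n, e i * x ^ ((i : ℕ) + 1) := by
  -- The `ζ j` are the roots of the reversed, monic polynomial.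
  open Polynomial in
  let Q : ℂ[X] := X ^ n + ∑ i : Fin n, C (e i) * X ^ (n - 1 - i)
  have hdeg : (∑ i : Fin n, C (e i) * X ^ (n - 1 - i) : ℂ[X]).degree < n := by
    refine (degree_sum_le _ _).trans_lt ((Finset.sup_lt_iff (WithBot.bot_lt_coe n)).2 fun i _ => ?_)
    refine (degree_C_mul_X_pow_le _ _).trans_lt ?_
    exact WithBot.coe_lt_coe.2 (Nat.cast_lt.2 (by omega))
  have hm : Q.Monic := monic_X_pow_add hdeg
  have hnd : Q.natDegree = n := by
    refine natDegree_eq_of_degree_eq_some ?_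
    rw [degree_add_eq_left_of_degree_lt (by rwa [degree_X_pow]), degree_X_pow]
  have hs : Q.Splits := IsAlgClosed.splits Q
  have hcard : Q.roots.card = n := by rw [← hs.natDegree_eq_card_roots, hnd]
  have hev : ∀ z, Q.eval z = z ^ n + ∑ i : Fin n, e i * z ^ (n - 1 - i) := fun z => by
    simp [Q, eval_finsetSum]
  obtain ⟨l, hl⟩ := Quotient.exists_rep Q.roots
  have hlen : l.length = n := by
    rw [← hcard, ← hl]
    rfl
  subst hlen
  have hprod : ∀ z, Q.eval z = ∏ j : Fin l.length, (z - l.get j) := by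
    intro z
    conv_lhs => rw [hs.eq_prod_roots_of_monic hm, ← hl]
    rw [eval_multiset_prod, Multiset.quot_mk_to_coe, Multiset.map_coe, Multiset.map_coe,
      Multiset.prod_coe, List.map_map, ← Fin.prod_univ_fun_getElem]
    simp
  refine ⟨l.get, fun j => norm_lt_of_small_coeff hε he ?_ hn, fun x => ?_⟩
  · rw [← hev, hprod]
    exact Finset.prod_eq_zero (Finset.mem_univ j) (sub_self _)
  · rcases eq_or_ne x 0 with rfl | hx
    · simp
    have h1 := (hprod x⁻¹).symm.trans (hev x⁻¹)
    have h2 : ∏ j, (1 - l.get j * x) = x ^ l.length * ∏ j : Fin l.length, (x⁻¹ - l.get j) := by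
      have h3 : x ^ l.length = ∏ _j : Fin l.length, x := by simp
      rw [h3, ← Finset.prod_mul_distrib]
      refine Finset.prod_congr rfl fun j _ => ?_
      rw [mul_sub, mul_inv_cancel₀ hx, mul_comm]
    rw [h2, h1, mul_add, Finset.mul_sum, ← mul_pow, mul_inv_cancel₀ hx, one_pow]
    congr 1
    refine Finset.sum_congr rfl fun i _ => ?_
    have h3 : x ^ l.length = x ^ ((i : ℕ) + 1) * x ^ (l.length - 1 - i) := by
      rw [← pow_add]
      congr 1
      omega
    rw [h3, inv_pow]
    field_simp

/-- Complete symmetric polynomials in two variables with sum `X` and product `(X - α) / K`. -/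
noncomputable def completeSymm (α K : ℂ) : ℕ → Polynomial ℂ
  | 0 => 1
  | 1 => Polynomial.X
  | i + 2 => Polynomial.X * completeSymm α K (i + 1) -
      Polynomial.C K⁻¹ * (Polynomial.X - Polynomial.C α) * completeSymm α K i

/-- The constraint makes `x y` affine in `x + y`, so the symmetric quotient `(x^{i+1} - y^{i+1}) /
(x - y)` becomes a polynomial in the sum. -/
theorem completeSymm_spec {α K x y : ℂ} (hK : K ≠ 0) (h : x + y = α + K * (x * y)) :
    ∀ i, x ^ (i + 1) - y ^ (i + 1) = (x - y) * (completeSymm α K i).eval (x + y)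
  | 0 => by simp [completeSymm]
  | 1 => by simp [completeSymm]; ring
  | i + 2 => by
    have h1 := completeSymm_spec hK h i
    have h2 := completeSymm_spec hK h (i + 1)
    have h3 : K⁻¹ * (x + y - α) = x * y := by
      rw [h]
      field_simp
      ring
    simp only [completeSymm, Polynomial.eval_sub, Polynomial.eval_mul, Polynomial.eval_X,
      Polynomial.eval_C, h3]
    linear_combination (x + y) * h2 - x * y * h1

theorem completeSymm_monic (α K : ℂ) :
    ∀ i, (completeSymm α K i).Monic ∧ (completeSymm α K i).natDegree = i
  | 0 => by simp [completeSymm]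
  | 1 => by simp [completeSymm, Polynomial.monic_X]
  | i + 2 => by
    have h1 := completeSymm_monic α K i
    have h2 := completeSymm_monic α K (i + 1)
    have h3 : (Polynomial.X * completeSymm α K (i + 1)).Monic := Polynomial.monic_X.mul h2.1
    have h4 : (Polynomial.X * completeSymm α K (i + 1)).natDegree = i + 2 := by
      rw [Polynomial.natDegree_X_mul h2.1.ne_zero, h2.2]
    have h5 : (Polynomial.C K⁻¹ * (Polynomial.X - Polynomial.C α) *
        completeSymm α K i).natDegree < i + 2 := by
      have : (Polynomial.C K⁻¹ * (Polynomial.X - Polynomial.C α) *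
          completeSymm α K i).natDegree ≤ 1 + i := by
        refine Polynomial.natDegree_mul_le.trans (add_le_add ?_ h1.2.le)
        refine (Polynomial.natDegree_C_mul_le _ _).trans (Polynomial.natDegree_X_sub_C_le _)
      omega
    have h6 : (Polynomial.C K⁻¹ * (Polynomial.X - Polynomial.C α) *
        completeSymm α K i).degree < (Polynomial.X * completeSymm α K (i + 1)).degree :=
      Polynomial.degree_lt_degree (by rwa [h4])
    rw [completeSymm]
    exact ⟨h3.sub_of_left h6, by
      rw [Polynomial.natDegree_sub_eq_left_of_natDegree_lt
        (by rwa [h4]), h4]⟩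

/-- Extracting `x k - y k` from each row leaves monic polynomials of degrees `0, …, n - 1` in `x k +
y k`, so the rest is a Vandermonde determinant. -/
theorem det_pow_sub_pow_ne_zero {n : ℕ} {α K : ℂ} {x y : Fin n → ℂ} (hK : K ≠ 0)
    (h : ∀ k, x k + y k = α + K * (x k * y k)) (hxy : ∀ k, x k ≠ y k)
    (hinj : Function.Injective fun k => x k + y k) :
    (Matrix.of fun k i : Fin n => x k ^ ((i : ℕ) + 1) - y k ^ ((i : ℕ) + 1)).det ≠ 0 := by
  have e : (Matrix.of fun k i : Fin n => x k ^ ((i : ℕ) + 1) - y k ^ ((i : ℕ) + 1)) =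
      Matrix.diagonal (fun k => x k - y k) *
        Matrix.of fun k i : Fin n => (completeSymm α K i).eval (x k + y k) := by
    ext k i
    rw [Matrix.diagonal_mul, Matrix.of_apply, Matrix.of_apply, completeSymm_spec hK (h k)]
  rw [e, Matrix.det_mul, Matrix.det_diagonal,
    ← Matrix.det_eval_matrixOfPolynomials_eq_det_vandermonde (fun k => x k + y k)
      (fun i : Fin n => completeSymm α K i) (fun i => (completeSymm_monic α K i).2)
      fun i => (completeSymm_monic α K i).1]
  exact mul_ne_zero (Finset.prod_ne_zero_iff.2 fun k _ => sub_ne_zero.2 (hxy k))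
    (Matrix.det_vandermonde_ne_zero_iff.2 hinj)

/-- Ratios close to `1` are interpolated by products of Möbius factors close to `1`. -/
theorem eventually_exists_prod_eq {n : ℕ} {α K : ℂ} {x y : Fin n → ℂ} (hK : K ≠ 0)
    (h : ∀ k, x k + y k = α + K * (x k * y k)) (hxy : ∀ k, x k ≠ y k)
    (hinj : Function.Injective fun k => x k + y k) {ε : ℝ} (hε : 0 < ε) :
    ∀ᶠ a : Fin n → ℂ in 𝓝 1, ∃ ζ : Fin n → ℂ, (∀ j, ‖ζ j‖ < ε) ∧
      ∀ k, ∏ j, (1 - ζ j * x k) = a k * ∏ j, (1 - ζ j * y k) := by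
  rcases Nat.eq_zero_or_pos n with rfl | hn
  · exact Eventually.of_forall fun a => ⟨0, fun j => j.elim0, fun k => k.elim0⟩
  have hn' : (0 : ℝ) < n := Nat.cast_pos.2 hn
  -- Expanding the product as `1 + ∑ e_i x^{i+1}` turns the condition into the linear system `A a ·
  -- e = a - 1`, which near `a = 1` is invertible with small solution.
  let A : (Fin n → ℂ) → Matrix (Fin n) (Fin n) ℂ := fun a =>
    Matrix.of fun k i => x k ^ ((i : ℕ) + 1) - a k * y k ^ ((i : ℕ) + 1)
  have hA : Continuous A := by
    refine continuous_matrix fun k i => ?_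
    simp only [A, Matrix.of_apply]
    fun_prop
  have hA1 : (A 1).det ≠ 0 := by
    have := det_pow_sub_pow_ne_zero hK h hxy hinj
    simpa only [A, Pi.one_apply, one_mul] using this
  let E : (Fin n → ℂ) → Fin n → ℂ := fun a => ((A a).det)⁻¹ • (A a).adjugate.mulVec (a - 1)
  have hE : Tendsto E (𝓝 1) (𝓝 0) := by
    have h0 : ContinuousAt (fun a => (A a).adjugate.mulVec (a - 1)) 1 :=
      (hA.matrix_adjugate.matrix_mulVec (continuous_id.sub continuous_const)).continuousAt
    have h1 : ContinuousAt E 1 := (hA.matrix_det.continuousAt.inv₀ hA1).smul h0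
    have h2 : E 1 = 0 := by simp [E]
    simpa only [h2] using h1.tendsto
  have hsmall : ∀ᶠ a in 𝓝 1, ∀ i, ‖E a i‖ < ε ^ ((i : ℕ) + 1) / n := by
    refine eventually_all.2 fun i => ?_
    have h1 : Tendsto (fun a => ‖E a i‖) (𝓝 1) (𝓝 0) := by
      simpa using (tendsto_pi_nhds.1 hE i).norm
    exact h1.eventually (gt_mem_nhds (by positivity))
  filter_upwards [hsmall, hA.matrix_det.continuousAt.eventually (isOpen_ne.mem_nhds hA1)]
    with a h1 h2
  obtain ⟨ζ, hζ, hζ'⟩ := exists_factorization hn (E a) hε h1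
  refine ⟨ζ, hζ, fun k => ?_⟩
  have h3 : (A a).mulVec (E a) = a - 1 := by
    simp only [E]
    rw [Matrix.mulVec_smul, Matrix.mulVec_mulVec, Matrix.mul_adjugate, Matrix.smul_mulVec,
      Matrix.one_mulVec, smul_smul, inv_mul_cancel₀ h2, one_smul]
  have h4 := congr_fun h3 k
  simp only [A, Matrix.mulVec, dotProduct, Matrix.of_apply, Pi.sub_apply, Pi.one_apply] at h4
  rw [hζ', hζ', mul_add, Finset.mul_sum]
  have h5 : ∑ i : Fin n, (x k ^ ((i : ℕ) + 1) - a k * y k ^ ((i : ℕ) + 1)) * E a i =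
      ∑ i : Fin n, E a i * x k ^ ((i : ℕ) + 1) -
        ∑ i : Fin n, a k * (E a i * y k ^ ((i : ℕ) + 1)) := by
    rw [← Finset.sum_sub_distrib]
    exact Finset.sum_congr rfl fun i _ => by ring
  rw [h5] at h4
  linear_combination h4

end

section
open Filter Topology

/-! ### All generic amplitudes are linked -/

section
variable {M n : ℕ} {K : ℂ} {p q : Fin n → ℂ} (h : SpectralData M K p q)
include h

theorem SpectralData.inv_add_inv (k : Fin n) :
    (p k + K)⁻¹ + (q k + K)⁻¹ = (1 + K)⁻¹ + K * ((p k + K)⁻¹ * (q k + K)⁻¹) := by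
  have h1 := h.p_add_ne k
  have h2 := h.q_add_ne k
  have h3 := h.one_add_K_ne
  field_simp
  linear_combination (-1 : ℂ) * h.rel k

theorem SpectralData.inv_ne_inv (k : Fin n) : (p k + K)⁻¹ ≠ (q k + K)⁻¹ := fun h1 =>
  h.p_ne_q k k (add_right_cancel (inv_injective h1))

/-- The sum determines the product, hence `p + q`, `p q` and the unordered pair `{p, q}`; `p_ne_q`
excludes the swap. -/
theorem SpectralData.injective_inv_add_inv :
    Function.Injective fun k => (p k + K)⁻¹ + (q k + K)⁻¹ := by
  intro j k hjk
  have h1 : (p j + K)⁻¹ * (q j + K)⁻¹ = (p k + K)⁻¹ * (q k + K)⁻¹ := by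
    simp only [h.inv_add_inv] at hjk
    exact mul_left_cancel₀ h.K_ne (add_left_cancel hjk)
  have h2 : (p j + K) * (q j + K) = (p k + K) * (q k + K) := by
    rw [← mul_inv, ← mul_inv] at h1
    exact inv_injective h1
  have h3 : p j + q j = p k + q k := by
    have h4 : (1 + K) * (p j + q j) = (1 + K) * (p k + q k) := by
      linear_combination h2 - h.rel j + h.rel k
    exact mul_left_cancel₀ h.one_add_K_ne h4
  have h5 : (p j - p k) * (p j - q k) = 0 := by
    linear_combination p j * h3 - h.rel j + h.rel k - h3
  rcases mul_eq_zero.1 h5 with h6 | h6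
  · exact h.p_inj (sub_eq_zero.1 h6)
  · exact absurd (sub_eq_zero.1 h6) (h.p_ne_q j k)

theorem SpectralData.bt_neg_add (ζ : ℂ) (f : Fin n → ℂ) (k : Fin n) :
    bt K p q (-K + ζ) f k = f k * ((1 - ζ * (p k + K)⁻¹) / (1 - ζ * (q k + K)⁻¹)) := by
  have h1 := h.p_add_ne k
  have h2 := h.q_add_ne k
  have e1 : 1 - ζ * (p k + K)⁻¹ = (p k - (-K + ζ)) / (p k - -K) := by
    rw [sub_neg_eq_add]
    field_simp
    ring
  have e2 : 1 - ζ * (q k + K)⁻¹ = (q k - (-K + ζ)) / (q k - -K) := by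
    rw [sub_neg_eq_add]
    field_simp
    ring
  rw [bt, shift, shift, e1, e2, div_div_div_comm]

end

section
variable {N M n : ℕ} [NeZero N] [NeZero M] {kap : ℂ} {p q : Fin n → ℂ}

/-- A composition of Bäcklund transformations close to the identity is a similarity. -/
theorem Generic.eventually_linked_prod (h : SpectralData M (kap ^ N) p q) {f₀ : Fin n → ℂ}
    (hf : Generic M (kap ^ N) p q f₀) (s : Finset (Fin n)) :
    ∀ᶠ ζ : Fin n → ℂ in 𝓝 0, Linked N M kap p q f₀ fun k =>
      f₀ k * ∏ j ∈ s, (1 - ζ j * (p k + kap ^ N)⁻¹) / (1 - ζ j * (q k + kap ^ N)⁻¹) := by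
  induction s using Finset.induction_on with
  | empty => exact Eventually.of_forall fun ζ => by simpa using hf.linked
  | insert i s hi ih =>
    -- The next transformation starts from amplitudes already moved away from `f₀` but still close
    -- to it, which is why `eventually_linked_bt` lets the initial amplitudes vary.
    have hT : Tendsto (fun ζ : Fin n → ℂ => ((fun k => f₀ k * ∏ j ∈ s,
        (1 - ζ j * (p k + kap ^ N)⁻¹) / (1 - ζ j * (q k + kap ^ N)⁻¹)), ζ i))
        (𝓝 0) (𝓝 (f₀, (0 : ℂ))) := by
      refine Tendsto.prodMk_nhds (tendsto_pi_nhds.2 fun k => ?_)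
        ((continuous_apply i).tendsto (0 : Fin n → ℂ))
      have h1 : ∀ (j : Fin n) (c : ℂ), Tendsto (fun ζ : Fin n → ℂ => 1 - ζ j * c) (𝓝 0) (𝓝 1) := by
        intro j c
        have : Continuous fun ζ : Fin n → ℂ => 1 - ζ j * c := by fun_prop
        simpa using this.tendsto 0
      have h2 := (tendsto_finsetProd s fun j _ =>
        (h1 j (p k + kap ^ N)⁻¹).div (h1 j (q k + kap ^ N)⁻¹) one_ne_zero).const_mul (f₀ k)
      simpa using h2
    filter_upwards [ih, hT.eventually (hf.eventually_linked_bt h)] with ζ h1 h2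
    refine h1.trans ?_
    convert h2 using 1
    funext k
    rw [h.bt_neg_add, Finset.prod_insert hi]
    ring

/-- The `n` ratios `f k / f₀ k` are matched by `n` small parameters `ζ j`; `f₀ k ≠ 0` makes the
ratios available. -/
theorem Generic.eventually_linked (h : SpectralData M (kap ^ N) p q) {f₀ : Fin n → ℂ}
    (hf : Generic M (kap ^ N) p q f₀) : ∀ᶠ f in 𝓝 f₀, Linked N M kap p q f₀ f := by
  have hne : ∀ᶠ ζ : Fin n → ℂ in 𝓝 0, ∀ k j, 1 - ζ j * (q k + kap ^ N)⁻¹ ≠ 0 := by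
    refine eventually_all.2 fun k => eventually_all.2 fun j => ?_
    have : Continuous fun ζ : Fin n → ℂ => 1 - ζ j * (q k + kap ^ N)⁻¹ := by fun_prop
    refine (this.tendsto 0).eventually (isOpen_ne.mem_nhds ?_)
    simp
  obtain ⟨ε, hε, hζ⟩ := Metric.eventually_nhds_iff.1
    ((hf.eventually_linked_prod h Finset.univ).and hne)
  have h1 := eventually_exists_prod_eq h.K_ne h.inv_add_inv h.inv_ne_inv h.injective_inv_add_inv hε
  have h2 : Tendsto (fun f : Fin n → ℂ => fun k => f k / f₀ k) (𝓝 f₀) (𝓝 1) := by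
    refine tendsto_pi_nhds.2 fun k => ?_
    have := ((continuous_apply (A := fun _ : Fin n => ℂ) k).tendsto f₀).div_const (f₀ k)
    simpa [div_self (hf.amp_ne k)] using this
  filter_upwards [h2.eventually h1] with f hf'
  obtain ⟨ζ, hζ1, hζ2⟩ := hf'
  obtain ⟨h3, h4⟩ := hζ (y := ζ) (by rw [dist_zero_right]; exact (pi_norm_lt_iff hε).2 hζ1)
  convert h3 using 1
  funext k
  rw [Finset.prod_div_distrib, hζ2, mul_div_cancel_right₀ _
    (Finset.prod_ne_zero_iff.2 fun j _ => h4 k j), mul_div_cancel₀ _ (hf.amp_ne k)]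

/-- On the line through two amplitudes, one of which is generic, all but finitely many are. -/
theorem Generic.finite_not_generic {f g : Fin n → ℂ} {K : ℂ} {t₀ : ℂ}
    (hf : Generic M K p q (f + t₀ • (g - f))) :
    {t : ℂ | ¬ Generic M K p q (f + t • (g - f))}.Finite := by
  obtain ⟨P, -, hP⟩ := exists_generic_iff M K p q
  let R : Polynomial ℂ :=
    MvPolynomial.aeval (fun k => Polynomial.C (f k) + Polynomial.X * Polynomial.C (g k - f k)) P
  have hR : ∀ t, R.eval t = MvPolynomial.eval (f + t • (g - f)) P := by
    intro t
    have h1 : ((Polynomial.aeval t).comp (MvPolynomial.aeval fun k =>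
        Polynomial.C (f k) + Polynomial.X * Polynomial.C (g k - f k)) :
          MvPolynomial (Fin n) ℂ →ₐ[ℂ] ℂ) = MvPolynomial.aeval (f + t • (g - f)) := by
      ext k
      simp
    have h2 := DFunLike.congr_fun h1 P
    rw [AlgHom.comp_apply, Polynomial.coe_aeval_eq_eval, MvPolynomial.aeval_eq_eval] at h2
    exact h2
  have hR0 : R ≠ 0 := fun h0 => (hP _).2 hf (by rw [← hR, h0, Polynomial.eval_zero])
  refine (R.roots.toFinset.finite_toSet).subset fun t ht => ?_
  simp only [Set.mem_ofPred_eq, ← hP, ← hR, not_not] at ht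
  simpa [hR0] using ht

/-- Generic points on the complex line through `f` and `g` form the complement of a finite set in
`ℂ`, which is connected, and linkage is there an equivalence relation with open classes. -/
theorem Generic.linked_generic (h : SpectralData M (kap ^ N) p q) {f g : Fin n → ℂ}
    (hf : Generic M (kap ^ N) p q f) (hg : Generic M (kap ^ N) p q g) :
    Linked N M kap p q f g := by
  have e0 : f + (0 : ℂ) • (g - f) = f := by simp
  have e1 : f + (1 : ℂ) • (g - f) = g := by simp
  have hfin := Generic.finite_not_generic (t₀ := 0) (f := f) (g := g) (by rwa [e0])
  have hconn : IsPreconnected {t : ℂ | ¬ Generic M (kap ^ N) p q (f + t • (g - f))}ᶜ :=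
    (hfin.countable.isPathConnected_compl_of_one_lt_rank
      (by rw [Complex.rank_real_complex]; exact Nat.one_lt_ofNat)).isConnected.isPreconnected
  have hcont : Continuous fun t : ℂ => f + t • (g - f) := by fun_prop
  have key := hconn.induction₂ (fun s t => Linked N M kap p q (f + s • (g - f)) (f + t • (g - f)))
    (fun t ht => ?_) (fun _ _ _ _ _ _ h1 h2 => h1.trans h2) (fun _ _ _ _ h1 => h1.symm)
    (x := 0) (y := 1) (by simpa using hf) (by simpa using hg)
  · rwa [e0, e1] at key
  · exact (hcont.continuousAt.eventually ((not_not.1 ht).eventually_linked h)).filter_mono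
      nhdsWithin_le_nhds

/-! ### Degenerate amplitudes -/

theorem continuous_localLax {N : ℕ} (χ : ZMod N → ℂ) (h kap mu : ℂ) (a b : ZMod N) (i j : Fin 2) :
    Continuous fun z : ℂ × ℂ => localLax χ h kap mu z.1 z.2 a b i j := by
  fin_cases i <;> fin_cases j
  · change Continuous fun z : ℂ × ℂ => (if b = a then (1 : ℂ) else 0) +
      if b = a - 1 then kap * mu * z.1 * z.2 * χ a else 0
    split_ifs <;> fun_prop
  · change Continuous fun z : ℂ × ℂ => if b = a then -(h * mu * z.1 * χ a) else 0
    split_ifs <;> fun_prop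
  · change Continuous fun z : ℂ × ℂ => if b = a - 1 then z.2 else 0
    split_ifs <;> fun_prop
  · exact continuous_const

theorem tendsto_transfer {Y : Type*} {l : Filter Y} {u w : Y → ZMod M → ℂ} {u₀ w₀ : ZMod M → ℂ}
    (hu : ∀ m, Tendsto (fun y => u y m) l (𝓝 (u₀ m)))
    (hw : ∀ m, Tendsto (fun y => w y m) l (𝓝 (w₀ m))) (lam : ℂ) :
    Tendsto (fun y => transfer N M lam kap (u y) (w y)) l (𝓝 (transfer N M lam kap u₀ w₀)) := by
  simp only [transfer_eq_mpo]
  refine tendsto_mpo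
    (A := fun y m a b => localLax (chi N) (omegaHalf N) kap lam⁻¹ (u y m) (w y m) a b)
    (A₀ := fun m a b => localLax (chi N) (omegaHalf N) kap lam⁻¹ (u₀ m) (w₀ m) a b)
    fun m a b i j => ?_
  have h1 := (continuous_localLax (chi N) (omegaHalf N) kap lam⁻¹ a b i j).tendsto (u₀ m, w₀ m)
  have h2 : Tendsto (fun y => (u y m, w y m)) l (𝓝 (u₀ m, w₀ m)) := (hu m).prodMk_nhds (hw m)
  have h3 := h1.comp h2
  simp only [Function.comp_def] at h3
  exact h3

/-- A limit of invertible intertwiners is, after rescaling, a nonzero intertwiner. -/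
theorem exists_intertwiner_of_tendsto {d X Y : Type*} [Fintype d] [DecidableEq d] [Nonempty d]
    {l : Filter Y} [l.NeBot] {A B : Y → X → Matrix d d ℂ} {A₀ B₀ : X → Matrix d d ℂ}
    (hA : ∀ x, Tendsto (fun y => A y x) l (𝓝 (A₀ x)))
    (hB : ∀ x, Tendsto (fun y => B y x) l (𝓝 (B₀ x)))
    (h : ∀ᶠ y in l, ∃ S, S ≠ 0 ∧ ∀ x, A y x * S = S * B y x) :
    ∃ S, S ≠ 0 ∧ ∀ x, A₀ x * S = S * B₀ x := by
  let : NormedAddCommGroup (Matrix d d ℂ) := Matrix.normedAddCommGroup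
  let : NormedSpace ℝ (Matrix d d ℂ) := Matrix.normedSpace
  have h1 : ∀ y, ∃ S : Matrix d d ℂ, (∃ S : Matrix d d ℂ, S ≠ 0 ∧ ∀ x, A y x * S = S * B y x) →
      ‖S‖ = 1 ∧ ∀ x, A y x * S = S * B y x := by
    intro y
    by_cases hy : ∃ S : Matrix d d ℂ, S ≠ 0 ∧ ∀ x, A y x * S = S * B y x
    · obtain ⟨S, hS0, hS⟩ := hy
      refine ⟨‖S‖⁻¹ • S, fun _ => ⟨?_, fun x => ?_⟩⟩
      · rw [norm_smul, norm_inv, norm_norm, inv_mul_cancel₀ (norm_ne_zero_iff.2 hS0)]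
      · rw [Matrix.mul_smul, Matrix.smul_mul, hS]
    · exact ⟨0, fun h => absurd h hy⟩
  choose S hS using h1
  -- Along an ultrafilter the unit-norm intertwiners converge by compactness of the sphere; each `S
  -- y` serves all `x`, so one limit does too.
  obtain ⟨U, hU⟩ := Ultrafilter.exists_le l
  have h2 : ∀ᶠ y in (U : Filter Y), ‖S y‖ = 1 ∧ ∀ x, A y x * S y = S y * B y x :=
    (h.filter_mono hU).mono fun y hy => hS y hy
  have : FiniteDimensional ℝ (Matrix d d ℂ) := inferInstance
  have : ProperSpace (Matrix d d ℂ) := FiniteDimensional.proper ℝ _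
  have hcomp : IsCompact (Metric.sphere (0 : Matrix d d ℂ) 1) := isCompact_sphere _ _
  obtain ⟨S₀, hS₀, hlim⟩ := hcomp.ultrafilter_le_nhds (U.map S) (by
    rw [le_principal_iff]
    exact h2.mono fun y hy => by simpa using hy.1)
  refine ⟨S₀, fun h0 => ?_, fun x => ?_⟩
  · rw [h0] at hS₀
    simp at hS₀
  · have t1 : Tendsto S U (𝓝 S₀) := hlim
    have t2 := ((hA x).mono_left hU).mul t1
    have t3 := t1.mul ((hB x).mono_left hU)
    exact tendsto_nhds_unique_of_eventuallyEq t2 t3 (h2.mono fun y hy => hy.2 x)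

theorem charpoly_eq_of_mul_eq {d : Type*} [Fintype d] [DecidableEq d] {A B S : Matrix d d ℂ}
    (hS : IsUnit S) (h : A * S = S * B) : A.charpoly = B.charpoly := by
  obtain ⟨S, rfl⟩ := hS
  rw [← Matrix.charpoly_units_conj' S A, mul_assoc, h, ← mul_assoc, ← Matrix.coe_units_inv,
    Units.inv_mul, one_mul]

/-- Both amplitude vectors are approached along lines towards a common generic `g`, with the given
roots continued. -/
theorem exists_intertwiner (h : SpectralData M (kap ^ N) p q) {f f' : Fin n → ℂ}
    {τ θ τ' θ' : ZMod M → ℂ} (hr : IsRoots N (kap ^ N) p q f τ θ)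
    (hr' : IsRoots N (kap ^ N) p q f' τ' θ') (hτ : ∀ m, τ m ≠ 0) (hθ : ∀ m, θ m ≠ 0)
    (hτ' : ∀ m, τ' m ≠ 0) (hθ' : ∀ m, θ' m ≠ 0) :
    ∃ S : Op N M, S ≠ 0 ∧ ∀ lam, transfer N M lam kap (uOf N τ) (wOf θ) * S =
      S * transfer N M lam kap (uOf N τ') (wOf θ') := by
  obtain ⟨P, hP0, hP⟩ := exists_generic_iff M (kap ^ N) p q
  obtain ⟨g, hg⟩ : ∃ g, Generic M (kap ^ N) p q g := by
    by_contra! hc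
    exact hP0 (MvPolynomial.funext fun x => by
      rw [map_zero]
      exact not_not.1 fun hx => hc x ((hP x).1 hx))
  have hline : ∀ e : Fin n → ℂ, Tendsto (fun t : ℂ => e + t • (g - e)) (𝓝[≠] 0) (𝓝 e) ∧
      ∀ᶠ t in 𝓝[≠] (0 : ℂ), Generic M (kap ^ N) p q (e + t • (g - e)) := by
    intro e
    constructor
    · have : Continuous fun t : ℂ => e + t • (g - e) := by fun_prop
      simpa using (this.tendsto 0).mono_left nhdsWithin_le_nhds
    · have hfin := Generic.finite_not_generic (t₀ := 1) (f := e) (g := g) (by simpa using hg)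
      have := (hfin.subset (Set.sdiff_subset (t := {0}))).isClosed.isOpen_compl.mem_nhds
        (show (0 : ℂ) ∈ _ by simp)
      filter_upwards [nhdsWithin_le_nhds this, self_mem_nhdsWithin] with t h1 h2
      by_contra h3
      exact h1 ⟨h3, h2⟩
  obtain ⟨T, Θ, hR, tT, tΘ⟩ := exists_tendsto_isRoots hr (hline f).1
  obtain ⟨T', Θ', hR', tT', tΘ'⟩ := exists_tendsto_isRoots hr' (hline f').1
  refine exists_intertwiner_of_tendsto
    (A := fun t lam => transfer N M lam kap (uOf N (T t)) (wOf (Θ t)))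
    (B := fun t lam => transfer N M lam kap (uOf N (T' t)) (wOf (Θ' t)))
    (fun lam => tendsto_transfer (tendsto_uOf hτ tT) (tendsto_wOf hθ tΘ) lam)
    (fun lam => tendsto_transfer (tendsto_uOf hτ' tT') (tendsto_wOf hθ' tΘ') lam) ?_
  filter_upwards [(hline f).2, (hline f').2] with t h1 h2
  obtain ⟨S, hS, hS'⟩ := h1.linked_generic h h2 _ _ _ _ (hR t) (hR' t)
  exact ⟨S, hS.ne_zero, hS'⟩

end

end

end RelToda

/-! ### Generic and degenerate states together -/

theorem proposition2 (N M : ℕ) [NeZero N] [NeZero M] (kap : ℂ) (φ : Fin (M - 1) → ℝ)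
    (hφ_inj : Function.Injective φ)
    (hφ_mem : ∀ k, ∃ j : ℕ, 1 ≤ j ∧ j ≤ M - 1 ∧ φ k = j * Real.pi / M)
    (hadm : RelToda.Admissible (kap ^ N) φ) :
    ∃ P : MvPolynomial (Fin (M - 1)) ℂ, P ≠ 0 ∧
      ∀ s s' : RelToda.SolitonState N M kap φ,
        (MvPolynomial.eval s.f P ≠ 0 → MvPolynomial.eval s'.f P ≠ 0 →
          ∀ lam : ℂ, lam ≠ 0 → (s.transfer lam).charpoly = (s'.transfer lam).charpoly) ∧
        ∃ S : RelToda.Op N M, S ≠ 0 ∧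
          (∀ lam : ℂ, lam ≠ 0 → s.transfer lam * S = S * s'.transfer lam) ∧
          (MvPolynomial.eval s.f P ≠ 0 → MvPolynomial.eval s'.f P ≠ 0 → IsUnit S) := by
  open RelToda in
  suffices H : ∃ P : MvPolynomial (Fin (M - 1)) ℂ, P ≠ 0 ∧ ∀ s s' : SolitonState N M kap φ,
      (MvPolynomial.eval s.f P ≠ 0 → MvPolynomial.eval s'.f P ≠ 0 →
        Similar N M kap s.u s.w s'.u s'.w) ∧
      ∃ S : Op N M, S ≠ 0 ∧ ∀ lam, s.transfer lam * S = S * s'.transfer lam by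
    obtain ⟨P, hP0, hP⟩ := H
    refine ⟨P, hP0, fun s s' => ⟨fun h1 h2 lam _ => ?_, ?_⟩⟩
    · obtain ⟨S, hS, hSt⟩ := (hP s s').1 h1 h2
      exact charpoly_eq_of_mul_eq hS (hSt lam)
    · by_cases hg : MvPolynomial.eval s.f P ≠ 0 ∧ MvPolynomial.eval s'.f P ≠ 0
      · obtain ⟨S, hS, hSt⟩ := (hP s s').1 hg.1 hg.2
        exact ⟨S, hS.ne_zero, fun lam _ => hSt lam, fun _ _ => hS⟩
      · obtain ⟨S, hS, hSt⟩ := (hP s s').2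
        exact ⟨S, hS, fun lam _ => hSt lam, fun h1 h2 => absurd ⟨h1, h2⟩ hg⟩
  -- For `M = 1` admissibility says nothing about `K`, but there are no amplitudes: states differ
  -- only by phases and `P = 1` works.
  rcases Nat.eq_zero_or_pos (M - 1) with hM | hM
  · have : IsEmpty (Fin (M - 1)) := by rw [hM]; infer_instance
    have hs : ∀ s s' : SolitonState N M kap φ, Similar N M kap s.u s.w s'.u s'.w := by
      intro s s'
      have hf : s.f = s'.f := Subsingleton.elim _ _
      refine similar_of_pow_eq (uOf_ne_zero s.τ_ne_zero) (wOf_ne_zero s.θ_ne_zero)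
        (fun m => ?_) fun m => ?_
      · refine (uOf_pow s.τ m).trans (Eq.trans ?_ (uOf_pow s'.τ m).symm)
        simp only [s.τ_pow, s'.τ_pow, hf]
      · refine (wOf_pow N s.θ m).trans (Eq.trans ?_ (wOf_pow N s'.θ m).symm)
        simp only [s.θ_pow, s'.θ_pow, hf]
    refine ⟨1, one_ne_zero, fun s s' => ⟨fun _ _ => hs s s', ?_⟩⟩
    obtain ⟨S, hS, hSt⟩ := hs s s'
    exact ⟨S, hS.ne_zero, hSt⟩
  · have h := spectralData hM (Nat.sub_add_cancel (NeZero.one_le)) hφ_inj hφ_mem hadm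
    obtain ⟨P, hP0, hP⟩ := exists_generic_iff M (kap ^ N) (fun k => Delta (kap ^ N) (φ k))
      fun k => DeltaStar (kap ^ N) (φ k)
    have hr : ∀ s : SolitonState N M kap φ, IsRoots N (kap ^ N) (fun k => Delta (kap ^ N) (φ k))
        (fun k => DeltaStar (kap ^ N) (φ k)) s.f s.τ s.θ := by
      intro s
      refine ⟨fun m => ?_, fun m => ?_⟩
      · rw [s.τ_pow, tau_eq_tauAt h]
      · rw [s.θ_pow, theta, tau_eq_tauAt h]
        simp only [cFun_eq_shift h]
    refine ⟨P, hP0, fun s s' => ⟨fun h1 h2 => ?_, ?_⟩⟩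
    · exact ((hP _).1 h1).linked_generic h ((hP _).1 h2) _ _ _ _ (hr s) (hr s')
    · exact exists_intertwiner h (hr s) (hr s') s.τ_ne_zero s.θ_ne_zero s'.τ_ne_zero s'.θ_ne_zero
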